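/- **Theorem 6.15.** Let $k$ be a field with separable closure $\overline{k}$ and absolute Galois group $\mathcal{G}=\mathrm{Gal}(\overline{k}/k)$. For an algebraic $k$-torus $T$, let $k(T)$ be its function field and let $\widehat{T}=\mathrm{Hom}(T\times_k\overline{k},\mathbb{G}_{m,\overline{k}})$ be its character lattice, with its $\mathcal{G}$-action. The *permutation order* of $\widehat{T}$ is the smallest integer $a\ge 1$ such that $a\cdot\mathrm{id}_{\widehat{T}}$ factors $\mathcal{G}$-equivariantly as $\widehat{T}\to P\to\widehat{T}$ for some permutation $\mathcal{G}$-lattice $P=\mathbb{Z}[X]$, where $X$ is a finite set with continuous $\mathcal{G}$-action. For algebraic $k$-tori $T_1,T_2$, let $T_1\otimes T_2$ denote the algebraic $k$-torus (unique up to isomorphism) whose character lattice is isomorphic as a $\mathcal{G}$-lattice to $\widehat{T}_1\otimes_{\mathbb{Z}}\widehat{T}_2$, with diagonal action. The torus $T$ is *stably $k$-rational* if there are integers $m,n,r\ge 0$ and a $k$-isomorphism $k(T)(y_1,\dots,y_m)\simeq k(x_1,\dots,x_n)(z_1,\dots,z_r)$, all the variables being independent. It is *retract $k$-rational* if there is a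 $k$-subalgebra $R\subset k(T)$ with quotient field $k(T)$, together with an integer $n\ge 0$, a polynomial $f\in k[x_1,\dots,x_n]$ and $k$-algebra homomorphisms $\varphi:R\to k[x_1,\dots,x_n][1/f]$ and $\psi:k[x_1,\dots,x_n][1/f]\to R$ with $\psi\circ\varphi=\mathrm{id}_R$. Let $T_1$ and $T_2$ be algebraic $k$-tori such that the permutation orders of $\widehat{T}_1$ and $\widehat{T}_2$ are coprime. 1. If $T_1$ and $T_2$ are stably $k$-rational, then $T_1\otimes T_2$ is stably $k$-rational. 2. If $T_1$ and $T_2$ are retract $k$-rational, then $T_1\otimes T_2$ is retract $k$-rational. -/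

import Mathlib

open scoped TensorProduct

universe u

noncomputable section

/-! ### Rationality notions for field extensions -/

/-- `K` and `K'` are stably `k`-isomorphic: `K(y₁,…,yₘ) ≃ K'(z₁,…,zₙ)` over `k` for some
`m`, `n`. -/
def IsStablyIsomorphic (k K K' : Type*) [Field k] [Field K] [Algebra k K]
    [Field K'] [Algebra k K'] : Prop :=
  ∃ m n : ℕ, Nonempty (FractionRing (MvPolynomial (Fin m) K) ≃ₐ[k]
    FractionRing (MvPolynomial (Fin n) K'))

/-- `K` is stably `k`-rational: it is stably `k`-isomorphic to a rational function field
`k(x₁,…,xₙ)`. -/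
def IsStablyRational (k K : Type*) [Field k] [Field K] [Algebra k K] : Prop :=
  ∃ n : ℕ, IsStablyIsomorphic k K (FractionRing (MvPolynomial (Fin n) k))

/-- `K` is retract `k`-rational: there is a `k`-subalgebra `R` of `K` with quotient field `K` whose
identity map factors, as a `k`-algebra homomorphism, through a localized polynomial ring
`k[x₁,…,xₙ][1/f]`. -/
def IsRetractRational (k K : Type*) [Field k] [Field K] [Algebra k K] : Prop :=
  ∃ R : Subalgebra k K, IsFractionRing R K ∧
    ∃ (n : ℕ) (f : MvPolynomial (Fin n) k) (φ : R →ₐ[k] Localization.Away f)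
      (ψ : Localization.Away f →ₐ[k] R), ψ.comp φ = AlgHom.id k R

/-! ### The permutation order of a lattice -/

/-- The permutation order of a `G`-lattice `M`: the smallest integer `a ≥ 1` such that `a • id_M`
factors `G`-equivariantly as `M → ℤ[X] → M` through a permutation `G`-lattice `ℤ[X]`, where `X` is a
finite `G`-set on which `G` acts continuously (i.e. with open stabilisers). Every finite set is in
bijection with some `Fin n`, so it is enough to consider `X = Fin n`. -/
def permutationOrder {G M : Type*} [Group G] [TopologicalSpace G] [AddCommGroup M]
    (ρ : Representation ℤ G M) : ℕ :=
  sInf {a : ℕ | 1 ≤ a ∧ ∃ (n : ℕ) (_ : MulAction G (Fin n)),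
    (∀ x : Fin n, IsOpen (MulAction.stabilizer G x : Set G)) ∧
    ∃ (f : ρ.IntertwiningMap (Representation.ofMulAction ℤ G (Fin n)))
      (g : (Representation.ofMulAction ℤ G (Fin n)).IntertwiningMap ρ),
      ∀ m : M, g (f m) = a • m}

/-! ### Characters of affine group schemes, and the Galois action -/

section Characters

variable (k F A : Type*) [Field k] [Field F] [Algebra k F] [CommRing A] [HopfAlgebra k A]

/-- The characters `T ×ₖ F → 𝔾ₘ` of the affine `k`-group scheme `T = Spec A` over a field extension
`F` of `k`, as the invertible functions `χ` on `T ×ₖ F` with `χ(gh) = χ(g)χ(h)`, i.e. the group-like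
elements of the Hopf algebra `F ⊗ A` over `F`. -/
def Character : Type _ := GroupLike F (F ⊗[k] A)

instance : CommGroup (Character k F A) :=
  inferInstanceAs (CommGroup (GroupLike F (F ⊗[k] A)))

variable {F}

/-- The semilinear action `σ ⊗ id` of `σ ∈ Gal(F/k)` on `F ⊗ A`. -/
def galMap (σ : Gal(F/k)) : F ⊗[k] A →ₐ[k] F ⊗[k] A :=
  Algebra.TensorProduct.map (σ : F →ₐ[k] F) (AlgHom.id k A)

variable {k A}

@[simp]
theorem galMap_tmul (σ : Gal(F/k)) (c : F) (a : A) :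
    galMap k A σ (c ⊗ₜ a) = σ c ⊗ₜ a := rfl

theorem galMap_one (x : F ⊗[k] A) : galMap k A 1 x = x := by
  induction x with
  | zero => simp
  | tmul c a => simp
  | add x y hx hy => rw [map_add, hx, hy]

theorem galMap_mul (σ τ : Gal(F/k)) (x : F ⊗[k] A) :
    galMap k A (σ * τ) x = galMap k A σ (galMap k A τ x) := by
  induction x with
  | zero => simp
  | tmul c a => simp
  | add x y hx hy => simp only [map_add, hx, hy]

theorem counit_galMap (σ : Gal(F/k)) (x : F ⊗[k] A) :
    Coalgebra.counit (R := F) (galMap k A σ x) = σ (Coalgebra.counit (R := F) x) := by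
  induction x with
  | zero => simp
  | tmul c a => simp [TensorProduct.counit_tmul, Algebra.smul_def]
  | add x y hx hy => simp only [map_add, hx, hy]

variable (k A) in
/-- The semilinear action of `σ ∈ Gal(F/k)` on `(F ⊗ A) ⊗ (F ⊗ A)`. -/
def galMapTensor (σ : Gal(F/k)) :
    (F ⊗[k] A) ⊗[F] (F ⊗[k] A) →+* (F ⊗[k] A) ⊗[F] (F ⊗[k] A) :=
  Algebra.TensorProduct.mapRingHom (σ : F →+* F)
    (galMap k A σ : F ⊗[k] A →+* F ⊗[k] A) (galMap k A σ : F ⊗[k] A →+* F ⊗[k] A)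
    (by ext c; simp [Algebra.TensorProduct.algebraMap_apply])
    (by ext c; simp [Algebra.TensorProduct.algebraMap_apply])

@[simp]
theorem galMapTensor_tmul (σ : Gal(F/k)) (x y : F ⊗[k] A) :
    galMapTensor k A σ (x ⊗ₜ y) = galMap k A σ x ⊗ₜ galMap k A σ y := by
  simp [galMapTensor]

theorem comul_galMap (σ : Gal(F/k)) (x : F ⊗[k] A) :
    Coalgebra.comul (R := F) (galMap k A σ x) =
      galMapTensor k A σ (Coalgebra.comul (R := F) x) := by
  induction x with
  | zero => simp
  | add x y hx hy => simp only [map_add, hx, hy]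
  | tmul c a =>
    simp only [galMap_tmul, TensorProduct.comul_tmul, CommSemiring.comul_apply]
    generalize (Coalgebra.comul (R := k) a) = z
    induction z with
    | zero => simp
    | add x y hx hy => simp only [TensorProduct.tmul_add, map_add, hx, hy]
    | tmul x y => simp

variable (k A) in
/-- The action of `σ ∈ Gal(F/k)` on characters. -/
def galCharacter (σ : Gal(F/k)) : Character k F A →* Character k F A where
  toFun χ := ⟨galMap k A σ χ.val, by
    refine ⟨?_, ?_⟩
    · rw [counit_galMap, χ.2.counit_eq_one, map_one]
    · rw [comul_galMap, χ.2.comul_eq_tmul_self, galMapTensor_tmul]⟩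
  map_one' := GroupLike.val_injective (map_one (galMap k A σ))
  map_mul' χ χ' := GroupLike.val_injective (map_mul (galMap k A σ) χ.val χ'.val)

variable (k F A) in
/-- The group of characters over `F`, written additively, as a representation of `Gal(F/k)`. -/
def characterRep : Representation ℤ Gal(F/k) (Additive (Character k F A)) where
  toFun σ := (MonoidHom.toAdditive (galCharacter k A σ)).toIntLinearMap
  map_one' := by
    refine LinearMap.ext fun χ => ?_
    exact congrArg Additive.ofMul (GroupLike.val_injective (galMap_one χ.toMul.val))
  map_mul' σ τ := by
    refine LinearMap.ext fun χ => ?_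
    exact congrArg Additive.ofMul (GroupLike.val_injective (galMap_mul σ τ χ.toMul.val))

end Characters

/-! ### Algebraic tori -/

/-- The affine `k`-group scheme `Spec A` becomes isomorphic over `F` to the split torus `𝔾ₘⁿ` for
some `n`: the Hopf algebra `F ⊗ A` over `F` is isomorphic to the group algebra `F[ℤⁿ]`, the
coordinate ring of `𝔾ₘⁿ`. -/
def SplitsOver (k F A : Type*) [Field k] [Field F] [Algebra k F] [CommRing A]
    [HopfAlgebra k A] : Prop :=
  ∃ n : ℕ, Nonempty ((F ⊗[k] A) ≃ₐc[F] MonoidAlgebra F (Multiplicative (Fin n → ℤ)))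

theorem SplitsOver.isDomain {k F A : Type*} [Field k] [Field F] [Algebra k F] [CommRing A]
    [HopfAlgebra k A] (h : SplitsOver k F A) : IsDomain A := by
  obtain ⟨n, ⟨e⟩⟩ := h
  have h1 : Function.Injective (Algebra.TensorProduct.includeRight : A →ₐ[k] F ⊗[k] A) :=
    Algebra.TensorProduct.includeRight_injective (FaithfulSMul.algebraMap_injective k F)
  have : IsDomain (F ⊗[k] A) :=
    Function.Injective.isDomain
      ((e : (F ⊗[k] A) →ₐc[F] MonoidAlgebra F (Multiplicative (Fin n → ℤ))) :
        (F ⊗[k] A) →ₐ[F] MonoidAlgebra F (Multiplicative (Fin n → ℤ))).toRingHom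
      (EquivLike.injective e)
  exact Function.Injective.isDomain
    (Algebra.TensorProduct.includeRight : A →ₐ[k] F ⊗[k] A).toRingHom h1

/-- An algebraic `k`-torus, given as an affine `k`-group scheme `T = Spec k[T]`: a commutative Hopf
algebra `k[T]` over `k` such that `T` becomes isomorphic to `𝔾ₘⁿ` over the separable closure of
`k`. -/
structure AlgebraicTorus (k : Type u) [Field k] where
  /-- The coordinate ring `k[T]`. -/
  coordRing : Type u
  [commRing : CommRing coordRing]
  [hopfAlgebra : HopfAlgebra k coordRing]
  splits : SplitsOver k (SeparableClosure k) coordRing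

namespace AlgebraicTorus

variable {k : Type u} [Field k] (T : AlgebraicTorus k)

instance : CommRing T.coordRing := T.commRing

instance : HopfAlgebra k T.coordRing := T.hopfAlgebra

instance : IsDomain T.coordRing := T.splits.isDomain

/-- The function field `k(T)`. -/
abbrev functionField : Type u := FractionRing T.coordRing

/-- The character lattice `T̂` of `T`: the abelian group of characters of `T` over the separable
closure `k̄` of `k`, with its action of the absolute Galois group `Gal(k̄/k)`. -/
def characterLattice :
    Representation ℤ Gal(SeparableClosure k/k)
      (Additive (Character k (SeparableClosure k) T.coordRing)) :=
  characterRep k (SeparableClosure k) T.coordRing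

/-- `T` is the tensor product `T₁ ⊗ T₂`, i.e. the torus (unique up to isomorphism) whose character
lattice is isomorphic, as a Galois lattice, to `T̂₁ ⊗_ℤ T̂₂` with the diagonal action. -/
def IsTensorProduct (T₁ T₂ T : AlgebraicTorus k) : Prop :=
  Nonempty ((T₁.characterLattice.tprod T₂.characterLattice).Equiv T.characterLattice)

end AlgebraicTorus

end

/-! Both notions of rationality are visible on resolutions `0 → M → E → Q → 0` of the character
lattice `M`. Stable rationality is equivalent to having one with `E` and `Q` permutation lattices.
Retract rationality gives one with `E` invertible (a direct summand of a permutation lattice) and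
`Q` permutation, and follows as soon as `E` and `Q` are both invertible. So the task is to resolve
`M₁ ⊗ M₂`, given resolutions of `M₁` and `M₂`.

The tensor product of the complexes `Eᵢ → Qᵢ` is an exact sequence `0 → M₁ ⊗ M₂ → E₁ ⊗ E₂ → E₁ ⊗ Q₂
⊕ Q₁ ⊗ E₂ → Q₁ ⊗ Q₂ → 0`. If its last map has an equivariant section, `Q₁ ⊗ Q₂` can be moved to the
middle term and a resolution results. When `aᵢ • id` on `Mᵢ` factors through a permutation lattice,
the vanishing of `Ext¹` between permutation lattices lets `aᵢ • id` on `Qᵢ` lift to `Eᵢ`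
(`exists_lift_of_factor`). For coprime `a₁`, `a₂` a Bézout combination of the two lifts is the
section (`Resolution.tensor`).

Rationality gives resolutions through units. Over the splitting field `F`, the units on `T × 𝔸ᵐ` are
the scalars times the characters. For a principal open subset `U` this yields a resolution of `M` by
`F[U]ˣ/Fˣ` and `F[U]ˣ/F[T × 𝔸ᵐ]ˣ` (`characterResolution`); the latter is free on the boundary
divisors, which the Galois group permutes. If `U` is also open in affine space, `F[U]ˣ/Fˣ` is a
permutation lattice for the same reason; if `U` is a retract of such an open set, it is a direct
summand of one.

Conversely, equivariant maps from `M` to `(F ⊗ K)ˣ` are `K`-points of `T`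
(`exists_algHom_of_intertwiningMap`), and Hilbert 90 extends the generic point to `E`
(`Resolution.exists_extension_unitRep`). Points of a permutation lattice of rank `d` are points of
an open subset of affine `d`-space, by an equivariant change of coordinates
(`exists_equivariant_matrix`). In the invertible case this factors the generic point through affine
space. In the permutation case, adjoining variables for `Q` produces a field generated by `rank E`
elements, and a count of transcendence degree makes them independent. -/

noncomputable section

/-! ### Extending equivariant maps along resolutions by permutation lattices -/

section Lattices

open Module

variable {G : Type*} [Group G]

/-- The basis `b` of the representation `ρ` is permuted by the group, through `a`. -/
def IsPermutedBasis {X M : Type*} [AddCommGroup M] (ρ : Representation ℤ G M)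
    (b : Basis X ℤ M) (a : G →* Equiv.Perm X) : Prop :=
  ∀ g x, ρ g (b x) = b (a g x)

theorem exists_orbit_representatives {X : Type*} (a : G →* Equiv.Perm X) :
    ∃ (x₀ : X → X) (s : X → G), (∀ x, a (s x) (x₀ x) = x) ∧ ∀ g x, x₀ (a g x) = x₀ x := by
  let _ : MulAction G X := MulAction.compHom X a
  have hsmul : ∀ (g : G) (x : X), g • x = a g x := fun _ _ => rfl
  let x₀ : X → X := fun x => (Quotient.mk (MulAction.orbitRel G X) x).out
  have h : ∀ x, ∃ g : G, a g (x₀ x) = x := fun x => by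
    have : (MulAction.orbitRel G X).r (x₀ x) x := Quotient.mk_out (s := MulAction.orbitRel G X) x
    obtain ⟨g, hg⟩ := (MulAction.orbitRel G X).symm this
    exact ⟨g, hg⟩
  choose s hs using h
  refine ⟨x₀, s, hs, fun g x => ?_⟩
  have : Quotient.mk (MulAction.orbitRel G X) (a g x) = Quotient.mk (MulAction.orbitRel G X) x :=
    Quotient.sound (s := MulAction.orbitRel G X) ⟨g, rfl⟩
  simp only [x₀, this]

variable {M E W Q N : Type*} [AddCommGroup M] [AddCommGroup E] [AddCommGroup W] [AddCommGroup Q]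
  [AddCommGroup N] {ρM : Representation ℤ G M} {ρE : Representation ℤ G E}
  {ρW : Representation ℤ G W} {ρQ : Representation ℤ G Q} {ρN : Representation ℤ G N}

/-- Let `0 → M → E → W → 0` be exact with `W` a direct summand of a permutation lattice `Q`.
An equivariant map `M → N` extends to `E` as soon as, for every basis vector `x` of `Q`, the class
in `H¹(Stab x, N)` obtained from it vanishes. -/
theorem exists_equivariant_extension (ι : ρM.IntertwiningMap ρE) (π : ρE.IntertwiningMap ρW)
    (hι : Function.Injective ι) (hπ : Function.Surjective π)
    (hex : ∀ e, π e = 0 ↔ ∃ m, ι m = e)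
    (i : ρW.IntertwiningMap ρQ) (r : ρQ.IntertwiningMap ρW) (hri : ∀ w, r (i w) = w)
    {X : Type*} {b : Basis X ℤ Q} {a : G →* Equiv.Perm X} (hb : IsPermutedBasis ρQ b a)
    (α : ρM.IntertwiningMap ρN)
    (H : ∀ x e, π e = r (b x) → ∃ p : N, ∀ τ m, a τ x = x → ρE τ e = e + ι m →
      ρN τ p = p + α m) :
    ∃ f : ρE.IntertwiningMap ρN, ∀ m, f (ι m) = α m := by
  obtain ⟨x₀, s, hs, hx₀⟩ := exists_orbit_representatives a
  choose e₀ he₀ using fun x => hπ (r (b x))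
  choose p₀ hp₀ using fun x => H x (e₀ x) (he₀ x)
  -- `S` is an additive lift of `r`, in general not equivariant, obtained by transporting one chosen
  -- lift per orbit. `P` transports the solutions of the cocycle equations in the same way, so its
  -- defect of equivariance is the image under `α` of that of `S`; this is `key`.
  let S : Q →ₗ[ℤ] E := b.constr ℤ fun x => ρE (s x) (e₀ (x₀ x))
  let P : Q →ₗ[ℤ] N := b.constr ℤ fun x => ρN (s x) (p₀ (x₀ x))
  have hSb : ∀ x, S (b x) = ρE (s x) (e₀ (x₀ x)) := fun x => b.constr_basis ℤ _ x
  have hPb : ∀ x, P (b x) = ρN (s x) (p₀ (x₀ x)) := fun x => b.constr_basis ℤ _ x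
  have hπS : ∀ q, π (S q) = r q := by
    intro q
    have : π.toLinearMap ∘ₗ S = r.toLinearMap := by
      refine b.ext fun x => ?_
      change π (S (b x)) = r (b x)
      rw [hSb, π.isIntertwining, he₀, ← r.isIntertwining, hb, hs]
    exact LinearMap.congr_fun this q
  have key : ∀ τ q, ∃ m, ρE τ (S q) = S (ρQ τ q) + ι m ∧ ρN τ (P q) = P (ρQ τ q) + α m := by
    intro τ q
    induction b.mem_span q using Submodule.span_induction with
    | mem q hq =>
      obtain ⟨x, rfl⟩ := hq
      set y := a τ x with hy
      -- Shapiro's lemma by hand: the defect at `x` is governed by an element `h` of the stabiliser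
      -- of the orbit representative, where `hp₀` applies.
      let h := (s y)⁻¹ * τ * s x
      have hx : x₀ y = x₀ x := hx₀ τ x
      have hh : a h (x₀ x) = x₀ x := by
        simp only [h, map_mul, Equiv.Perm.mul_apply, hs]
        rw [← hy, map_inv, Equiv.Perm.inv_eq_iff_eq, ← hx, hs]
      have h1 : ∃ m, ι m = ρE h (e₀ (x₀ x)) - e₀ (x₀ x) := by
        rw [← hex, map_sub, π.isIntertwining, he₀, ← r.isIntertwining, hb, hh, sub_self]
      obtain ⟨m, hm⟩ := h1
      have h2 := hp₀ (x₀ x) h m hh (by rw [hm]; abel)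
      have hτ : τ * s x = s y * h := by simp [h, mul_assoc]
      refine ⟨ρM (s y) m, ?_, ?_⟩
      · rw [hb, ← hy, hSb, hSb, hx, ι.isIntertwining, hm, map_sub, ← Module.End.mul_apply,
          ← map_mul, hτ, map_mul, Module.End.mul_apply]
        abel
      · rw [hb, ← hy, hPb, hPb, hx, α.isIntertwining, ← Module.End.mul_apply,
          ← map_mul, hτ, map_mul, Module.End.mul_apply, h2, map_add]
    | zero => exact ⟨0, by simp⟩
    | add q q' _ _ h h' =>
      obtain ⟨m, h1, h2⟩ := h
      obtain ⟨m', h1', h2'⟩ := h'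
      refine ⟨m + m', ?_, ?_⟩
      · simp only [map_add, h1, h1']; abel
      · simp only [map_add, h2, h2']; abel
    | smul n q _ h =>
      obtain ⟨m, h1, h2⟩ := h
      exact ⟨n • m, by simp only [map_smul, h1, smul_add], by simp only [map_smul, h2, smul_add]⟩
  -- The additive section `S ∘ i` splits off an `M`-component `L e`. The extension is `α` on this
  -- component, corrected by `P` on the other so that the two defects cancel.
  have hL : ∀ e, ∃ m, ι m = e - S (i (π e)) := fun e => by
    rw [← hex, map_sub, hπS, hri, sub_self]
  choose L hL using hL
  have hLadd : ∀ e e', L (e + e') = L e + L e' := fun e e' => hι (by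
    simp only [map_add, hL]; abel)
  let f : E →+ N :=
    { toFun := fun e => α (L e) + P (i (π e))
      map_zero' := by
        have : L 0 = 0 := by simpa using hLadd 0 0
        simp [this]
      map_add' := fun e e' => by simp only [hLadd, map_add]; abel }
  have hf : ∀ e, f e = α (L e) + P (i (π e)) := fun _ => rfl
  refine ⟨⟨f.toIntLinearMap, fun g => LinearMap.ext fun e => ?_⟩, fun m => ?_⟩
  · change f (ρE g e) = ρN g (f e)
    obtain ⟨m, h1, h2⟩ := key g (i (π e))
    have h3 : L (ρE g e) = ρM g (L e) + m := hι (by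
      rw [hL, map_add, ι.isIntertwining, hL, map_sub, h1, π.isIntertwining, i.isIntertwining]
      abel)
    rw [hf, hf, h3, map_add, map_add, h2, π.isIntertwining, i.isIntertwining, α.isIntertwining]
    abel
  · change f (ι m) = α m
    have h0 : π (ι m) = 0 := (hex _).2 ⟨m, rfl⟩
    have h1 : L (ι m) = m := hι (by rw [hL, h0]; simp)
    rw [hf, h1, h0]; simp

/-- Elements with finite orbit have vanishing classes in the cohomology of a permutation lattice. -/
theorem exists_coboundary_of_permutedBasis {Y : Type*} {b : Basis Y ℤ N} {c : G →* Equiv.Perm Y}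
    (hb : IsPermutedBasis ρN b c) (ι : ρM.IntertwiningMap ρE)
    (hι : Function.Injective ι) (α : ρM.IntertwiningMap ρN) (e : E)
    (hfin : (Set.range fun g => ρE g e).Finite) (H : Subgroup G)
    (hH : ∀ τ ∈ H, ∃ m, ρE τ e = e + ι m) :
    ∃ p : N, ∀ τ ∈ H, ∀ m, ρE τ e = e + ι m → ρN τ p = p + α m := by
  classical
  have hrepr : ∀ g (n : N) y, b.repr (ρN g n) (c g y) = b.repr n y := by
    intro g n y
    have : (Finsupp.lapply (c g y) ∘ₗ b.repr.toLinearMap ∘ₗ ρN g : N →ₗ[ℤ] ℤ) =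
        Finsupp.lapply y ∘ₗ b.repr.toLinearMap := by
      refine b.ext fun x => ?_
      simp [hb g x, Finsupp.single_apply]
    exact LinearMap.congr_fun this n
  have hfin' : (Set.range fun g : H => ρE g e).Finite :=
    hfin.subset (by rintro _ ⟨g, rfl⟩; exact ⟨g, rfl⟩)
  let O : Finset E := hfin'.toFinset
  have hO : ∀ o, o ∈ O ↔ ∃ g ∈ H, ρE g e = o := fun o => by simp [O]
  have heO : e ∈ O := (hO e).2 ⟨1, H.one_mem, by simp⟩
  have hn : 0 < O.card := Finset.card_pos.2 ⟨e, heO⟩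
  -- Averaging over the orbit: this `t` satisfies `τ t = t - |O| • m`, so `|O|` times the class is a
  -- coboundary.
  have hsum : ∃ t, ι t = ∑ o ∈ O, (o - e) := by
    choose! t ht using fun o (ho : o ∈ O) => (show ∃ m, ι m = o - e by
      obtain ⟨g, hg, rfl⟩ := (hO o).1 ho
      obtain ⟨m, hm⟩ := hH g hg
      exact ⟨m, by rw [hm]; abel⟩)
    refine ⟨∑ o ∈ O, t o, ?_⟩
    rw [map_sum]
    exact Finset.sum_congr rfl fun o ho => ht o ho
  obtain ⟨t, ht⟩ := hsum
  have hinv : ∀ τ ∈ H, ∑ o ∈ O, ρE τ o = ∑ o ∈ O, o := by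
    intro τ hτ
    have hinj : Function.Injective (ρE τ) := fun x y hxy => by
      have := congrArg (ρE τ⁻¹) hxy
      rwa [← Module.End.mul_apply, ← Module.End.mul_apply, ← map_mul, inv_mul_cancel, map_one] at this
    refine Finset.sum_bij (fun o _ => ρE τ o) (fun o ho => ?_) (fun _ _ _ _ h => hinj h)
      (fun o ho => ?_) (fun _ _ => rfl)
    · obtain ⟨g, hg, rfl⟩ := (hO o).1 ho
      exact (hO _).2 ⟨τ * g, H.mul_mem hτ hg, by simp⟩
    · obtain ⟨g, hg, rfl⟩ := (hO o).1 ho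
      exact ⟨ρE (τ⁻¹ * g) e, (hO _).2 ⟨τ⁻¹ * g, H.mul_mem (H.inv_mem hτ) hg, rfl⟩, by
        rw [← Module.End.mul_apply, ← map_mul, mul_inv_cancel_left]⟩
  have htτ : ∀ τ ∈ H, ∀ m, ρE τ e = e + ι m → ρM τ t = t - O.card • m := by
    intro τ hτ m hm
    apply hι
    rw [ι.isIntertwining, ht, map_sub, ht, map_sum]
    simp only [map_sub, Finset.sum_sub_distrib, hinv τ hτ, hm, Finset.sum_const, smul_add,
      map_nsmul]
    abel
  -- Division by `|O|` may leave remainders, so floors are taken coordinatewise. They commute with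
  -- the permutation of the coordinates, and since `τ` changes `-α t` by the exact multiple `|O| • α
  -- m`, it changes the floor by exactly `α m`.
  let p : N := b.repr.symm ((b.repr (α t)).mapRange (fun z => (-z) / (O.card : ℤ)) (by simp))
  have hp : ∀ y, b.repr p y = (-(b.repr (α t) y)) / (O.card : ℤ) := fun y => by simp [p]
  refine ⟨p, fun τ hτ m hm => b.repr.injective (Finsupp.ext fun y => ?_)⟩
  obtain ⟨x, rfl⟩ := (c τ).surjective y
  have h1 := hrepr τ (α t) x
  rw [← α.isIntertwining, htτ τ hτ m hm, map_sub, map_nsmul] at h1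
  simp only [map_sub, map_nsmul, Finsupp.sub_apply, Finsupp.smul_apply, nsmul_eq_mul] at h1
  rw [hrepr, hp, ← h1, map_add, Finsupp.add_apply, hp]
  have : -((b.repr (α t)) (c τ x) - (O.card : ℤ) * (b.repr (α m)) (c τ x)) =
      -((b.repr (α t)) (c τ x)) + (b.repr (α m)) (c τ x) * (O.card : ℤ) := by ring
  rw [this, Int.add_mul_ediv_right _ _ (by exact_mod_cast hn.ne')]

/-- If `a • id_M` factors through a permutation lattice, then multiplication by `a` on `Q` lifts
along the resolution `0 → M → E → Q → 0`. -/
theorem exists_lift_of_factor {P : Type*} [AddCommGroup P] {ρP : Representation ℤ G P}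
    (ι : ρM.IntertwiningMap ρE) (π : ρE.IntertwiningMap ρQ)
    (hι : Function.Injective ι) (hπ : Function.Surjective π)
    (hex : ∀ e, π e = 0 ↔ ∃ m, ι m = e)
    {X : Type*} {b : Basis X ℤ Q} {a : G →* Equiv.Perm X} (hb : IsPermutedBasis ρQ b a)
    {Y : Type*} {c : Basis Y ℤ P} {a' : G →* Equiv.Perm Y} (hc : IsPermutedBasis ρP c a')
    (hfin : ∀ e, (Set.range fun g => ρE g e).Finite)
    (n : ℕ) (α : ρM.IntertwiningMap ρP) (β : ρP.IntertwiningMap ρM) (hβα : ∀ m, β (α m) = n • m) :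
    ∃ s : ρQ.IntertwiningMap ρE, ∀ q, π (s q) = n • q := by
  obtain ⟨α', hα'⟩ := exists_equivariant_extension ι π hι hπ hex (.id ρQ) (.id ρQ) (fun _ => rfl)
    hb α (fun x e he => by
      let _ : MulAction G X := MulAction.compHom X a
      obtain ⟨p, hp⟩ := exists_coboundary_of_permutedBasis hc ι hι α e (hfin e)
        (MulAction.stabilizer G x) (fun τ hτ => by
          have hτ' : a τ x = x := hτ
          have : ∃ m, ι m = ρE τ e - e := by
            rw [← hex, map_sub, π.isIntertwining, he]
            change ρQ τ (b x) - b x = 0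
            rw [hb, hτ', sub_self]
          obtain ⟨m, hm⟩ := this
          exact ⟨m, by rw [hm]; abel⟩)
      exact ⟨p, fun τ m hτ h => hp τ hτ m h⟩)
  choose σ hσ using hπ
  -- `n • id - ι β α'` vanishes on `M`, because `α'` extends `α`, and so descends to `Q`; as `π ι =
  -- 0`, the descended map lifts `n • id`.
  let t : E → E := fun e => n • e - ι (β (α' e))
  have ht0 : ∀ e, π e = 0 → t e = 0 := by
    intro e he
    obtain ⟨m, rfl⟩ := (hex e).1 he
    simp only [t, hα', hβα, map_nsmul, sub_self]
  have htsub : ∀ e e', t (e - e') = t e - t e' := by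
    intro e e'; simp only [t, map_sub, smul_sub]; abel
  have hteq : ∀ e e', π e = π e' → t e = t e' := by
    intro e e' h
    rw [← sub_eq_zero, ← htsub]
    exact ht0 _ (by rw [map_sub, h, sub_self])
  let s : Q →+ E := AddMonoidHom.mk' (fun q => t (σ q)) (fun q q' => by
    have : t (σ (q + q')) = t (σ q + σ q') := hteq _ _ (by rw [hσ, map_add, hσ, hσ])
    rw [this]; simp only [t, map_add, smul_add]; abel)
  have hs : ∀ e, s (π e) = t e := fun e => hteq _ _ (hσ _)
  refine ⟨⟨s.toIntLinearMap, fun g => LinearMap.ext fun q => ?_⟩, fun q => ?_⟩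
  · change s (ρQ g q) = ρE g (s q)
    rw [← hσ q, ← π.isIntertwining, hs, hs]
    simp only [t, map_sub, map_nsmul, α'.isIntertwining, β.isIntertwining, ι.isIntertwining]
  · change π (t (σ q)) = n • q
    have : π (ι (β (α' (σ q)))) = 0 := (hex _).2 ⟨_, rfl⟩
    simp only [t, map_sub, map_nsmul, hσ, this, sub_zero]

end Lattices

end

noncomputable section

/-! ### Resolutions of lattices and their tensor products -/

section Resolutions

open Module

/-- A short exact sequence `0 → M → E → Q → 0` of representations. -/
structure Resolution {G M E Q : Type*} [Group G] [AddCommGroup M] [AddCommGroup E]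
    [AddCommGroup Q] (ρM : Representation ℤ G M) (ρE : Representation ℤ G E)
    (ρQ : Representation ℤ G Q) where
  incl : ρM.IntertwiningMap ρE
  proj : ρE.IntertwiningMap ρQ
  incl_injective : Function.Injective incl
  proj_surjective : Function.Surjective proj
  proj_eq_zero_iff : ∀ e, proj e = 0 ↔ ∃ m, incl m = e

namespace Resolution

variable {G : Type*} [Group G]

theorem exact {M E Q : Type*} [AddCommGroup M] [AddCommGroup E]
    [AddCommGroup Q] {ρM : Representation ℤ G M} {ρE : Representation ℤ G E}
    {ρQ : Representation ℤ G Q} (r : Resolution ρM ρE ρQ) :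
    Function.Exact r.incl.toLinearMap r.proj.toLinearMap :=
  fun e => (r.proj_eq_zero_iff e).trans Iff.rfl

/-- A projective quotient splits the sequence additively, though not equivariantly. The tensor
product of two such retractions keeps `M₁ ⊗ M₂ → E₁ ⊗ E₂` injective. -/
theorem exists_retraction {M E Q : Type*} [AddCommGroup M] [AddCommGroup E]
    [AddCommGroup Q] {ρM : Representation ℤ G M} {ρE : Representation ℤ G E}
    {ρQ : Representation ℤ G Q} (r : Resolution ρM ρE ρQ) [Module.Projective ℤ Q] :
    ∃ l : E →ₗ[ℤ] M, l ∘ₗ r.incl.toLinearMap = LinearMap.id := by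
  obtain ⟨s, hs⟩ := Module.projective_lifting_property r.proj.toLinearMap LinearMap.id
    r.proj_surjective
  have h : Function.Surjective r.proj.toLinearMap ∧
      ∃ l, l ∘ₗ r.incl.toLinearMap = LinearMap.id :=
    (List.TFAE.out r.exact.split_tfae' 0 1 rfl rfl).1 (And.intro r.incl_injective (Exists.intro s hs))
  exact h.2

variable {M₁ E₁ Q₁ M₂ E₂ Q₂ : Type*} [AddCommGroup M₁] [AddCommGroup E₁] [AddCommGroup Q₁]
  [AddCommGroup M₂] [AddCommGroup E₂] [AddCommGroup Q₂]
  {ρM₁ : Representation ℤ G M₁} {ρE₁ : Representation ℤ G E₁} {ρQ₁ : Representation ℤ G Q₁}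
  {ρM₂ : Representation ℤ G M₂} {ρE₂ : Representation ℤ G E₂} {ρQ₂ : Representation ℤ G Q₂}

/-- The resolution `0 → M₁ ⊗ M₂ → E₁ ⊗ E₂ ⊕ Q₁ ⊗ Q₂ → E₁ ⊗ Q₂ ⊕ Q₁ ⊗ E₂ → 0`, for resolutions
`0 → Mᵢ → Eᵢ → Qᵢ → 0` in which coprime multiples of the identities of `Q₁`, `Q₂` lift. -/
def tensor (r₁ : Resolution ρM₁ ρE₁ ρQ₁) (r₂ : Resolution ρM₂ ρE₂ ρQ₂)
    [Module.Projective ℤ Q₁] [Module.Projective ℤ Q₂] {a₁ a₂ : ℕ}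
    (s₁ : ρQ₁.IntertwiningMap ρE₁) (hs₁ : ∀ q, r₁.proj (s₁ q) = a₁ • q)
    (s₂ : ρQ₂.IntertwiningMap ρE₂) (hs₂ : ∀ q, r₂.proj (s₂ q) = a₂ • q)
    {u v : ℤ} (huv : u * a₁ + v * a₂ = 1) :
    Resolution (ρM₁.tprod ρM₂) ((ρE₁.tprod ρE₂).prod (ρQ₁.tprod ρQ₂))
      ((ρE₁.tprod ρQ₂).prod (ρQ₁.tprod ρE₂)) := by
  let A : (ρE₁.tprod ρE₂).IntertwiningMap (ρE₁.tprod ρQ₂) := r₂.proj.lTensor ρE₁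
  let B : (ρE₁.tprod ρE₂).IntertwiningMap (ρQ₁.tprod ρE₂) := r₁.proj.rTensor ρE₂
  let A' : (ρE₁.tprod ρQ₂).IntertwiningMap (ρQ₁.tprod ρQ₂) := r₁.proj.rTensor ρQ₂
  let B' : (ρQ₁.tprod ρE₂).IntertwiningMap (ρQ₁.tprod ρQ₂) := r₂.proj.lTensor ρQ₁
  let S : (ρQ₁.tprod ρQ₂).IntertwiningMap (ρE₁.tprod ρQ₂) := s₁.rTensor ρQ₂
  let S' : (ρQ₁.tprod ρQ₂).IntertwiningMap (ρQ₁.tprod ρE₂) := s₂.lTensor ρQ₁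
  let fst := Representation.IntertwiningMap.fst ℤ (ρE₁.tprod ρE₂) (ρQ₁.tprod ρQ₂)
  let snd := Representation.IntertwiningMap.snd ℤ (ρE₁.tprod ρE₂) (ρQ₁.tprod ρQ₂)
  have hsq : ∀ e, A' (A e) = B' (B e) := fun e => by
    induction e with
    | zero => simp
    | tmul x y => rfl
    | add x y hx hy => simp only [map_add, hx, hy]
  have hS : ∀ q, A' (S q) = a₁ • q := fun q => by
    induction q with
    | zero => simp
    | tmul x y =>
      change r₁.proj (s₁ x) ⊗ₜ[ℤ] y = _
      rw [hs₁, TensorProduct.smul_tmul']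
    | add x y hx hy => simp only [map_add, hx, hy, smul_add]
  have hS' : ∀ q, B' (S' q) = a₂ • q := fun q => by
    induction q with
    | zero => simp
    | tmul x y =>
      change x ⊗ₜ[ℤ] r₂.proj (s₂ y) = _
      rw [hs₂, TensorProduct.tmul_smul]
    | add x y hx hy => simp only [map_add, hx, hy, smul_add]
  -- Bézout: `q ↦ (u • S q, -v • S' q)` is an equivariant section of `(x, y) ↦ A' x - B' y`.
  have hsec : ∀ q, A' (u • S q) + B' (v • S' q) = q := fun q => by
    rw [map_zsmul, map_zsmul, hS, hS', ← natCast_zsmul, ← natCast_zsmul, smul_smul, smul_smul,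
      ← add_smul, huv, one_smul]
  have hAsurj : Function.Surjective A := LinearMap.lTensor_surjective E₁ r₂.proj_surjective
  -- An element of the kernel comes from `Q₁ ⊗ M₂`, hence from `E₁ ⊗ M₂`, and `A` is zero on the
  -- image of the latter.
  have hBker : ∀ b, B' b = 0 → ∃ x : E₁ ⊗[ℤ] E₂, A x = 0 ∧ B x = b := by
    intro b hb
    obtain ⟨b, rfl⟩ := (lTensor_exact Q₁ r₂.exact r₂.proj_surjective b).1 hb
    obtain ⟨c, rfl⟩ := LinearMap.rTensor_surjective M₂ r₁.proj_surjective b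
    refine ⟨r₂.incl.toLinearMap.lTensor E₁ c, ?_, ?_⟩
    · exact (lTensor_exact E₁ r₂.exact r₂.proj_surjective _).2 ⟨c, rfl⟩
    · change (r₁.proj.toLinearMap.rTensor E₂ ∘ₗ r₂.incl.toLinearMap.lTensor E₁) c =
        (r₂.incl.toLinearMap.lTensor Q₁ ∘ₗ r₁.proj.toLinearMap.rTensor M₂) c
      rw [LinearMap.rTensor_comp_lTensor, LinearMap.lTensor_comp_rTensor]
  refine
    { incl := (r₁.incl.tensor r₂.incl).prod 0
      proj := (A.comp fst + (u • S).comp snd).prod (B.comp fst - (v • S').comp snd)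
      incl_injective := ?_
      proj_surjective := ?_
      proj_eq_zero_iff := ?_ }
  · obtain ⟨l₁, hl₁⟩ := r₁.exists_retraction
    obtain ⟨l₂, hl₂⟩ := r₂.exists_retraction
    have : Function.LeftInverse (TensorProduct.map l₁ l₂)
        (TensorProduct.map r₁.incl.toLinearMap r₂.incl.toLinearMap) := fun x => by
      rw [← LinearMap.comp_apply, ← TensorProduct.map_comp, hl₁, hl₂, TensorProduct.map_id]; rfl
    intro x y hxy
    exact this.injective (congrArg Prod.fst hxy)
  · rintro ⟨x, y⟩
    -- `q` is the obstruction to lifting `(x, y)` to `E₁ ⊗ E₂`; after the section's value at `q` is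
    -- subtracted, the rest lifts.
    set q := A' x - B' y with hq
    have h0 : A' (x - u • S q) = B' (y + v • S' q) := by
      have := hsec q
      rw [map_sub, map_add, sub_eq_iff_eq_add, add_assoc, add_comm _ (A' _), this, hq]; abel
    obtain ⟨e, he⟩ := hAsurj (x - u • S q)
    obtain ⟨e', he', he''⟩ := hBker (y + v • S' q - B e) (by
      rw [map_sub, ← hsq, he, h0, sub_self])
    refine ⟨(e + e', q), Prod.ext ?_ ?_⟩
    · change A (e + e') + u • S q = x
      rw [map_add, he, he']; abel
    · change B (e + e') - v • S' q = y
      rw [map_add, he'']; abel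
  · rintro ⟨e, q⟩
    constructor
    · intro h
      have h1 : A e + u • S q = 0 := congrArg Prod.fst h
      have h2 : B e - v • S' q = 0 := congrArg Prod.snd h
      have hq : q = 0 := by
        have t1 : u • S q = - A e := by rw [eq_neg_iff_add_eq_zero, add_comm]; exact h1
        have t2 : v • S' q = B e := (sub_eq_zero.1 h2).symm
        refine (hsec q).symm.trans ?_
        rw [t1, t2, map_neg, hsq, neg_add_cancel]
      subst hq
      have hA : A e = 0 := by simpa using h1
      have hB : B e = 0 := by simpa using h2
      obtain ⟨c, rfl⟩ := (lTensor_exact E₁ r₂.exact r₂.proj_surjective e).1 hA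
      have hB' : r₂.incl.toLinearMap.lTensor Q₁ (r₁.proj.toLinearMap.rTensor M₂ c) = 0 := by
        rw [← hB]
        change (r₂.incl.toLinearMap.lTensor Q₁ ∘ₗ r₁.proj.toLinearMap.rTensor M₂) c =
          (r₁.proj.toLinearMap.rTensor E₂ ∘ₗ r₂.incl.toLinearMap.lTensor E₁) c
        rw [LinearMap.rTensor_comp_lTensor, LinearMap.lTensor_comp_rTensor]
      -- `Q₁` is flat, so `Q₁ ⊗ M₂` embeds in `Q₁ ⊗ E₂`. Thus `c` dies in `Q₁ ⊗ M₂` and comes from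
      -- `M₁ ⊗ M₂`.
      have hc := (injective_iff_map_eq_zero _).1
        (Module.Flat.lTensor_preserves_injective_linearMap (M := Q₁) r₂.incl.toLinearMap
          r₂.incl_injective) _ hB'
      obtain ⟨d, rfl⟩ := (rTensor_exact M₂ r₁.exact r₁.proj_surjective c).1 hc
      refine ⟨d, Prod.ext ?_ rfl⟩
      change TensorProduct.map r₁.incl.toLinearMap r₂.incl.toLinearMap d =
        (r₂.incl.toLinearMap.lTensor E₁ ∘ₗ r₁.incl.toLinearMap.rTensor M₂) d
      rw [LinearMap.lTensor_comp_rTensor]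
    · rintro ⟨m, hm⟩
      obtain rfl : q = 0 := (congrArg Prod.snd hm).symm
      obtain rfl : TensorProduct.map r₁.incl.toLinearMap r₂.incl.toLinearMap m = e :=
        congrArg Prod.fst hm
      refine Prod.ext ?_ ?_
      · change A (TensorProduct.map r₁.incl.toLinearMap r₂.incl.toLinearMap m) + u • S 0 = 0
        rw [map_zero, smul_zero, add_zero]
        refine (lTensor_exact E₁ r₂.exact r₂.proj_surjective _).2
          ⟨r₁.incl.toLinearMap.rTensor M₂ m, ?_⟩
        rw [← LinearMap.comp_apply, LinearMap.lTensor_comp_rTensor]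
      · change B (TensorProduct.map r₁.incl.toLinearMap r₂.incl.toLinearMap m) - v • S' 0 = 0
        rw [map_zero, smul_zero, sub_zero]
        refine (rTensor_exact E₂ r₁.exact r₁.proj_surjective _).2
          ⟨r₂.incl.toLinearMap.lTensor M₁ m, ?_⟩
        rw [← LinearMap.comp_apply, LinearMap.rTensor_comp_lTensor]

/-- Transport of a resolution along an isomorphism. -/
def congr {M E Q M' : Type*} [AddCommGroup M] [AddCommGroup E] [AddCommGroup Q] [AddCommGroup M']
    {ρM : Representation ℤ G M} {ρE : Representation ℤ G E} {ρQ : Representation ℤ G Q}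
    {ρM' : Representation ℤ G M'} (r : Resolution ρM ρE ρQ) (e : ρM.Equiv ρM') :
    Resolution ρM' ρE ρQ where
  incl := r.incl.comp e.symm.toIntertwiningMap
  proj := r.proj
  incl_injective := r.incl_injective.comp e.symm.toLinearEquiv.injective
  proj_surjective := r.proj_surjective
  proj_eq_zero_iff x := (r.proj_eq_zero_iff x).trans
    ⟨fun ⟨m, hm⟩ => by
      obtain ⟨m, rfl⟩ := e.symm.toLinearEquiv.surjective m
      exact ⟨m, hm⟩, fun ⟨m, hm⟩ => ⟨_, hm⟩⟩

end Resolution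

/-! ### Permutation and invertible Galois lattices -/

section Galois

variable {k F : Type*} [Field k] [Field F] [Algebra k F]

/-- Every vector is fixed by the Galois group of `F` over some finite normal extension of `k`. -/
def IsDiscreteRep {M : Type*} [AddCommGroup M] (ρ : Representation ℤ Gal(F/k) M) : Prop :=
  ∀ m, ∃ L : IntermediateField k F, FiniteDimensional k L ∧ Normal k L ∧
    ∀ σ ∈ L.fixingSubgroup, ρ σ m = m

/-- Permutation lattices: lattices with a finite basis permuted by the group, which acts
continuously. -/
def IsPermutationLattice {M : Type*} [AddCommGroup M] (ρ : Representation ℤ Gal(F/k) M) : Prop :=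
  IsDiscreteRep ρ ∧ ∃ (n : ℕ) (b : Basis (Fin n) ℤ M) (a : Gal(F/k) →* Equiv.Perm (Fin n)),
    IsPermutedBasis ρ b a

/-- Invertible lattices: direct summands of permutation lattices. -/
def IsInvertibleLattice {M : Type u} [AddCommGroup M] (ρ : Representation ℤ Gal(F/k) M) : Prop :=
  ∃ (P : Type u) (_ : AddCommGroup P) (ρP : Representation ℤ Gal(F/k) P),
    IsPermutationLattice ρP ∧ ∃ (i : ρ.IntertwiningMap ρP) (r : ρP.IntertwiningMap ρ),
      ∀ m, r (i m) = m

theorem IsPermutationLattice.isInvertibleLattice {M : Type u} [AddCommGroup M]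
    {ρ : Representation ℤ Gal(F/k) M} (h : IsPermutationLattice ρ) : IsInvertibleLattice ρ :=
  ⟨M, _, ρ, h, .id ρ, .id ρ, fun _ => rfl⟩

theorem IsPermutationLattice.projective {M : Type*} [AddCommGroup M]
    {ρ : Representation ℤ Gal(F/k) M} (h : IsPermutationLattice ρ) : Module.Projective ℤ M := by
  obtain ⟨-, n, b, -⟩ := h
  exact Module.Projective.of_basis b

theorem IsDiscreteRep.of_injective {M N : Type*} [AddCommGroup M] [AddCommGroup N]
    {ρ : Representation ℤ Gal(F/k) M} {ρ' : Representation ℤ Gal(F/k) N} (h : IsDiscreteRep ρ')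
    (i : ρ.IntertwiningMap ρ') (hi : Function.Injective i) : IsDiscreteRep ρ := fun m => by
  obtain ⟨L, h1, h2, h3⟩ := h (i m)
  exact ⟨L, h1, h2, fun σ hσ => hi (by rw [i.isIntertwining, h3 σ hσ])⟩

theorem IsDiscreteRep.of_surjective {M N : Type*} [AddCommGroup M] [AddCommGroup N]
    {ρ : Representation ℤ Gal(F/k) M} {ρ' : Representation ℤ Gal(F/k) N} (h : IsDiscreteRep ρ)
    (p : ρ.IntertwiningMap ρ') (hp : Function.Surjective p) : IsDiscreteRep ρ' := fun m => by
  obtain ⟨m, rfl⟩ := hp m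
  obtain ⟨L, h1, h2, h3⟩ := h m
  exact ⟨L, h1, h2, fun σ hσ => by rw [← p.isIntertwining, h3 σ hσ]⟩

theorem IsInvertibleLattice.isDiscreteRep {M : Type u} [AddCommGroup M]
    {ρ : Representation ℤ Gal(F/k) M} (h : IsInvertibleLattice ρ) : IsDiscreteRep ρ := by
  obtain ⟨P, _, ρP, hP, i, r, hri⟩ := h
  exact hP.1.of_injective i (Function.LeftInverse.injective hri)

/-- The orbit map factors through the finite group `Gal(L/k)`. -/
theorem IsDiscreteRep.finite_orbit {M : Type*} [AddCommGroup M]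
    {ρ : Representation ℤ Gal(F/k) M} (h : IsDiscreteRep ρ) (m : M) :
    (Set.range fun g => ρ g m).Finite := by
  obtain ⟨L, h1, h2, h3⟩ := h m
  have hfac : Function.FactorsThrough (fun g => ρ g m) (AlgEquiv.restrictNormalHom (F := k) L) := by
    intro g g' hgg'
    have : g'⁻¹ * g ∈ L.fixingSubgroup := by
      rw [← IntermediateField.restrictNormalHom_ker, MonoidHom.mem_ker, map_mul, map_inv, hgg',
        inv_mul_cancel]
    have h4 := h3 _ this
    have h5 : g = g' * (g'⁻¹ * g) := by group
    change ρ g m = ρ g' m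
    rw [h5, map_mul, Module.End.mul_apply, h4]
  obtain ⟨f, hf⟩ := (Function.factorsThrough_iff _).1 hfac
  rw [hf]
  exact (Set.finite_range f).subset (Set.range_comp_subset_range _ _)

theorem exists_finite_normal_sup (L L' : IntermediateField k F) [FiniteDimensional k L]
    [FiniteDimensional k L'] [Normal k L] [Normal k L'] :
    ∃ K : IntermediateField k F, FiniteDimensional k K ∧ Normal k K ∧
      K.fixingSubgroup ≤ L.fixingSubgroup ∧ K.fixingSubgroup ≤ L'.fixingSubgroup :=
  ⟨L ⊔ L', inferInstance, inferInstance, IntermediateField.fixingSubgroup_antitone le_sup_left,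
    IntermediateField.fixingSubgroup_antitone le_sup_right⟩

variable {M N : Type u} [AddCommGroup M] [AddCommGroup N]
    {ρM : Representation ℤ Gal(F/k) M} {ρN : Representation ℤ Gal(F/k) N}

theorem IsDiscreteRep.prod (hM : IsDiscreteRep ρM) (hN : IsDiscreteRep ρN) :
    IsDiscreteRep (ρM.prod ρN) := by
  rintro ⟨m, n⟩
  obtain ⟨L, h1, h2, h3⟩ := hM m
  obtain ⟨L', h1', h2', h3'⟩ := hN n
  obtain ⟨K, h4, h5, h6, h6'⟩ := exists_finite_normal_sup L L'
  exact ⟨K, h4, h5, fun σ hσ => Prod.ext (h3 σ (h6 hσ)) (h3' σ (h6' hσ))⟩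

theorem IsDiscreteRep.tprod (hM : IsDiscreteRep ρM) (hN : IsDiscreteRep ρN) :
    IsDiscreteRep (ρM.tprod ρN) := by
  intro x
  induction x with
  | zero => exact ⟨⊥, inferInstance, inferInstance, by simp⟩
  | tmul m n =>
    obtain ⟨L, h1, h2, h3⟩ := hM m
    obtain ⟨L', h1', h2', h3'⟩ := hN n
    obtain ⟨K, h4, h5, h6, h6'⟩ := exists_finite_normal_sup L L'
    refine ⟨K, h4, h5, fun σ hσ => ?_⟩
    change ρM σ m ⊗ₜ[ℤ] ρN σ n = m ⊗ₜ[ℤ] n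
    rw [h3 σ (h6 hσ), h3' σ (h6' hσ)]
  | add x y hx hy =>
    obtain ⟨L, h1, h2, h3⟩ := hx
    obtain ⟨L', h1', h2', h3'⟩ := hy
    obtain ⟨K, h4, h5, h6, h6'⟩ := exists_finite_normal_sup L L'
    exact ⟨K, h4, h5, fun σ hσ => by rw [map_add, h3 σ (h6 hσ), h3' σ (h6' hσ)]⟩

theorem IsPermutationLattice.of_finite {X : Type*} [Finite X] (hM : IsDiscreteRep ρM)
    {b : Basis X ℤ M} {a : Gal(F/k) →* Equiv.Perm X} (hb : IsPermutedBasis ρM b a) :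
    IsPermutationLattice ρM := by
  obtain ⟨n, ⟨e⟩⟩ := Finite.exists_equiv_fin X
  exact ⟨hM, n, b.reindex e, (e.permCongrHom.toMonoidHom).comp a, fun g x => by simp [hb g]⟩

theorem IsPermutationLattice.prod (hM : IsPermutationLattice ρM) (hN : IsPermutationLattice ρN) :
    IsPermutationLattice (ρM.prod ρN) := by
  obtain ⟨hM, n, b, a, hb⟩ := hM
  obtain ⟨hN, n', b', a', hb'⟩ := hN
  refine .of_finite (hM.prod hN) (b := b.prod b')
    (a := (Equiv.Perm.sumCongrHom _ _).comp (a.prod a')) ?_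
  rintro g (x | x)
  · simp [hb g]
  · simp [hb' g]

theorem IsPermutationLattice.tprod (hM : IsPermutationLattice ρM) (hN : IsPermutationLattice ρN) :
    IsPermutationLattice (ρM.tprod ρN) := by
  obtain ⟨hM, n, b, a, hb⟩ := hM
  obtain ⟨hN, n', b', a', hb'⟩ := hN
  refine .of_finite (hM.tprod hN) (b := b.tensorProduct b')
    (a := ⟨⟨fun g => (a g).prodCongr (a' g), by simp; rfl⟩, fun g h => by ext <;> simp⟩) ?_
  rintro g ⟨x, y⟩
  change TensorProduct.map (ρM g) (ρN g) (b.tensorProduct b' (x, y)) =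
    b.tensorProduct b' (a g x, a' g y)
  rw [Basis.tensorProduct_apply, Basis.tensorProduct_apply, TensorProduct.map_tmul, hb, hb']

theorem IsInvertibleLattice.prod (hM : IsInvertibleLattice ρM) (hN : IsInvertibleLattice ρN) :
    IsInvertibleLattice (ρM.prod ρN) := by
  obtain ⟨P, _, ρP, hP, i, r, hri⟩ := hM
  obtain ⟨P', _, ρP', hP', i', r', hri'⟩ := hN
  refine ⟨P × P', inferInstance, ρP.prod ρP', hP.prod hP',
    (i.comp (.fst _ _ _)).prod (i'.comp (.snd _ _ _)),
    (r.comp (.fst _ _ _)).prod (r'.comp (.snd _ _ _)), ?_⟩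
  rintro ⟨m, n⟩
  exact Prod.ext (hri m) (hri' n)

theorem IsInvertibleLattice.tprod (hM : IsInvertibleLattice ρM) (hN : IsInvertibleLattice ρN) :
    IsInvertibleLattice (ρM.tprod ρN) := by
  obtain ⟨P, _, ρP, hP, i, r, hri⟩ := hM
  obtain ⟨P', _, ρP', hP', i', r', hri'⟩ := hN
  refine ⟨P ⊗[ℤ] P', inferInstance, ρP.tprod ρP', hP.tprod hP', i.tensor i', r.tensor r', ?_⟩
  intro x
  change TensorProduct.map r.toLinearMap r'.toLinearMap
    (TensorProduct.map i.toLinearMap i'.toLinearMap x) = x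
  have h : r.toLinearMap ∘ₗ i.toLinearMap = LinearMap.id := LinearMap.ext hri
  have h' : r'.toLinearMap ∘ₗ i'.toLinearMap = LinearMap.id := LinearMap.ext hri'
  rw [← LinearMap.comp_apply, ← TensorProduct.map_comp, h, h', TensorProduct.map_id]
  rfl

/-- There is a resolution by permutation lattices. -/
def HasPermutationResolution (ρ : Representation ℤ Gal(F/k) M) : Prop :=
  ∃ (E Q : Type u) (_ : AddCommGroup E) (_ : AddCommGroup Q) (ρE : Representation ℤ Gal(F/k) E)
    (ρQ : Representation ℤ Gal(F/k) Q), Nonempty (Resolution ρ ρE ρQ) ∧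
    IsPermutationLattice ρE ∧ IsPermutationLattice ρQ

/-- There is a resolution `0 → M → E → Q → 0` with `E` invertible and `Q` a permutation
lattice. -/
def HasRetractResolution (ρ : Representation ℤ Gal(F/k) M) : Prop :=
  ∃ (E Q : Type u) (_ : AddCommGroup E) (_ : AddCommGroup Q) (ρE : Representation ℤ Gal(F/k) E)
    (ρQ : Representation ℤ Gal(F/k) Q), Nonempty (Resolution ρ ρE ρQ) ∧
    IsInvertibleLattice ρE ∧ IsPermutationLattice ρQ

/-- There is a resolution by invertible lattices. -/
def HasInvertibleResolution (ρ : Representation ℤ Gal(F/k) M) : Prop :=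
  ∃ (E Q : Type u) (_ : AddCommGroup E) (_ : AddCommGroup Q) (ρE : Representation ℤ Gal(F/k) E)
    (ρQ : Representation ℤ Gal(F/k) Q), Nonempty (Resolution ρ ρE ρQ) ∧
    IsInvertibleLattice ρE ∧ IsInvertibleLattice ρQ

/-- If no admissible integer exists, the infimum is `0`, and multiplication by `0` factors through
the zero lattice; hence no separate proof that the order is attained is needed. Continuity of the
action on `P` is dropped, since the lifting argument only uses finite orbits in `E`. -/
theorem permutationOrder_factors (ρ : Representation ℤ Gal(F/k) M) :
    ∃ (n : ℕ) (P : Type) (_ : AddCommGroup P) (ρP : Representation ℤ Gal(F/k) P)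
      (b : Basis (Fin n) ℤ P) (a : Gal(F/k) →* Equiv.Perm (Fin n)), IsPermutedBasis ρP b a ∧
      ∃ (f : ρ.IntertwiningMap ρP) (g : ρP.IntertwiningMap ρ),
        ∀ m, g (f m) = permutationOrder ρ • m := by
  have key : ∀ (n : ℕ) (_ : MulAction Gal(F/k) (Fin n)),
      ∃ b : Basis (Fin n) ℤ (MonoidAlgebra ℤ (Fin n)),
        IsPermutedBasis (Representation.ofMulAction ℤ Gal(F/k) (Fin n)) b
          (MulAction.toPermHom Gal(F/k) (Fin n)) := fun n _ =>
    ⟨.ofRepr (MonoidAlgebra.coeffLinearEquiv ℤ), fun g x => by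
      have h : ∀ y, (Basis.ofRepr (MonoidAlgebra.coeffLinearEquiv (M := Fin n) ℤ) :
        Basis (Fin n) ℤ (MonoidAlgebra ℤ (Fin n))) y = MonoidAlgebra.single y 1 := fun _ => rfl
      rw [h, h, Representation.ofMulAction_single]; rfl⟩
  obtain h | h := Set.eq_empty_or_nonempty {a : ℕ | 1 ≤ a ∧
    ∃ (n : ℕ) (_ : MulAction Gal(F/k) (Fin n)),
    (∀ x : Fin n, IsOpen (MulAction.stabilizer Gal(F/k) x : Set Gal(F/k))) ∧
    ∃ (f : ρ.IntertwiningMap (Representation.ofMulAction ℤ Gal(F/k) (Fin n)))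
      (g : (Representation.ofMulAction ℤ Gal(F/k) (Fin n)).IntertwiningMap ρ),
      ∀ m : M, g (f m) = a • m}
  · have h0 : permutationOrder ρ = 0 := by rw [permutationOrder, h, Nat.sInf_empty]
    let act : MulAction Gal(F/k) (Fin 0) :=
      { smul := fun _ x => x, one_smul := fun _ => rfl, mul_smul := fun _ _ _ => rfl }
    obtain ⟨b, hb⟩ := key 0 act
    exact ⟨0, _, inferInstance, _, b, _, hb, 0, 0, fun m => by rw [h0, zero_smul]; rfl⟩
  · obtain ⟨-, n, act, -, f, g, hfg⟩ := Nat.sInf_mem h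
    obtain ⟨b, hb⟩ := key n act
    exact ⟨n, _, inferInstance, _, b, _, hb, f, g, hfg⟩

theorem Resolution.exists_permutationOrder_lift {E Q : Type*} [AddCommGroup E] [AddCommGroup Q]
    {ρE : Representation ℤ Gal(F/k) E} {ρQ : Representation ℤ Gal(F/k) Q}
    (r : Resolution ρM ρE ρQ) (hE : IsDiscreteRep ρE) (hQ : IsPermutationLattice ρQ) :
    ∃ s : ρQ.IntertwiningMap ρE, ∀ q, r.proj (s q) = permutationOrder ρM • q := by
  obtain ⟨n, P, _, ρP, c, a', hc, f, g, hfg⟩ := permutationOrder_factors ρM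
  obtain ⟨-, m, b, a, hb⟩ := hQ
  exact exists_lift_of_factor r.incl r.proj r.incl_injective r.proj_surjective r.proj_eq_zero_iff
    hb hc hE.finite_orbit _ f g hfg

theorem exists_resolution_tprod {M₁ E₁ Q₁ M₂ E₂ Q₂ : Type*} [AddCommGroup M₁] [AddCommGroup E₁]
    [AddCommGroup Q₁] [AddCommGroup M₂] [AddCommGroup E₂] [AddCommGroup Q₂]
    {ρM₁ : Representation ℤ Gal(F/k) M₁} {ρE₁ : Representation ℤ Gal(F/k) E₁}
    {ρQ₁ : Representation ℤ Gal(F/k) Q₁} {ρM₂ : Representation ℤ Gal(F/k) M₂}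
    {ρE₂ : Representation ℤ Gal(F/k) E₂} {ρQ₂ : Representation ℤ Gal(F/k) Q₂}
    (r₁ : Resolution ρM₁ ρE₁ ρQ₁) (r₂ : Resolution ρM₂ ρE₂ ρQ₂)
    (hE₁ : IsDiscreteRep ρE₁) (hQ₁ : IsPermutationLattice ρQ₁)
    (hE₂ : IsDiscreteRep ρE₂) (hQ₂ : IsPermutationLattice ρQ₂)
    (hcop : Nat.Coprime (permutationOrder ρM₁) (permutationOrder ρM₂)) :
    Nonempty (Resolution (ρM₁.tprod ρM₂) ((ρE₁.tprod ρE₂).prod (ρQ₁.tprod ρQ₂))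
      ((ρE₁.tprod ρQ₂).prod (ρQ₁.tprod ρE₂))) := by
  have := hQ₁.projective
  have := hQ₂.projective
  obtain ⟨s₁, hs₁⟩ := r₁.exists_permutationOrder_lift hE₁ hQ₁
  obtain ⟨s₂, hs₂⟩ := r₂.exists_permutationOrder_lift hE₂ hQ₂
  obtain ⟨u, v, huv⟩ := Nat.isCoprime_iff_coprime.2 hcop
  exact ⟨r₁.tensor r₂ s₁ hs₁ s₂ hs₂ huv⟩

theorem HasPermutationResolution.tprod (h₁ : HasPermutationResolution ρM)
    (h₂ : HasPermutationResolution ρN)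
    (hcop : Nat.Coprime (permutationOrder ρM) (permutationOrder ρN)) :
    HasPermutationResolution (ρM.tprod ρN) := by
  obtain ⟨E₁, Q₁, _, _, ρE₁, ρQ₁, ⟨r₁⟩, hE₁, hQ₁⟩ := h₁
  obtain ⟨E₂, Q₂, _, _, ρE₂, ρQ₂, ⟨r₂⟩, hE₂, hQ₂⟩ := h₂
  exact ⟨_, _, _, _, _, _, exists_resolution_tprod r₁ r₂ hE₁.1 hQ₁ hE₂.1 hQ₂ hcop,
    (hE₁.tprod hE₂).prod (hQ₁.tprod hQ₂), (hE₁.tprod hQ₂).prod (hQ₁.tprod hE₂)⟩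

/-- The terms `E₁ ⊗ Q₂` and `Q₁ ⊗ E₂` are only summands of permutation lattices, so the new cokernel
is known only to be invertible. The return to retract rationality has to start from this weaker
form. -/
theorem HasRetractResolution.tprod (h₁ : HasRetractResolution ρM)
    (h₂ : HasRetractResolution ρN)
    (hcop : Nat.Coprime (permutationOrder ρM) (permutationOrder ρN)) :
    HasInvertibleResolution (ρM.tprod ρN) := by
  obtain ⟨E₁, Q₁, _, _, ρE₁, ρQ₁, ⟨r₁⟩, hE₁, hQ₁⟩ := h₁
  obtain ⟨E₂, Q₂, _, _, ρE₂, ρQ₂, ⟨r₂⟩, hE₂, hQ₂⟩ := h₂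
  exact ⟨_, _, _, _, _, _,
    exists_resolution_tprod r₁ r₂ hE₁.isDiscreteRep hQ₁ hE₂.isDiscreteRep hQ₂ hcop,
    (hE₁.tprod hE₂).prod (hQ₁.isInvertibleLattice.tprod hQ₂.isInvertibleLattice),
    (hE₁.tprod hQ₂.isInvertibleLattice).prod (hQ₁.isInvertibleLattice.tprod hE₂)⟩

theorem HasPermutationResolution.congr (h : HasPermutationResolution ρM) (e : ρM.Equiv ρN) :
    HasPermutationResolution ρN := by
  obtain ⟨E, Q, _, _, ρE, ρQ, ⟨r⟩, hE, hQ⟩ := h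
  exact ⟨E, Q, _, _, ρE, ρQ, ⟨r.congr e⟩, hE, hQ⟩

theorem HasInvertibleResolution.congr (h : HasInvertibleResolution ρM) (e : ρM.Equiv ρN) :
    HasInvertibleResolution ρN := by
  obtain ⟨E, Q, _, _, ρE, ρQ, ⟨r⟩, hE, hQ⟩ := h
  exact ⟨E, Q, _, _, ρE, ρQ, ⟨r.congr e⟩, hE, hQ⟩

end Galois

end Resolutions

end

noncomputable section

/-! ### Galois descent and Hilbert's theorem 90 -/

section Descent

open Module

variable {k F : Type*} [Field k] [Field F] [Algebra k F]

/-- Galois descent: a vector with open stabiliser under a semilinear action is in the span of the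
invariant vectors. -/
theorem mem_span_fixed {H V : Type*} [Group H] [AddCommGroup V] [Module F V] (j : H →* Gal(F/k))
    (ρ : H →* AddMonoid.End V) (hρ : ∀ h (c : F) v, ρ h (c • v) = j h c • ρ h v)
    (L : IntermediateField k F) [FiniteDimensional k L] [Normal k L] (v : V)
    (hv : ∀ h, j h ∈ L.fixingSubgroup → ρ h v = v) :
    v ∈ Submodule.span F {w : V | ∀ h, ρ h w = w} := by
  classical
  let r : H →* Gal(L/k) := (AlgEquiv.restrictNormalHom (F := k) L).comp j
  have hr : ∀ h (x : L), ((r h x : L) : F) = j h x := fun h x =>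
    AlgEquiv.restrictNormalHom_apply L (j h) x
  have hρr : ∀ h h', r h = r h' → ρ h v = ρ h' v := by
    intro h h' hh
    have h1 : j (h'⁻¹ * h) ∈ L.fixingSubgroup := by
      rw [← IntermediateField.restrictNormalHom_ker, MonoidHom.mem_ker]
      change r (h'⁻¹ * h) = 1
      rw [map_mul, map_inv, hh, inv_mul_cancel]
    have h2 : h = h' * (h'⁻¹ * h) := by group
    rw [h2, map_mul, AddMonoid.End.coe_mul, Function.comp_apply, hv _ h1]
  choose s hs using fun g : r.range => g.2
  -- Twisted traces of `l • v` over the image of `H` in `Gal(L/k)`; they are invariant.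
  let w : L → V := fun l => ∑ g : r.range, ((g.1 l : L) : F) • ρ (s g) v
  have hw : ∀ l h, ρ h (w l) = w l := by
    intro l h
    simp only [w, map_sum, hρ]
    refine Fintype.sum_equiv (Equiv.mulLeft (⟨r h, h, rfl⟩ : r.range)) _ _ fun g => ?_
    have h1 : ρ h (ρ (s g) v) = ρ (h * s g) v := by rw [map_mul]; rfl
    rw [h1, ← hr h]
    refine congrArg₂ _ rfl (hρr _ _ ?_)
    rw [map_mul, hs, hs]; rfl
  by_contra hnot
  -- A functional that kills the invariant vectors kills `w l` for all `l`. Dedekind's independence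
  -- of the distinct embeddings of `L` in `F` then makes every coefficient vanish, in particular `ℓ
  -- v`.
  obtain ⟨ℓ, hℓ, hker⟩ := Submodule.exists_le_ker_of_notMem hnot
  have hli : LinearIndependent F fun g : r.range =>
      (fun l : L => ((g.1 l : L) : F) : L → F) := by
    refine (linearIndependent_monoidHom L F).comp
      (fun g : r.range => (((algebraMap L F : L →+* F) : L →* F).comp
        (g.1.toRingEquiv : L →* L))) fun g g' hgg' => ?_
    refine Subtype.ext (AlgEquiv.ext fun l => Subtype.ext ?_)
    exact DFunLike.congr_fun hgg' l
  rw [Fintype.linearIndependent_iff] at hli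
  have h0 := hli (fun g => ℓ (ρ (s g) v)) (funext fun l => by
    have := hker (Submodule.subset_span (s := {w : V | ∀ h, ρ h w = w}) (hw l))
    rw [LinearMap.mem_ker] at this
    simp only [w, map_sum, map_smul, smul_eq_mul] at this
    simpa [Finset.sum_apply, mul_comm] using this) 1
  have h1 : ρ (s 1) v = v := by
    rw [hρr (s 1) 1 (by rw [hs, map_one]; rfl), map_one]; rfl
  exact hℓ (by rw [← h0, h1])

theorem IsPermutationLattice.exists_normal {M : Type*} [AddCommGroup M]
    {ρ : Representation ℤ Gal(F/k) M} (h : IsDiscreteRep ρ) {X : Type*} [Finite X]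
    {b : Basis X ℤ M} {a : Gal(F/k) →* Equiv.Perm X} (hb : IsPermutedBasis ρ b a) :
    ∃ L : IntermediateField k F, FiniteDimensional k L ∧ Normal k L ∧
      ∀ σ ∈ L.fixingSubgroup, a σ = 1 := by
  choose L h1 h2 h3 using fun x => h (b x)
  refine ⟨⨆ x, L x, IntermediateField.finiteDimensional_iSup_of_finite,
    IntermediateField.normal_iSup k F L, fun σ hσ => Equiv.ext fun x => b.injective ?_⟩
  rw [← hb, h3 x σ (IntermediateField.fixingSubgroup_antitone (le_iSup L x) hσ)]; rfl

/-- An equivariant trivialisation of a finite Galois set: an invertible matrix over `F` whose rows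
are permuted by the Galois group. -/
theorem exists_equivariant_matrix {n : ℕ} (a : Gal(F/k) →* Equiv.Perm (Fin n))
    (L : IntermediateField k F) [FiniteDimensional k L] [Normal k L]
    (hL : ∀ σ ∈ L.fixingSubgroup, a σ = 1) :
    ∃ D D' : Matrix (Fin n) (Fin n) F, D * D' = 1 ∧ D' * D = 1 ∧
      ∀ (σ : Gal(F/k)) x i, σ (D x i) = D (a σ x) i := by
  -- The semilinear action on functions on the Galois set. A basis of invariant functions, taken as
  -- columns, is the matrix `D`.
  let ρ : Gal(F/k) →* AddMonoid.End (Fin n → F) :=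
    { toFun := fun σ => AddMonoidHom.mk' (fun v x => σ (v (a σ⁻¹ x)))
        (fun v w => funext fun x => by simp)
      map_one' := AddMonoidHom.ext fun v => funext fun x => by simp; rfl
      map_mul' := fun σ τ => AddMonoidHom.ext fun v => funext fun x => by
        change (σ * τ) (v (a (σ * τ)⁻¹ x)) = σ (τ (v (a τ⁻¹ (a σ⁻¹ x))))
        rw [mul_inv_rev, map_mul]; rfl }
  have hρ : ∀ σ v x, ρ σ v x = σ (v (a σ⁻¹ x)) := fun _ _ _ => rfl
  have hspan : ⊤ ≤ Submodule.span F {w : Fin n → F | ∀ h, ρ h w = w} := fun v _ => by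
    rw [pi_eq_sum_univ v]
    refine Submodule.sum_mem _ fun i _ => Submodule.smul_mem _ _ ?_
    refine mem_span_fixed (.id _) ρ (fun σ c v => ?_) L _ fun σ hσ => ?_
    · ext x; simp [hρ]
    · have hσ' : a σ⁻¹ = 1 := hL _ (inv_mem hσ)
      ext x
      rw [hρ, hσ']
      simp only [Equiv.Perm.coe_one, id]
      split_ifs with h <;> simp [h]
  let B₀ := Basis.ofSpan hspan
  have hB₀ : ∀ i, B₀ i ∈ {w : Fin n → F | ∀ h, ρ h w = w} := fun i =>
    Basis.ofSpan_subset hspan ⟨i, rfl⟩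
  let B : Basis (Fin n) F (Fin n → F) := B₀.reindex (B₀.indexEquiv (Pi.basisFun F (Fin n)))
  have hB : ∀ i, B i ∈ {w : Fin n → F | ∀ h, ρ h w = w} := fun i => by
    rw [Basis.reindex_apply]; exact hB₀ _
  refine ⟨(Pi.basisFun F (Fin n)).toMatrix B, B.toMatrix (Pi.basisFun F (Fin n)),
    Basis.toMatrix_mul_toMatrix_flip _ _, Basis.toMatrix_mul_toMatrix_flip _ _, fun σ x i => ?_⟩
  have h := congrFun (hB i σ) (a σ x)
  rw [hρ] at h
  simpa [Basis.toMatrix_apply] using h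

variable (k F) in
/-- The semilinear Galois action on `F ⊗ C`. -/
def galTensor (C : Type*) [CommRing C] [Algebra k C] :
    Gal(F/k) →* (F ⊗[k] C →ₐ[k] F ⊗[k] C) where
  toFun σ := Algebra.TensorProduct.map (σ : F →ₐ[k] F) (AlgHom.id k C)
  map_one' := by ext <;> simp
  map_mul' σ τ := by ext <;> simp

section

variable {C D : Type*} [CommRing C] [Algebra k C] [CommRing D] [Algebra k D]

@[simp]
theorem galTensor_tmul (σ : Gal(F/k)) (c : F) (x : C) :
    galTensor k F C σ (c ⊗ₜ x) = σ c ⊗ₜ x := rfl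

theorem galTensor_smul (σ : Gal(F/k)) (c : F) (x : F ⊗[k] C) :
    galTensor k F C σ (c • x) = σ c • galTensor k F C σ x := by
  rw [Algebra.smul_def, Algebra.smul_def, map_mul]; rfl

theorem galTensor_mul_apply (σ τ : Gal(F/k)) (x : F ⊗[k] C) :
    galTensor k F C (σ * τ) x = galTensor k F C σ (galTensor k F C τ x) := by
  rw [map_mul]; rfl

theorem galTensor_one_apply (x : F ⊗[k] C) : galTensor k F C 1 x = x := by
  rw [map_one]; rfl

theorem galTensor_map (f : C →ₐ[k] D) (σ : Gal(F/k)) (x : F ⊗[k] C) :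
    galTensor k F D σ (Algebra.TensorProduct.map (AlgHom.id F F) f x) =
      Algebra.TensorProduct.map (AlgHom.id F F) f (galTensor k F C σ x) := by
  induction x with
  | zero => simp
  | tmul c x => simp
  | add x y hx hy => simp only [map_add, hx, hy]

/-- The coordinates of `x` in a `k`-basis of `C` are fixed by the Galois group, hence lie in `k`. -/
theorem exists_tmul_of_galTensor_fixed [IsGalois k F] (x : F ⊗[k] C)
    (hx : ∀ σ, galTensor k F C σ x = x) : ∃ y : C, x = 1 ⊗ₜ y := by
  classical
  let b := Basis.ofVectorSpace k C
  let B : Basis _ F (F ⊗[k] C) := b.baseChange F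
  have hB : ∀ i, B i = 1 ⊗ₜ b i := fun i => by simp [B]
  have hrepr : ∀ (σ : Gal(F/k)) z i, B.repr (galTensor k F C σ z) i = σ (B.repr z i) := by
    intro σ z i
    induction z with
    | zero => simp
    | tmul c z => simp [B, Basis.baseChange_repr_tmul]
    | add z z' h h' => simp only [map_add, Finsupp.add_apply, h, h']
  have hfix : ∀ i, ∃ c : k, algebraMap k F c = B.repr x i := fun i => by
    have := (InfiniteGalois.mem_range_algebraMap_iff_fixed (k := k) (K := F) (B.repr x i)).2
      fun σ => by rw [← hrepr, hx]
    exact this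
  choose c hc using hfix
  refine ⟨∑ i ∈ (B.repr x).support, c i • b i, ?_⟩
  conv_lhs => rw [← B.linearCombination_repr x, Finsupp.linearCombination_apply, Finsupp.sum]
  rw [TensorProduct.tmul_sum]
  refine Finset.sum_congr rfl fun i _ => ?_
  rw [hB, ← hc, TensorProduct.smul_tmul', TensorProduct.tmul_smul, TensorProduct.smul_tmul',
    smul_eq_mul, mul_one, Algebra.algebraMap_eq_smul_one]

theorem exists_normal_galTensor_fixed [Normal k F] (x : F ⊗[k] C) :
    ∃ L : IntermediateField k F, FiniteDimensional k L ∧ Normal k L ∧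
      ∀ σ ∈ L.fixingSubgroup, galTensor k F C σ x = x := by
  induction x with
  | zero => exact ⟨⊥, inferInstance, inferInstance, by simp⟩
  | tmul c x =>
    have := IntermediateField.adjoin.finiteDimensional (K := k) (x := c)
      (Algebra.IsIntegral.isIntegral c)
    let L := IntermediateField.normalClosure k (IntermediateField.adjoin k {c}) F
    have hc : c ∈ L := IntermediateField.le_normalClosure _
      (IntermediateField.mem_adjoin_simple_self k c)
    refine ⟨L, normalClosure.is_finiteDimensional k _ F, normalClosure.normal k _ F,
      fun σ hσ => ?_⟩
    rw [galTensor_tmul, (IntermediateField.mem_fixingSubgroup_iff L σ).1 hσ c hc]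
  | add x y hx hy =>
    obtain ⟨L, h1, h2, h3⟩ := hx
    obtain ⟨L', h1', h2', h3'⟩ := hy
    obtain ⟨K, h4, h5, h6, h6'⟩ := exists_finite_normal_sup L L'
    exact ⟨K, h4, h5, fun σ hσ => by rw [map_add, h3 σ (h6 hσ), h3' σ (h6' hσ)]⟩

variable (k F C) in
/-- The units of `F ⊗ C`, written additively, with their Galois action. -/
def unitRep : Representation ℤ Gal(F/k) (Additive (F ⊗[k] C)ˣ) where
  toFun σ := (MonoidHom.toAdditive
    (Units.map (galTensor k F C σ : F ⊗[k] C →* F ⊗[k] C))).toIntLinearMap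
  map_one' := by
    refine LinearMap.ext fun u => ?_
    exact congrArg Additive.ofMul (Units.ext (galTensor_one_apply _))
  map_mul' σ τ := by
    refine LinearMap.ext fun u => ?_
    exact congrArg Additive.ofMul (Units.ext (galTensor_mul_apply σ τ _))

theorem unitRep_apply (σ : Gal(F/k)) (u : Additive (F ⊗[k] C)ˣ) :
    ((unitRep k F C σ u).toMul : F ⊗[k] C) = galTensor k F C σ (u.toMul : F ⊗[k] C) := rfl

theorem unitRep_isDiscreteRep [Normal k F] : IsDiscreteRep (unitRep k F C) := fun u => by
  obtain ⟨L, h1, h2, h3⟩ := exists_normal_galTensor_fixed (u.toMul : F ⊗[k] C)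
  exact ⟨L, h1, h2, fun σ hσ => Additive.toMul.injective (Units.ext (h3 σ hσ))⟩

/-- Hilbert's theorem 90 for the units of a field `F ⊗ C`. -/
theorem hilbert90 (hC : IsField (F ⊗[k] C)) (H : Subgroup Gal(F/k)) (c : H → (F ⊗[k] C)ˣ)
    (hc : ∀ σ τ : H, (c (σ * τ) : F ⊗[k] C) = c σ * galTensor k F C σ (c τ))
    (L : IntermediateField k F) [FiniteDimensional k L] [Normal k L]
    (hL : ∀ σ : H, σ.1 ∈ L.fixingSubgroup → c σ = 1) :
    ∃ p : (F ⊗[k] C)ˣ, ∀ σ : H, galTensor k F C σ p = c σ * p := by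
  have : Nontrivial (F ⊗[k] C) := hC.nontrivial
  have hc1 : c 1 = 1 := hL 1 (one_mem _)
  -- The Galois action twisted by `c⁻¹`: its invariants are the solutions of `σ p = c σ * p`. By
  -- descent `1` is in their span, so some invariant is non-zero, and it is a unit because `F ⊗ C`
  -- is a field.
  let ρ : H →* AddMonoid.End (F ⊗[k] C) :=
    { toFun := fun σ => AddMonoidHom.mk' (fun v => ↑(c σ)⁻¹ * galTensor k F C σ v)
        (fun v w => by rw [map_add, mul_add])
      map_one' := by
        ext v
        change ↑(c 1)⁻¹ * galTensor k F C 1 v = v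
        rw [hc1, galTensor_one_apply, inv_one, Units.val_one, one_mul]
      map_mul' := fun σ τ => by
        ext v
        change ↑(c (σ * τ))⁻¹ * galTensor k F C (σ * τ) v =
          ↑(c σ)⁻¹ * galTensor k F C σ (↑(c τ)⁻¹ * galTensor k F C τ v)
        have h : c (σ * τ) = c σ * Units.map (galTensor k F C σ : F ⊗[k] C →* F ⊗[k] C) (c τ) :=
          Units.ext (hc σ τ)
        rw [h, mul_inv, ← map_inv, Units.val_mul, map_mul (galTensor k F C σ.1), galTensor_mul_apply,
          mul_assoc]
        rfl }
  have hρ : ∀ σ v, ρ σ v = ↑(c σ)⁻¹ * galTensor k F C σ v := fun _ _ => rfl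
  have h1 := mem_span_fixed (H.subtype) ρ (fun σ x v => by
    rw [hρ, hρ, galTensor_smul, mul_smul_comm]; rfl) L (1 : F ⊗[k] C) (fun σ hσ => by
      rw [hρ, hL σ hσ, map_one]; simp)
  obtain ⟨w, hw, hw0⟩ : ∃ w ∈ {w : F ⊗[k] C | ∀ h, ρ h w = w}, w ≠ 0 := by
    by_contra hno
    push Not at hno
    have : Submodule.span F {w : F ⊗[k] C | ∀ h, ρ h w = w} ≤ ⊥ := Submodule.span_le.2 hno
    exact one_ne_zero ((Submodule.mem_bot F).1 (this h1))
  obtain ⟨w', hw'⟩ := hC.mul_inv_cancel hw0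
  refine ⟨⟨w, w', hw', by rw [mul_comm]; exact hw'⟩, fun σ => ?_⟩
  have := hw σ
  rw [hρ, Units.inv_mul_eq_iff_eq_mul] at this
  exact this

/-- Equivariant homomorphisms into the units of a field `F ⊗ C` extend along resolutions with
invertible cokernel. -/
theorem Resolution.exists_extension_unitRep (hC : IsField (F ⊗[k] C)) {M E : Type*} {W : Type u}
    [AddCommGroup M] [AddCommGroup E] [AddCommGroup W] {ρM : Representation ℤ Gal(F/k) M}
    {ρE : Representation ℤ Gal(F/k) E} {ρW : Representation ℤ Gal(F/k) W}
    (r : Resolution ρM ρE ρW) (hE : IsDiscreteRep ρE) (hW : IsInvertibleLattice ρW)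
    (α : ρM.IntertwiningMap (unitRep k F C)) :
    ∃ f : ρE.IntertwiningMap (unitRep k F C), ∀ m, f (r.incl m) = α m := by
  obtain ⟨Q, _, ρQ, ⟨-, n, b, a, hb⟩, i, p, hip⟩ := hW
  refine exists_equivariant_extension r.incl r.proj r.incl_injective r.proj_surjective
    r.proj_eq_zero_iff i p hip hb α fun x e he => ?_
  let act : MulAction Gal(F/k) (Fin n) := MulAction.compHom (Fin n) a
  let H := MulAction.stabilizer Gal(F/k) x
  have hm : ∀ τ : H, ∃ m, ρE τ e = e + r.incl m := fun τ => by
    have hτ : a τ.1 x = x := τ.2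
    have : ∃ m, r.incl m = ρE τ e - e := by
      rw [← r.proj_eq_zero_iff, map_sub, r.proj.isIntertwining, he, ← p.isIntertwining, hb, hτ,
        sub_self]
    obtain ⟨m, hm⟩ := this
    exact ⟨m, by rw [hm]; abel⟩
  choose m hm using hm
  obtain ⟨L, _, _, h3⟩ := hE e
  -- `τ ↦ α (m τ)` is a multiplicative cocycle on the stabiliser of `x`, trivial on the elements
  -- fixing `L` and hence `e`.
  obtain ⟨q, hq⟩ := hilbert90 hC H (fun τ => (α (m τ)).toMul) (fun σ τ => by
    have h1 : m (σ * τ) = m σ + ρM σ (m τ) := r.incl_injective (by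
      have h2 := hm (σ * τ)
      rw [Subgroup.coe_mul, map_mul, Module.End.mul_apply, hm, map_add, hm, add_assoc] at h2
      rw [map_add, r.incl.isIntertwining]
      exact (add_left_cancel h2).symm)
    rw [h1, map_add, α.isIntertwining]; rfl) L (fun σ hσ => by
      have h1 : m σ = 0 := r.incl_injective (by
        have h2 := hm σ
        rw [h3 _ hσ, left_eq_add] at h2
        rw [h2, map_zero])
      rw [h1, map_zero]; rfl)
  refine ⟨Additive.ofMul q, fun τ m' hτ hm' => Additive.toMul.injective (Units.ext ?_)⟩
  have h1 : m ⟨τ, hτ⟩ = m' := r.incl_injective (by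
    have h2 := hm ⟨τ, hτ⟩
    rw [hm'] at h2
    exact (add_left_cancel h2).symm)
  have h2 := hq ⟨τ, hτ⟩
  rw [h1] at h2
  rw [unitRep_apply, toMul_add, Units.val_mul, mul_comm]
  exact h2

end

end Descent

end

noncomputable section

/-! ### Units of localizations of factorial domains -/

section LocalizedUnits

open Module

/-- The units of a commutative ring modulo a subgroup, written additively. -/
def UnitClass {R : Type*} [CommRing R] (N : Subgroup Rˣ) : Type _ := Additive (Rˣ ⧸ N)

namespace UnitClass

variable {R S : Type*} [CommRing R] [CommRing S] (N : Subgroup Rˣ)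

instance : AddCommGroup (UnitClass N) := inferInstanceAs (AddCommGroup (Additive (Rˣ ⧸ N)))

/-- The class of a unit. -/
def mk : Additive Rˣ →+ UnitClass N := MonoidHom.toAdditive (QuotientGroup.mk' N)

theorem mk_surjective : Function.Surjective (mk N) := QuotientGroup.mk'_surjective N

variable {N}

theorem mk_eq_zero {u : Additive Rˣ} : mk N u = 0 ↔ u.toMul ∈ N :=
  QuotientGroup.eq_one_iff u.toMul

/-- The map induced by a homomorphism on units. -/
def map (f : Rˣ →* Sˣ) {N' : Subgroup Sˣ} (h : N ≤ N'.comap f) : UnitClass N →+ UnitClass N' :=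
  MonoidHom.toAdditive (QuotientGroup.map N N' f h)

end UnitClass

/-- The prime divisors of `f`, up to associates. -/
def PrimeDivisor {B : Type*} [CommRing B] (f : B) : Type _ :=
  {p : Associates B // Irreducible p ∧ p ∣ Associates.mk f}

theorem PrimeDivisor.finite {B : Type*} [CommRing B] [IsDomain B] [UniqueFactorizationMonoid B]
    {f : B} (hf : f ≠ 0) : Finite (PrimeDivisor f) := by
  classical
  have : Fintype {p : Associates B // p ∣ Associates.mk f} :=
    UniqueFactorizationMonoid.fintypeSubtypeDvd _ (by simpa using hf)
  exact Finite.of_injective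
    (fun p : PrimeDivisor f => (⟨p.1, p.2.2⟩ : {p : Associates B // p ∣ Associates.mk f}))
    fun p q h => Subtype.ext (by simpa using h)

/-- In a localization `B' = B[1/f]` of a factorial domain `B`, the classes of the prime divisors
of `f` form a basis of the units of `B'` modulo those of `B`. -/
theorem exists_basis_units {B B' : Type*} [CommRing B] [IsDomain B] [UniqueFactorizationMonoid B]
    [CommRing B'] (i : B →+* B') (hi : Function.Injective i) {f : B}
    (hu : IsUnit (i f)) (hsurj : ∀ z : B', ∃ (n : ℕ) (b : B), z * i f ^ n = i b)
    (N : Subgroup B'ˣ) (hN : ∀ u, u ∈ N ↔ ∃ v : Bˣ, i v = u) :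
    ∃ b : Basis (PrimeDivisor f) ℤ (UnitClass N),
      ∀ (x : PrimeDivisor f) (q : B), Associates.mk q = x.1 → ∀ w : B'ˣ, (w : B') = i q →
        b x = UnitClass.mk N (.ofMul w) := by
  classical
  have hdvd : ∀ (q : B) (n : ℕ), q ∣ f ^ n → ∃ w : B'ˣ, (w : B') = i q := by
    intro q n hq
    obtain ⟨w, hw⟩ := isUnit_of_dvd_unit (map_dvd i hq) (by rw [map_pow]; exact hu.pow n)
    exact ⟨w, hw⟩
  have hrep : ∀ x : PrimeDivisor f, ∃ p : B, Associates.mk p = x.1 := fun x =>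
    Associates.mk_surjective x.1
  choose p hp using hrep
  have hprime : ∀ x, Prime (p x) := fun x => by
    have := x.2.1
    rw [← hp, Associates.irreducible_mk] at this
    exact this.prime
  have hpdvd : ∀ x, p x ∣ f := fun x => by
    have := x.2.2
    rwa [← hp, Associates.mk_dvd_mk] at this
  choose w hw using fun x => hdvd (p x) 1 (by simpa using hpdvd x)
  have hassoc : ∀ (a b : B) (u v : B'ˣ), (u : B') = i a → (v : B') = i b → Associated a b →
      UnitClass.mk N (.ofMul u) = UnitClass.mk N (.ofMul v) := by
    rintro a b u v hu hv ⟨c, rfl⟩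
    rw [← sub_eq_zero, ← map_sub, UnitClass.mk_eq_zero]
    refine (hN _).2 ⟨c⁻¹, ?_⟩
    change _ = ((u * v⁻¹ : B'ˣ) : B')
    rw [Units.val_mul, Units.eq_mul_inv_iff_mul_eq, hu, hv, ← map_mul, mul_left_comm,
      Units.inv_mul, mul_one]
  let c : PrimeDivisor f → UnitClass N := fun x => UnitClass.mk N (.ofMul (w x))
  have hc : ∀ (x : PrimeDivisor f) (q : B), Associates.mk q = x.1 → ∀ w : B'ˣ, (w : B') = i q →
      c x = UnitClass.mk N (.ofMul w) := fun x q hq v hv =>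
    hassoc _ _ _ _ (hw x) hv (Associates.mk_eq_mk_iff_associated.1 (by rw [hp, hq]))
  have hli : LinearIndependent ℤ c := by
    rw [linearIndependent_iff']
    -- Moving negative exponents to the other side turns a relation into an equality in `B` up to a
    -- unit of `B`. A prime with positive exponent would then divide a product of powers of other
    -- primes. The opposite inequality comes from applying this to `-g`.
    have key : ∀ (s : Finset (PrimeDivisor f)) (g : PrimeDivisor f → ℤ),
        ∑ x ∈ s, g x • c x = 0 → ∀ x ∈ s, g x ≤ 0 := by
      intro s g hs x hx
      by_contra! hgx
      have h1 : UnitClass.mk N (.ofMul (∏ x ∈ s, w x ^ g x)) = 0 := by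
        rw [ofMul_prod, map_sum, ← hs]
        exact Finset.sum_congr rfl fun x _ => map_zsmul _ _ _
      obtain ⟨v, hv⟩ := (hN _).1 (UnitClass.mk_eq_zero.1 h1)
      change i v = ((∏ x ∈ s, w x ^ g x : B'ˣ) : B') at hv
      have h2 : ∏ x ∈ s, w x ^ (g x).toNat =
          (∏ x ∈ s, w x ^ g x) * ∏ x ∈ s, w x ^ (-g x).toNat := by
        rw [← Finset.prod_mul_distrib]
        refine Finset.prod_congr rfl fun x _ => ?_
        rw [← zpow_natCast, ← zpow_natCast, ← zpow_add]
        congr 1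
        omega
      have h3 : ∏ x ∈ s, p x ^ (g x).toNat = v * ∏ x ∈ s, p x ^ (-g x).toNat := by
        apply hi
        have := congrArg Units.val h2
        rw [Units.val_mul, ← hv] at this
        simpa [Units.coe_prod, hw] using this
      have h4 : p x ∣ v * ∏ x ∈ s, p x ^ (-g x).toNat := by
        rw [← h3]
        exact (dvd_pow_self _ (by omega)).trans (Finset.dvd_prod_of_mem _ hx)
      rw [Units.dvd_mul_left] at h4
      obtain ⟨y, hy, hxy⟩ := (hprime x).exists_mem_finset_dvd h4
      have hxy' : x = y := Subtype.ext (by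
        rw [← hp, ← hp, Associates.mk_eq_mk_iff_associated]
        exact (hprime x).associated_of_dvd (hprime y) ((hprime x).dvd_of_dvd_pow hxy))
      subst hxy'
      have h0 : (-g x).toNat = 0 := by omega
      rw [h0, pow_zero] at hxy
      exact (hprime x).not_isUnit (isUnit_of_dvd_one hxy)
    intro s g hs x hx
    refine le_antisymm (key s g hs x hx) ?_
    have := key s (-g) (by simp [hs]) x hx
    simpa using this
  have hspan' : ∀ (a : B) (n : ℕ), a ∣ f ^ n → ∀ u : B'ˣ, (u : B') = i a →
      UnitClass.mk N (.ofMul u) ∈ Submodule.span ℤ (Set.range c) := by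
    intro a n
    induction a using UniqueFactorizationMonoid.induction_on_prime with
    | h₁ =>
      intro _ u hu
      have : Subsingleton B' := by
        rw [map_zero] at hu
        exact ⟨fun x y => by
          have : ∀ z : B', z = 0 := fun z => by
            have h := u.inv_mul_cancel_left z
            rw [hu] at h; simpa using h.symm
          rw [this x, this y]⟩
      have h1 : u = 1 := Units.ext (Subsingleton.elim _ _)
      rw [h1, ofMul_one, map_zero]; exact Submodule.zero_mem _
    | h₂ a ha =>
      intro _ u hu
      obtain ⟨v, rfl⟩ := ha
      have : UnitClass.mk N (.ofMul u) = 0 := UnitClass.mk_eq_zero.2 ((hN _).2 ⟨v, hu.symm⟩)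
      rw [this]; exact Submodule.zero_mem _
    | h₃ a q ha hq ih =>
      intro hd u hu
      obtain ⟨u₁, hu₁⟩ := hdvd q n ((dvd_mul_right q a).trans hd)
      obtain ⟨u₂, hu₂⟩ := hdvd a n ((dvd_mul_left a q).trans hd)
      have h1 : u = u₁ * u₂ := Units.ext (by rw [Units.val_mul, hu, hu₁, hu₂, map_mul])
      have h2 : UnitClass.mk N (.ofMul u) =
          UnitClass.mk N (.ofMul (u₁)) + UnitClass.mk N (.ofMul (u₂)) := by
        rw [h1, ofMul_mul, map_add]
      rw [h2]
      refine Submodule.add_mem _ ?_ (ih ((dvd_mul_left a q).trans hd) u₂ hu₂)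
      have hqf : q ∣ f := hq.dvd_of_dvd_pow ((dvd_mul_right q a).trans hd)
      let x : PrimeDivisor f := ⟨Associates.mk q, Associates.irreducible_mk.2 hq.irreducible,
        Associates.mk_dvd_mk.2 hqf⟩
      exact Submodule.subset_span ⟨x, hc x q rfl u₁ hu₁⟩
  have hspan : ⊤ ≤ Submodule.span ℤ (Set.range c) := by
    intro z _
    obtain ⟨u, rfl⟩ := UnitClass.mk_surjective N z
    obtain ⟨u, rfl⟩ := Additive.ofMul.surjective u
    obtain ⟨n, b, hb⟩ := hsurj u
    obtain ⟨m, b', hb'⟩ := hsurj (u⁻¹ : B'ˣ)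
    -- The numerators of `u` and `u⁻¹` multiply to a power of `f`, so `b` has no primes outside `f`.
    have hbb : b ∣ f ^ (n + m) := ⟨b', hi (by
      rw [map_pow, map_mul, ← hb, ← hb', pow_add]
      linear_combination (-(i f) ^ n * (i f) ^ m) * u.mul_inv)⟩
    obtain ⟨v, hv⟩ := hdvd b _ hbb
    obtain ⟨t, ht⟩ := hu
    have h1 : u = v * (t ^ n)⁻¹ := by
      rw [eq_mul_inv_iff_mul_eq]
      exact Units.ext (by rw [Units.val_mul, Units.val_pow_eq_pow_val, ht, hb, hv])
    have h2 : UnitClass.mk N (.ofMul u) =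
        UnitClass.mk N (.ofMul v) - n • UnitClass.mk N (.ofMul t) := by
      rw [h1, ofMul_mul, map_add, ofMul_inv, map_neg, ofMul_pow, map_nsmul, sub_eq_add_neg]
    rw [h2]
    exact Submodule.sub_mem _ (hspan' b _ hbb v hv)
      (Submodule.smul_of_tower_mem _ n (hspan' f 1 (by simp) t ht))
  refine ⟨Basis.mk hli hspan, fun x q hq v hv => ?_⟩
  rw [Basis.mk_apply]
  exact hc x q hq v hv

end LocalizedUnits

/-! ### The Galois action on unit classes -/

section UnitClasses

open Module

variable {k F : Type*} [Field k] [Field F] [Algebra k F]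

variable (k F) in
/-- The semilinear Galois action on `F ⊗ C`, by ring automorphisms. -/
def galAut (C : Type*) [CommRing C] [Algebra k C] : Gal(F/k) →* RingAut (F ⊗[k] C) where
  toFun σ := RingEquiv.ofRingHom (galTensor k F C σ : F ⊗[k] C →+* F ⊗[k] C)
    (galTensor k F C σ⁻¹ : F ⊗[k] C →+* F ⊗[k] C)
    (RingHom.ext fun x => by
      simp [← galTensor_mul_apply])
    (RingHom.ext fun x => by
      simp [← galTensor_mul_apply])
  map_one' := by ext x; simp
  map_mul' σ τ := by ext x; simp

/-- A subgroup of the units of `F ⊗ C` which is stable under the Galois action. -/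
def IsGalStable {C : Type*} [CommRing C] [Algebra k C] (N : Subgroup (F ⊗[k] C)ˣ) : Prop :=
  ∀ σ : Gal(F/k), N ≤ N.comap (Units.map (galTensor k F C σ : F ⊗[k] C →* F ⊗[k] C))

variable {C D : Type*} [CommRing C] [Algebra k C] [CommRing D] [Algebra k D]

/-- The Galois action on the units of `F ⊗ C` modulo a stable subgroup. -/
def unitClassRep (N : Subgroup (F ⊗[k] C)ˣ) (hN : IsGalStable N) :
    Representation ℤ Gal(F/k) (UnitClass N) where
  toFun σ := (UnitClass.map
    (Units.map (galTensor k F C σ : F ⊗[k] C →* F ⊗[k] C)) (hN σ)).toIntLinearMap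
  map_one' := by
    refine LinearMap.ext fun u => ?_
    obtain ⟨u, rfl⟩ := UnitClass.mk_surjective N u
    exact congrArg (fun u : (F ⊗[k] C)ˣ => UnitClass.mk N (.ofMul u))
      (Units.ext (galTensor_one_apply _))
  map_mul' σ τ := by
    refine LinearMap.ext fun u => ?_
    obtain ⟨u, rfl⟩ := UnitClass.mk_surjective N u
    exact congrArg (fun u : (F ⊗[k] C)ˣ => UnitClass.mk N (.ofMul u))
      (Units.ext (galTensor_mul_apply σ τ _))

/-- The projection from units to unit classes. -/
def unitClassMk (N : Subgroup (F ⊗[k] C)ˣ) (hN : IsGalStable N) :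
    (unitRep k F C).IntertwiningMap (unitClassRep N hN) where
  toLinearMap := (UnitClass.mk N).toIntLinearMap
  isIntertwining' _ := rfl

theorem unitClassRep_isDiscreteRep [Normal k F] (N : Subgroup (F ⊗[k] C)ˣ) (hN : IsGalStable N) :
    IsDiscreteRep (unitClassRep N hN) :=
  unitRep_isDiscreteRep.of_surjective (unitClassMk N hN) (UnitClass.mk_surjective N)

/-- The map induced on unit classes by an algebra homomorphism. -/
def unitClassMap (f : C →ₐ[k] D) {N : Subgroup (F ⊗[k] C)ˣ} {N' : Subgroup (F ⊗[k] D)ˣ}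
    (hN : IsGalStable N) (hN' : IsGalStable N')
    (h : N ≤ N'.comap (Units.map
      (Algebra.TensorProduct.map (AlgHom.id F F) f : F ⊗[k] C →* F ⊗[k] D))) :
    (unitClassRep N hN).IntertwiningMap (unitClassRep N' hN') where
  toLinearMap := (UnitClass.map _ h).toIntLinearMap
  isIntertwining' σ := by
    refine LinearMap.ext fun u => ?_
    obtain ⟨u, rfl⟩ := UnitClass.mk_surjective N u
    exact congrArg (fun u : (F ⊗[k] D)ˣ => UnitClass.mk N' (.ofMul u))
      (Units.ext (galTensor_map f σ _).symm)

theorem map_id_injective_of_injective {f : C →ₐ[k] D} (hf : Function.Injective f) :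
    Function.Injective (Algebra.TensorProduct.map (AlgHom.id F F) f) :=
  Module.Flat.lTensor_preserves_injective_linearMap (M := F) f.toLinearMap hf

theorem exists_map_id_eq_mul_pow {A₁ : Type*} [CommRing A₁] [Algebra k A₁] [Algebra A₁ C]
    [IsScalarTower k A₁ C] (f : A₁) [IsLocalization.Away f C] (z : F ⊗[k] C) :
    ∃ (n : ℕ) (b : F ⊗[k] A₁),
      z * Algebra.TensorProduct.map (AlgHom.id F F) (IsScalarTower.toAlgHom k A₁ C)
        (1 ⊗ₜ f) ^ n =
      Algebra.TensorProduct.map (AlgHom.id F F) (IsScalarTower.toAlgHom k A₁ C) b := by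
  induction z with
  | zero => exact ⟨0, 0, by simp⟩
  | tmul c z =>
    obtain ⟨n, a, ha⟩ := IsLocalization.Away.surj f z
    refine ⟨n, c ⊗ₜ a, ?_⟩
    simp [Algebra.TensorProduct.tmul_pow, ha]
  | add x y hx hy =>
    obtain ⟨n, b, hb⟩ := hx
    obtain ⟨n', b', hb'⟩ := hy
    refine ⟨n + n', b * (1 ⊗ₜ f) ^ n' + b' * (1 ⊗ₜ f) ^ n, ?_⟩
    rw [map_add, map_mul, map_mul, ← hb, ← hb', map_pow, map_pow]
    ring

/-- The units of `F ⊗ A₁[1/f]` modulo those of `F ⊗ A₁` form a permutation lattice, provided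
`F ⊗ A₁` is factorial. -/
theorem isPermutationLattice_unitClassRep {k : Type*} [Field k]
    {F C : Type u} [Field F] [Algebra k F] [Normal k F] {A₁ : Type*} [CommRing A₁] [Algebra k A₁]
    [CommRing C] [Algebra k C] [Algebra A₁ C] [IsScalarTower k A₁ C]
    {f : A₁} [IsLocalization.Away f C] (hf : f ≠ 0)
    [IsDomain (F ⊗[k] A₁)] [UniqueFactorizationMonoid (F ⊗[k] A₁)]
    (hinj : Function.Injective (algebraMap A₁ C))
    (N : Subgroup (F ⊗[k] C)ˣ) (hN : IsGalStable N)
    (hN' : ∀ u, u ∈ N ↔ ∃ v : (F ⊗[k] A₁)ˣ,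
      Algebra.TensorProduct.map (AlgHom.id F F) (IsScalarTower.toAlgHom k A₁ C) v = u) :
    IsPermutationLattice (unitClassRep N hN) := by
  let i := Algebra.TensorProduct.map (AlgHom.id F F) (IsScalarTower.toAlgHom k A₁ C)
  have hi : Function.Injective i := map_id_injective_of_injective hinj
  have hf' : (1 ⊗ₜ f : F ⊗[k] A₁) ≠ 0 := fun h => hf
    (Algebra.TensorProduct.includeRight_injective (A := F) (B := A₁) (R := k)
      (FaithfulSMul.algebraMap_injective k F) (by simpa using h))
  obtain ⟨b, hb⟩ := exists_basis_units (i : F ⊗[k] A₁ →+* F ⊗[k] C) hi (f := 1 ⊗ₜ f)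
    (by
      change IsUnit ((Algebra.TensorProduct.includeRight : C →ₐ[k] F ⊗[k] C) (algebraMap A₁ C f))
      exact (IsLocalization.Away.algebraMap_isUnit f).map _)
    (exists_map_id_eq_mul_pow f) N hN'
  have := PrimeDivisor.finite hf'
  -- Since `f` is defined over `k`, the Galois group permutes the prime divisors of `1 ⊗ f`, and
  -- with them the basis `b`.
  have hfix : ∀ σ, galTensor k F A₁ σ (1 ⊗ₜ f) = 1 ⊗ₜ f := fun σ => by simp
  let φ : Gal(F/k) → Associates (F ⊗[k] A₁) → Associates (F ⊗[k] A₁) := fun σ =>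
    Quotient.map (galTensor k F A₁ σ) fun _ _ h => h.map _
  have hφ : ∀ σ q, φ σ (Associates.mk q) = Associates.mk (galTensor k F A₁ σ q) := fun _ _ => rfl
  have hφ_mul : ∀ σ τ x, φ (σ * τ) x = φ σ (φ τ x) := fun σ τ x => by
    obtain ⟨q, rfl⟩ := Associates.mk_surjective x
    simp only [hφ, galTensor_mul_apply]
  have hφ_one : ∀ x, φ 1 x = x := fun x => by
    obtain ⟨q, rfl⟩ := Associates.mk_surjective x
    simp only [hφ, galTensor_one_apply]
  have hmem : ∀ σ (x : PrimeDivisor (1 ⊗ₜ f : F ⊗[k] A₁)),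
      Irreducible (φ σ x.1) ∧ φ σ x.1 ∣ Associates.mk (1 ⊗ₜ f) := by
    intro σ x
    obtain ⟨q, hq⟩ := Associates.mk_surjective x.1
    obtain ⟨h1, h2⟩ := x.2
    rw [← hq] at h1 h2 ⊢
    rw [Associates.irreducible_mk] at h1
    rw [Associates.mk_dvd_mk] at h2
    rw [hφ, Associates.irreducible_mk, Associates.mk_dvd_mk]
    refine ⟨(MulEquiv.irreducible_iff (galAut k F A₁ σ)).2 h1, ?_⟩
    rw [← hfix σ]
    exact map_dvd _ h2
  let act : MulAction Gal(F/k) (PrimeDivisor (1 ⊗ₜ f : F ⊗[k] A₁)) :=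
    { smul := fun σ x => ⟨φ σ x.1, hmem σ x⟩
      one_smul := fun x => Subtype.ext (hφ_one x.1)
      mul_smul := fun σ τ x => Subtype.ext (hφ_mul σ τ x.1) }
  refine .of_finite (unitClassRep_isDiscreteRep N hN) (b := b)
    (a := MulAction.toPermHom Gal(F/k) (PrimeDivisor (1 ⊗ₜ f : F ⊗[k] A₁))) fun σ x => ?_
  obtain ⟨q, hq⟩ := Associates.mk_surjective x.1
  have hqdvd : q ∣ 1 ⊗ₜ f := by
    have := x.2.2
    rwa [← hq, Associates.mk_dvd_mk] at this
  obtain ⟨w, hw⟩ := isUnit_of_dvd_unit (map_dvd i hqdvd) (by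
      change IsUnit ((Algebra.TensorProduct.includeRight : C →ₐ[k] F ⊗[k] C) (algebraMap A₁ C f))
      exact (IsLocalization.Away.algebraMap_isUnit f).map _)
  rw [hb x q hq w hw]
  symm
  refine hb _ (galTensor k F A₁ σ q) ?_ _ ?_
  · rw [← hφ, hq]; rfl
  · change galTensor k F C σ w = i _
    rw [hw]
    exact galTensor_map _ σ q

end UnitClasses

end

noncomputable section

/-! ### Laurent polynomial rings and their units -/

section LaurentRing

open MvPolynomial

variable (F : Type*) [Field F] (n : ℕ)

/-- The inclusion of the polynomial ring in the group algebra of `ℤⁿ`. -/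
def laurentHom : MvPolynomial (Fin n) F →ₐ[F] MonoidAlgebra F (Multiplicative (Fin n → ℤ)) :=
  aeval fun i => MonoidAlgebra.of F _ (Multiplicative.ofAdd (Pi.single i 1))

variable {F n}

theorem laurentHom_monomial (m : Fin n →₀ ℕ) (c : F) :
    laurentHom F n (monomial m c) =
      MonoidAlgebra.single (Multiplicative.ofAdd fun i => (m i : ℤ)) c := by
  have h : ∀ i, (MonoidAlgebra.of F (Multiplicative (Fin n → ℤ))
      (Multiplicative.ofAdd (Pi.single i 1))) ^ m i =
      MonoidAlgebra.of F _ (Multiplicative.ofAdd (m i • Pi.single i 1)) := fun i => by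
    rw [← map_pow]; rfl
  rw [laurentHom, aeval_monomial, Finsupp.prod_fintype _ _ (fun i => by simp)]
  simp only [h]
  rw [← map_prod, ← ofAdd_sum]
  have h2 : ∑ i, m i • (Pi.single i 1 : Fin n → ℤ) = fun i => (m i : ℤ) := by
    ext j
    simp [Finset.sum_apply, Pi.single_apply]
  rw [h2, ← Algebra.smul_def, MonoidAlgebra.of_apply, MonoidAlgebra.smul_single, smul_eq_mul,
    mul_one]

theorem laurentHom_injective : Function.Injective (laurentHom F n) := by
  have h : ∀ (m : Fin n →₀ ℕ) (p : MvPolynomial (Fin n) F),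
      (laurentHom F n p).coeff (Multiplicative.ofAdd fun i => (m i : ℤ)) = coeff m p := by
    classical
    intro m p
    induction p using MvPolynomial.induction_on' with
    | monomial m' c =>
      rw [laurentHom_monomial, coeff_monomial, MonoidAlgebra.coeff_single, Finsupp.single_apply]
      congr 1
      refine propext ⟨fun h => Finsupp.ext fun i => ?_, fun h => by rw [h]⟩
      exact_mod_cast congrFun (Multiplicative.ofAdd.injective h) i
    | add p q hp hq => rw [map_add, coeff_add, ← hp, ← hq]; simp
  intro p q hpq
  ext m
  rw [← h, ← h, hpq]

theorem laurentHom_prod_X :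
    laurentHom F n (∏ i, X i) = MonoidAlgebra.of F _ (Multiplicative.ofAdd fun _ => 1) := by
  have : (∏ i, X i : MvPolynomial (Fin n) F) = monomial (∑ i, Finsupp.single i 1) 1 := by
    rw [monomial_sum_one]; rfl
  rw [this, laurentHom_monomial, MonoidAlgebra.of_apply]
  congr 2
  ext i
  simp [Finsupp.finsetSum_apply, Finsupp.single_apply]

theorem isUnit_laurentHom_prod_X : IsUnit (laurentHom F n (∏ i, X i)) := by
  rw [laurentHom_prod_X]
  exact (Group.isUnit _).map _

theorem exists_laurentHom_eq_mul_pow (z : MonoidAlgebra F (Multiplicative (Fin n → ℤ))) :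
    ∃ (N : ℕ) (p : MvPolynomial (Fin n) F),
      z * laurentHom F n (∏ i, X i) ^ N = laurentHom F n p := by
  induction z using MonoidAlgebra.induction_linear with
  | zero => exact ⟨0, 0, by simp⟩
  | add x y hx hy =>
    obtain ⟨N, p, hp⟩ := hx
    obtain ⟨N', p', hp'⟩ := hy
    refine ⟨N + N', p * (∏ i, X i) ^ N' + p' * (∏ i, X i) ^ N, ?_⟩
    rw [map_add, map_mul, map_mul, ← hp, ← hp', map_pow, map_pow]
    ring
  | single g c =>
    -- Multiplication by the `N`th power of the product of the variables raises each exponent by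
    -- `N`, which outweighs every negative exponent of `g`.
    let N : ℕ := ∑ i, (g.toAdd i).natAbs
    refine ⟨N, monomial (Finsupp.equivFunOnFinite.symm fun i => (g.toAdd i + N).toNat) c, ?_⟩
    rw [laurentHom_prod_X, laurentHom_monomial, ← map_pow, MonoidAlgebra.of_apply,
      MonoidAlgebra.single_mul_single, mul_one]
    congr 1
    apply Multiplicative.toAdd.injective
    ext i
    have h1 : (g.toAdd i).natAbs ≤ N :=
      Finset.single_le_sum (f := fun i => (g.toAdd i).natAbs) (fun _ _ => Nat.zero_le _)
        (Finset.mem_univ i)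
    simp
    omega

theorem laurentRing_uniqueFactorizationMonoid :
    UniqueFactorizationMonoid (MonoidAlgebra F (Multiplicative (Fin n → ℤ))) := by
  let _ : Algebra (MvPolynomial (Fin n) F) (MonoidAlgebra F (Multiplicative (Fin n → ℤ))) :=
    (laurentHom F n).toRingHom.toAlgebra
  have : IsLocalization.Away (∏ i, X i : MvPolynomial (Fin n) F)
      (MonoidAlgebra F (Multiplicative (Fin n → ℤ))) :=
    IsLocalization.Away.mk _ isUnit_laurentHom_prod_X exists_laurentHom_eq_mul_pow
      fun a b h => ⟨0, by simpa using laurentHom_injective h⟩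
  exact UniqueFactorizationMonoid.of_isLocalization
    (Submonoid.powers (∏ i, X i : MvPolynomial (Fin n) F)) _

/-- If `u` had several terms, the supports of `u` and its inverse would have two distinct uniquely
represented products. Neither can cancel in `u * v = 1`, so both equal the identity, against
uniqueness. -/
theorem MonoidAlgebra.exists_eq_single_of_isUnit {G : Type*} [Group G] [TwoUniqueProds G]
    {u : MonoidAlgebra F G} (hu : IsUnit u) : ∃ g c, c ≠ 0 ∧ u = MonoidAlgebra.single g c := by
  classical
  obtain ⟨⟨u, v, huv, -⟩, rfl⟩ := hu
  change ∃ g c, c ≠ 0 ∧ u = _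
  have hu0 : u ≠ 0 := fun h => by simp [h] at huv
  have hv0 : v ≠ 0 := fun h => by simp [h] at huv
  have hu1 : 0 < u.coeff.support.card := Finset.card_pos.2 (by simpa using hu0)
  have hv1 : 0 < v.coeff.support.card := Finset.card_pos.2 (by simpa using hv0)
  have hcard : u.coeff.support.card = 1 := by
    by_contra hne
    obtain ⟨p, hp, q, hq, hpq, h1, h2⟩ := TwoUniqueProds.uniqueMul_of_one_lt_card
      (A := u.coeff.support) (B := v.coeff.support) (by nlinarith [Nat.lt_of_le_of_ne hu1 (Ne.symm hne)])
    have key : ∀ p ∈ u.coeff.support ×ˢ v.coeff.support,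
        UniqueMul u.coeff.support v.coeff.support p.1 p.2 → p.1 * p.2 = 1 := by
      intro p hp h
      have h3 := MonoidAlgebra.coeff_mul_mul_of_uniqueMul h
      rw [huv, MonoidAlgebra.one_def, MonoidAlgebra.coeff_single, Finsupp.single_apply] at h3
      by_contra hne
      rw [if_neg (Ne.symm hne)] at h3
      rw [Finset.mem_product, Finsupp.mem_support_iff, Finsupp.mem_support_iff] at hp
      exact mul_ne_zero hp.1 hp.2 h3.symm
    have hp' := Finset.mem_product.1 hp
    have h3 := h2 hp'.1 hp'.2 ((key p hp h1).trans (key q hq h2).symm)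
    exact hpq (Prod.ext h3.1 h3.2)
  obtain ⟨g, hg⟩ := Finset.card_eq_one.1 hcard
  obtain ⟨c, hc⟩ := Finsupp.support_eq_singleton.1 hg
  exact ⟨g, u.coeff g, c, MonoidAlgebra.coeff_injective (by rw [hc]; simp)⟩

end LaurentRing

/-! ### Units and characters of split tori -/

section SplitHopfAlgebra

variable {F H : Type*} [Field F] [CommRing H] [HopfAlgebra F H] {n : ℕ}

/-- Rosenlicht's lemma for a split torus: units of the Laurent ring are scalar multiples of
monomials, and monomials are the characters. -/
theorem exists_smul_groupLike_of_isUnit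
    (e : H ≃ₐc[F] MonoidAlgebra F (Multiplicative (Fin n → ℤ))) {u : H} (hu : IsUnit u) :
    ∃ (c : F) (χ : GroupLike F H), c ≠ 0 ∧ u = c • χ.val := by
  obtain ⟨g, c, hc, h⟩ := MonoidAlgebra.exists_eq_single_of_isUnit (hu.map e)
  refine ⟨c, ⟨e.symm (MonoidAlgebra.of F _ g),
    (MonoidAlgebra.isGroupLikeElem_of g).map e.symm⟩, hc, ?_⟩
  rw [← map_smul, MonoidAlgebra.of_apply, MonoidAlgebra.smul_single, smul_eq_mul, mul_one, ← h]
  exact (e.symm_apply_apply u).symm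

theorem span_groupLike_eq_top
    (e : H ≃ₐc[F] MonoidAlgebra F (Multiplicative (Fin n → ℤ))) :
    Submodule.span F (Set.range (GroupLike.val (R := F) (A := H))) = ⊤ := by
  rw [eq_top_iff]
  intro x _
  obtain ⟨z, rfl⟩ : ∃ z, e.symm z = x := ⟨e x, e.symm_apply_apply x⟩
  induction z using MonoidAlgebra.induction_linear with
  | zero => rw [map_zero]; exact Submodule.zero_mem _
  | add x y hx hy => rw [map_add]; exact Submodule.add_mem _ (hx trivial) (hy trivial)
  | single g c =>
    have : MonoidAlgebra.single g c = c • MonoidAlgebra.of F _ g := by simp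
    rw [this, map_smul]
    exact Submodule.smul_mem _ _ (Submodule.subset_span
      ⟨⟨_, (MonoidAlgebra.isGroupLikeElem_of g).map e.symm⟩, rfl⟩)

/-- The group-like elements of a split Hopf algebra form a free abelian group. -/
theorem nonempty_groupLike_equiv
    (e : H ≃ₐc[F] MonoidAlgebra F (Multiplicative (Fin n → ℤ))) :
    Nonempty (GroupLike F H ≃* Multiplicative (Fin n → ℤ)) := by
  let f : Multiplicative (Fin n → ℤ) →* GroupLike F H :=
    { toFun := fun g => ⟨e.symm (MonoidAlgebra.of F _ g),
        (MonoidAlgebra.isGroupLikeElem_of g).map e.symm⟩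
      map_one' := GroupLike.val_injective
        ((congrArg e.symm (map_one (MonoidAlgebra.of F _))).trans (map_one e.symm))
      map_mul' := fun g h => GroupLike.val_injective (by simp [← map_mul]) }
  refine ⟨(MulEquiv.ofBijective f ⟨fun g h hgh => ?_, fun χ => ?_⟩).symm⟩
  · exact MonoidAlgebra.of_injective (e.symm.injective (congrArg GroupLike.val hgh))
  · obtain ⟨g, hg⟩ := MonoidAlgebra.isGroupLikeElem_iff_mem_range_of.1 (χ.2.map e)
    exact ⟨g, GroupLike.val_injective (by
      change e.symm (MonoidAlgebra.of F _ g) = χ.val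
      rw [hg]; exact e.symm_apply_apply _)⟩

theorem exists_algebraicIndependent
    (e : H ≃ₐc[F] MonoidAlgebra F (Multiplicative (Fin n → ℤ))) :
    ∃ t : Fin n → H, AlgebraicIndependent F t := by
  let e' : MonoidAlgebra F (Multiplicative (Fin n → ℤ)) →ₐ[F] H := e.symm
  have he' : Function.Injective e' := e.symm.injective
  have h : AlgebraicIndependent F fun i : Fin n =>
      MonoidAlgebra.of F _ (Multiplicative.ofAdd (Pi.single i 1 : Fin n → ℤ)) :=
    laurentHom_injective
  exact ⟨_, h.map' (f := e') he'⟩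

end SplitHopfAlgebra

end

noncomputable section

/-! ### Resolving the character lattice by units -/

section CharacterResolution

open Module

variable {k : Type*} [Field k]

section

variable {F : Type*} [Field F] [Algebra k F] {C : Type*} [CommRing C] [Algebra k C]

variable (k F C) in
/-- The units of `F ⊗ C` that are scalars. -/
def scalarUnits : Subgroup (F ⊗[k] C)ˣ :=
  (Units.map (algebraMap F (F ⊗[k] C) : F →* F ⊗[k] C)).range

theorem mem_scalarUnits [Nontrivial (F ⊗[k] C)] {u : (F ⊗[k] C)ˣ} :
    u ∈ scalarUnits k F C ↔ ∃ c : F, c • (1 : F ⊗[k] C) = u := by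
  constructor
  · rintro ⟨c, rfl⟩
    exact ⟨c, (Algebra.algebraMap_eq_smul_one _).symm⟩
  · rintro ⟨c, hc⟩
    have hc0 : c ≠ 0 := fun h => u.ne_zero (by rw [← hc, h, zero_smul])
    exact ⟨Units.mk0 c hc0, Units.ext ((Algebra.algebraMap_eq_smul_one _).trans hc)⟩

theorem scalarUnits_isGalStable : IsGalStable (scalarUnits k F C) := by
  rintro σ _ ⟨c, rfl⟩
  exact ⟨Units.map ((σ : F →+* F) : F →* F) c, Units.ext rfl⟩

theorem scalarUnits_le_comap {D : Type*} [CommRing D] [Algebra k D] (f : C →ₐ[k] D) :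
    scalarUnits k F C ≤ (scalarUnits k F D).comap (Units.map
      (Algebra.TensorProduct.map (AlgHom.id F F) f : F ⊗[k] C →* F ⊗[k] D)) := by
  rintro _ ⟨c, rfl⟩
  exact ⟨c, Units.ext ((Algebra.TensorProduct.map (AlgHom.id F F) f).commutes c).symm⟩

variable (F) in
/-- The units of `F ⊗ C` that come from units of `F ⊗ A₁`. -/
def baseUnits {A₁ : Type*} [CommRing A₁] [Algebra k A₁] (i : A₁ →ₐ[k] C) :
    Subgroup (F ⊗[k] C)ˣ :=
  (Units.map (Algebra.TensorProduct.map (AlgHom.id F F) i : F ⊗[k] A₁ →* F ⊗[k] C)).range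

theorem mem_baseUnits {A₁ : Type*} [CommRing A₁] [Algebra k A₁] (i : A₁ →ₐ[k] C)
    (u : (F ⊗[k] C)ˣ) : u ∈ baseUnits F i ↔
      ∃ v : (F ⊗[k] A₁)ˣ, Algebra.TensorProduct.map (AlgHom.id F F) i v = u :=
  ⟨fun ⟨v, hv⟩ => ⟨v, congrArg Units.val hv⟩, fun ⟨v, hv⟩ => ⟨v, Units.ext hv⟩⟩

theorem baseUnits_isGalStable {A₁ : Type*} [CommRing A₁] [Algebra k A₁] (i : A₁ →ₐ[k] C) :
    IsGalStable (baseUnits F i) := by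
  rintro σ _ ⟨v, rfl⟩
  exact ⟨Units.map (galTensor k F A₁ σ : F ⊗[k] A₁ →* F ⊗[k] A₁) v,
    Units.ext (galTensor_map i σ _).symm⟩

theorem scalarUnits_le_baseUnits {A₁ : Type*} [CommRing A₁] [Algebra k A₁] (i : A₁ →ₐ[k] C) :
    scalarUnits k F C ≤ baseUnits F i := by
  rintro _ ⟨c, rfl⟩
  exact ⟨Units.map (algebraMap F (F ⊗[k] A₁) : F →* F ⊗[k] A₁) c,
    Units.ext ((Algebra.TensorProduct.map (AlgHom.id F F) i).commutes c)⟩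

end

section

variable {F A : Type*} [Field F] [Algebra k F] [CommRing A] [HopfAlgebra k A] {r m : ℕ}

theorem rTensorAlgEquiv_map_C (x : F ⊗[k] A) :
    MvPolynomial.rTensorAlgEquiv (Algebra.TensorProduct.map (AlgHom.id F F)
      (IsScalarTower.toAlgHom k A (MvPolynomial (Fin m) A)) x) = MvPolynomial.C x := by
  classical
  ext d
  induction x with
  | zero => simp
  | tmul c a =>
    rw [Algebra.TensorProduct.map_tmul, MvPolynomial.coeff_rTensorAlgEquiv_tmul,
      MvPolynomial.coeff_C]
    change c ⊗ₜ[k] (MvPolynomial.C a).coeff d = _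
    rw [MvPolynomial.coeff_C, TensorProduct.tmul_ite]
  | add x y hx hy => simp only [map_add, MvPolynomial.coeff_add, hx, hy]

variable (e : (F ⊗[k] A) ≃ₐc[F] MonoidAlgebra F (Multiplicative (Fin r → ℤ)))

include e

theorem isDomain_tensor_of_split : IsDomain (F ⊗[k] A) :=
  Function.Injective.isDomain
    ((e : (F ⊗[k] A) →ₐc[F] MonoidAlgebra F (Multiplicative (Fin r → ℤ))) :
      (F ⊗[k] A) →ₐ[F] MonoidAlgebra F (Multiplicative (Fin r → ℤ))).toRingHom
    (EquivLike.injective e)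

theorem uniqueFactorizationMonoid_tensor_of_split : UniqueFactorizationMonoid (F ⊗[k] A) :=
  MulEquiv.uniqueFactorizationMonoid
    (e.symm : MonoidAlgebra F (Multiplicative (Fin r → ℤ)) ≃* F ⊗[k] A)
    laurentRing_uniqueFactorizationMonoid

theorem isDomain_tensor_mvPolynomial : IsDomain (F ⊗[k] MvPolynomial (Fin m) A) :=
  have := isDomain_tensor_of_split e
  (MvPolynomial.rTensorAlgEquiv (R := k) (S := F) (N := A) (σ := Fin m)).injective.isDomain

theorem uniqueFactorizationMonoid_tensor_mvPolynomial :
    UniqueFactorizationMonoid (F ⊗[k] MvPolynomial (Fin m) A) :=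
  have := isDomain_tensor_of_split e
  have := uniqueFactorizationMonoid_tensor_of_split e
  MulEquiv.uniqueFactorizationMonoid
    (MvPolynomial.rTensorAlgEquiv (R := k) (S := F) (N := A) (σ := Fin m)).symm.toMulEquiv
    inferInstance

/-- As `F ⊗ A` is a domain, polynomial variables add no units, so `T × 𝔸ᵐ` has the same units as
`T`. -/
theorem exists_character_of_isUnit {u : F ⊗[k] MvPolynomial (Fin m) A} (hu : IsUnit u) :
    ∃ (c : F) (χ : GroupLike F (F ⊗[k] A)), c ≠ 0 ∧
      u = c • Algebra.TensorProduct.map (AlgHom.id F F)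
        (IsScalarTower.toAlgHom k A (MvPolynomial (Fin m) A)) χ.val := by
  have := isDomain_tensor_of_split e
  let j := MvPolynomial.rTensorAlgEquiv (R := k) (S := F) (N := A) (σ := Fin m)
  obtain ⟨v, hv, hv'⟩ := MvPolynomial.isUnit_iff_eq_C_of_isReduced.1 (hu.map j)
  obtain ⟨c, χ, hc, rfl⟩ := exists_smul_groupLike_of_isUnit e hv
  refine ⟨c, χ, hc, j.injective ?_⟩
  rw [hv', ← rTensorAlgEquiv_map_C, map_smul]

end

section

variable {F A : Type u} [Field F] [Algebra k F] [CommRing A] [HopfAlgebra k A] {r m : ℕ}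

/-- The map sending a character to the class of the corresponding unit. -/
def characterToUnitClass {C : Type*} [CommRing C] [Algebra k C] (i : A →ₐ[k] C) :
    (characterRep k F A).IntertwiningMap
      (unitClassRep (scalarUnits k F C) scalarUnits_isGalStable) where
  toLinearMap := ((UnitClass.mk _).comp (MonoidHom.toAdditive
    ((Units.map (Algebra.TensorProduct.map (AlgHom.id F F) i : F ⊗[k] A →* F ⊗[k] C)).comp
      (GroupLike.toUnits F : GroupLike F (F ⊗[k] A) →* (F ⊗[k] A)ˣ)))).toIntLinearMap
  isIntertwining' σ := LinearMap.ext fun _ =>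
    congrArg (fun u : (F ⊗[k] C)ˣ => UnitClass.mk _ (.ofMul u))
      (Units.ext (galTensor_map i σ _).symm)

variable (e : (F ⊗[k] A) ≃ₐc[F] MonoidAlgebra F (Multiplicative (Fin r → ℤ)))

include e

/-- The resolution of the character lattice by the unit classes of an open subset
of `T × 𝔸ᵐ`. -/
def characterResolution {C : Type*} [CommRing C] [Algebra k C]
    [Algebra (MvPolynomial (Fin m) A) C] [IsScalarTower k (MvPolynomial (Fin m) A) C]
    (hinj : Function.Injective (algebraMap (MvPolynomial (Fin m) A) C)) :
    Resolution (characterRep k F A)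
      (unitClassRep (scalarUnits k F C) scalarUnits_isGalStable)
      (unitClassRep (baseUnits F (IsScalarTower.toAlgHom k (MvPolynomial (Fin m) A) C))
        (baseUnits_isGalStable _)) := by
  let i₀ : A →ₐ[k] MvPolynomial (Fin m) A := IsScalarTower.toAlgHom k A _
  let i₁ := IsScalarTower.toAlgHom k (MvPolynomial (Fin m) A) C
  have hi₀ : Function.Injective i₀ := MvPolynomial.C_injective _ _
  have hinj' : Function.Injective (Algebra.TensorProduct.map (AlgHom.id F F) (i₁.comp i₀)) :=
    map_id_injective_of_injective (hinj.comp hi₀)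
  have hcomp : ∀ x : F ⊗[k] A, Algebra.TensorProduct.map (AlgHom.id F F) (i₁.comp i₀) x =
      Algebra.TensorProduct.map (AlgHom.id F F) i₁
        (Algebra.TensorProduct.map (AlgHom.id F F) i₀ x) := fun x => by
    induction x with
    | zero => simp
    | tmul c x => simp
    | add x y hx hy => simp only [map_add, hx, hy]
  have : IsDomain (F ⊗[k] A) := isDomain_tensor_of_split e
  have : Nontrivial (F ⊗[k] C) := hinj'.nontrivial
  have hle : scalarUnits k F C ≤ (baseUnits F i₁).comap (Units.map
      (Algebra.TensorProduct.map (AlgHom.id F F) (AlgHom.id k C) : F ⊗[k] C →* F ⊗[k] C)) := by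
    intro u hu
    have h : Units.map (Algebra.TensorProduct.map (AlgHom.id F F) (AlgHom.id k C) :
        F ⊗[k] C →* F ⊗[k] C) u = u := Units.ext (by simp)
    rw [Subgroup.mem_comap, h]
    exact scalarUnits_le_baseUnits i₁ hu
  have hproj : ∀ u, unitClassMap (AlgHom.id k C) scalarUnits_isGalStable
      (baseUnits_isGalStable i₁) hle (UnitClass.mk _ u) = UnitClass.mk _ u := fun u =>
    congrArg (fun u : (F ⊗[k] C)ˣ => UnitClass.mk _ (.ofMul u))
      (Units.ext (by simp : Algebra.TensorProduct.map (AlgHom.id F F) (AlgHom.id k C)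
        (u.toMul : F ⊗[k] C) = (u.toMul : F ⊗[k] C)))
  refine
    { incl := characterToUnitClass (i₁.comp i₀)
      proj := unitClassMap (AlgHom.id k C) scalarUnits_isGalStable (baseUnits_isGalStable _) hle
      incl_injective := ?_
      proj_surjective := fun z => ?_
      proj_eq_zero_iff := fun z => ?_ }
  · refine (injective_iff_map_eq_zero _).2 fun χ hχ => ?_
    obtain ⟨c, hc⟩ := mem_scalarUnits.1 (UnitClass.mk_eq_zero.1 hχ)
    have h1 : c • (1 : F ⊗[k] A) = (χ.toMul : GroupLike F (F ⊗[k] A)).val := hinj' (by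
      rw [map_smul, map_one]; exact hc)
    -- The counit of a character is `1`, which forces the scalar to be `1`.
    have h2 := congrArg (Coalgebra.counit (R := F)) h1
    rw [map_smul, Bialgebra.counit_one, (χ.toMul : GroupLike F (F ⊗[k] A)).2.counit_eq_one,
      smul_eq_mul, mul_one] at h2
    rw [h2, one_smul] at h1
    exact Additive.toMul.injective (GroupLike.val_injective h1.symm)
  · obtain ⟨u, rfl⟩ := UnitClass.mk_surjective _ z
    exact ⟨_, hproj u⟩
  · obtain ⟨u, rfl⟩ := UnitClass.mk_surjective _ z
    rw [hproj, UnitClass.mk_eq_zero, mem_baseUnits]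
    constructor
    · rintro ⟨v, hv⟩
      -- Exactness in the middle is Rosenlicht's lemma: the factor `c` is invisible modulo scalars.
      obtain ⟨c, χ, hc, hcχ⟩ := exists_character_of_isUnit e v.isUnit
      refine ⟨Additive.ofMul (χ : Character k F A), ?_⟩
      rw [← sub_eq_zero]
      refine (map_sub (UnitClass.mk (scalarUnits k F C)) (Additive.ofMul
        (Units.map (Algebra.TensorProduct.map (AlgHom.id F F) (i₁.comp i₀) :
          F ⊗[k] A →* F ⊗[k] C) (GroupLike.toUnits F χ))) u).symm.trans
        (UnitClass.mk_eq_zero.2 (mem_scalarUnits.2 ⟨c⁻¹, ?_⟩))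
      change _ = ((Units.map (Algebra.TensorProduct.map (AlgHom.id F F) (i₁.comp i₀) :
          F ⊗[k] A →* F ⊗[k] C) (GroupLike.toUnits F χ) * (u.toMul)⁻¹ : (F ⊗[k] C)ˣ) : F ⊗[k] C)
      rw [Units.val_mul, Units.eq_mul_inv_iff_mul_eq, ← hv, hcχ, map_smul, smul_mul_smul_comm,
        inv_mul_cancel₀ hc, one_smul, one_mul]
      exact (hcomp _).symm
    · rintro ⟨χ, hχ⟩
      have h1 := hχ
      rw [← sub_eq_zero] at h1
      have h2 := (map_sub (UnitClass.mk (scalarUnits k F C)) (Additive.ofMul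
        (Units.map (Algebra.TensorProduct.map (AlgHom.id F F) (i₁.comp i₀) :
          F ⊗[k] A →* F ⊗[k] C) (GroupLike.toUnits F (χ.toMul : GroupLike F (F ⊗[k] A)))))
        u).trans h1
      have h3 := scalarUnits_le_baseUnits i₁ (UnitClass.mk_eq_zero.1 h2)
      have h4 : Units.map (Algebra.TensorProduct.map (AlgHom.id F F) (i₁.comp i₀) :
          F ⊗[k] A →* F ⊗[k] C) (GroupLike.toUnits F (χ.toMul : GroupLike F (F ⊗[k] A))) ∈
          baseUnits F i₁ := ⟨Units.map (Algebra.TensorProduct.map (AlgHom.id F F) i₀ :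
          F ⊗[k] A →* F ⊗[k] MvPolynomial (Fin m) A) (GroupLike.toUnits F
            (χ.toMul : GroupLike F (F ⊗[k] A))), Units.ext (hcomp _).symm⟩
      rw [← mem_baseUnits]
      have h5 := mul_mem ((baseUnits F i₁).div_mem_comm_iff.1 h3) h4
      rwa [toMul_ofMul, div_mul_cancel] at h5

theorem exists_isPermutationLattice_projClasses [Normal k F] {C : Type u} [CommRing C]
    [Algebra k C] [Algebra (MvPolynomial (Fin m) A) C] [IsScalarTower k (MvPolynomial (Fin m) A) C]
    (hinj : Function.Injective (algebraMap (MvPolynomial (Fin m) A) C))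
    {f : MvPolynomial (Fin m) A} (hf : f ≠ 0) [IsLocalization.Away f C] :
    IsPermutationLattice
      (unitClassRep (baseUnits F (IsScalarTower.toAlgHom k (MvPolynomial (Fin m) A) C))
        (baseUnits_isGalStable _)) :=
  have := isDomain_tensor_mvPolynomial (m := m) e
  have := uniqueFactorizationMonoid_tensor_mvPolynomial (m := m) e
  isPermutationLattice_unitClassRep hf hinj _ _ (mem_baseUnits _)

-- Affine space over `F` has only scalar units, so here the scalars are exactly the base units and
-- the factorial case applies.
omit e in
theorem isPermutationLattice_scalarClasses [Normal k F] {n : ℕ} {D : Type u} [CommRing D]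
    [Algebra k D] [Algebra (MvPolynomial (Fin n) k) D] [IsScalarTower k (MvPolynomial (Fin n) k) D]
    {g : MvPolynomial (Fin n) k} (hg : g ≠ 0) [IsLocalization.Away g D] :
    IsPermutationLattice (unitClassRep (scalarUnits k F D) scalarUnits_isGalStable) := by
  have hinj : Function.Injective (algebraMap (MvPolynomial (Fin n) k) D) :=
    IsLocalization.injective D (powers_le_nonZeroDivisors_of_noZeroDivisors hg)
  let j := MvPolynomial.algebraTensorAlgEquiv (σ := Fin n) k F
  have : IsDomain (F ⊗[k] MvPolynomial (Fin n) k) := j.injective.isDomain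
  have : UniqueFactorizationMonoid (F ⊗[k] MvPolynomial (Fin n) k) :=
    MulEquiv.uniqueFactorizationMonoid j.symm.toMulEquiv inferInstance
  have : Nontrivial (F ⊗[k] D) := (map_id_injective_of_injective (F := F)
    (f := IsScalarTower.toAlgHom k (MvPolynomial (Fin n) k) D) hinj).nontrivial
  refine isPermutationLattice_unitClassRep hg hinj _ _ fun u =>
    ⟨fun hu => (mem_baseUnits _ u).1 (scalarUnits_le_baseUnits _ hu), ?_⟩
  rintro ⟨v, hv⟩
  obtain ⟨c, hc, hc'⟩ := MvPolynomial.isUnit_iff_eq_C_of_isReduced.1 (v.isUnit.map j)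
  refine mem_scalarUnits.2 ⟨c, ?_⟩
  have : (v : F ⊗[k] MvPolynomial (Fin n) k) = c • 1 := j.injective (by
    rw [hc', map_smul, map_one, MvPolynomial.smul_eq_C_mul, mul_one])
  rw [← hv, this, map_smul, map_one]

variable {n : ℕ} {C D : Type u} [CommRing C] [CommRing D] [Algebra k C] [Algebra k D]
  [Algebra (MvPolynomial (Fin m) A) C] [IsScalarTower k (MvPolynomial (Fin m) A) C]
  [Algebra (MvPolynomial (Fin n) k) D] [IsScalarTower k (MvPolynomial (Fin n) k) D]
  {f : MvPolynomial (Fin m) A} (hf : f ≠ 0) [IsLocalization.Away f C]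
  {g : MvPolynomial (Fin n) k} (hg : g ≠ 0) [IsLocalization.Away g D]

include hf hg

/-- If a principal open subset of `T × 𝔸ᵐ` is a retract of a principal open subset of affine space,
then the character lattice has a resolution by an invertible lattice and a permutation lattice. -/
theorem hasRetractResolution_of_retract [Normal k F] (φ : C →ₐ[k] D) (ψ : D →ₐ[k] C)
    (h : ψ.comp φ = AlgHom.id k C) : HasRetractResolution (characterRep k F A) := by
  have := isDomain_tensor_of_split e
  have : IsDomain A := (Algebra.TensorProduct.includeRight_injective (R := k) (A := F) (B := A)
    (FaithfulSMul.algebraMap_injective k F)).isDomain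
      (Algebra.TensorProduct.includeRight : A →ₐ[k] F ⊗[k] A)
  have hinj : Function.Injective (algebraMap (MvPolynomial (Fin m) A) C) :=
    IsLocalization.injective C (powers_le_nonZeroDivisors_of_noZeroDivisors hf)
  -- Units modulo scalars are functorial, so `ψ ∘ φ = id` makes the classes of `C` a direct summand
  -- of those of `D`.
  refine ⟨_, _, _, _, _, _, ⟨characterResolution e hinj⟩, ⟨_, _, _,
    isPermutationLattice_scalarClasses (D := D) hg,
    unitClassMap φ _ _ (scalarUnits_le_comap φ), unitClassMap ψ _ _ (scalarUnits_le_comap ψ),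
    fun z => ?_⟩, exists_isPermutationLattice_projClasses e hinj hf⟩
  obtain ⟨u, rfl⟩ := UnitClass.mk_surjective _ z
  refine congrArg (fun u : (F ⊗[k] C)ˣ => UnitClass.mk _ (.ofMul u)) (Units.ext ?_)
  change ((Algebra.TensorProduct.map (AlgHom.id F F) ψ).comp
    (Algebra.TensorProduct.map (AlgHom.id F F) φ)) (u.toMul : F ⊗[k] C) = u.toMul
  rw [← Algebra.TensorProduct.map_comp, h]
  simp

/-- If a principal open subset of `T × 𝔸ᵐ` is isomorphic to a principal open subset of affine space,
then the character lattice has a resolution by permutation lattices. -/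
theorem hasPermutationResolution_of_algEquiv [Normal k F] (φ : C ≃ₐ[k] D) :
    HasPermutationResolution (characterRep k F A) := by
  have := isDomain_tensor_of_split e
  have : IsDomain A := (Algebra.TensorProduct.includeRight_injective (R := k) (A := F) (B := A)
    (FaithfulSMul.algebraMap_injective k F)).isDomain
      (Algebra.TensorProduct.includeRight : A →ₐ[k] F ⊗[k] A)
  -- Through `φ`, the ring `C` is a localization of `k[x₁,…,xₙ]` as well, so its units modulo
  -- scalars can be computed on affine space.
  let _ : Algebra (MvPolynomial (Fin n) k) C :=
    ((φ.symm : D →+* C).comp (algebraMap (MvPolynomial (Fin n) k) D)).toAlgebra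
  have : IsScalarTower k (MvPolynomial (Fin n) k) C := .of_algebraMap_eq fun c => by
    change algebraMap k C c = φ.symm (algebraMap _ D (algebraMap k _ c))
    rw [← IsScalarTower.algebraMap_apply, AlgEquiv.commutes]
  have : IsLocalization.Away g C := IsLocalization.isLocalization_of_algEquiv _
    ({ φ.symm with commutes' := fun _ => rfl } : D ≃ₐ[MvPolynomial (Fin n) k] C)
  have hinj : Function.Injective (algebraMap (MvPolynomial (Fin m) A) C) :=
    IsLocalization.injective C (powers_le_nonZeroDivisors_of_noZeroDivisors hf)
  exact ⟨_, _, _, _, _, _, ⟨characterResolution e hinj⟩,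
    isPermutationLattice_scalarClasses (D := C) hg,
    exists_isPermutationLattice_projClasses e hinj hf⟩

end

end CharacterResolution

end

noncomputable section

/-! ### Common open subsets of birational affine schemes -/

section Birational

variable {k K A A₁ A₂ : Type*} [Field k] [Field K] [Algebra k K] [CommRing A] [Algebra k A]
  [CommRing A₁] [Algebra k A₁] [CommRing A₂] [Algebra k A₂]

/-- The subalgebra `A[1/f]` of a field containing `A`. -/
def awaySubalgebra (i : A →ₐ[k] K) (f : A) : Subalgebra k K where
  carrier := {x | ∃ (n : ℕ) (a : A), x * i f ^ n = i a}
  mul_mem' := by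
    rintro x y ⟨n, a, h⟩ ⟨m, b, h'⟩
    exact ⟨n + m, a * b, by rw [map_mul, ← h, ← h']; ring⟩
  add_mem' := by
    rintro x y ⟨n, a, h⟩ ⟨m, b, h'⟩
    exact ⟨n + m, a * f ^ m + b * f ^ n, by
      rw [map_add, map_mul, map_mul, map_pow, map_pow, ← h, ← h']; ring⟩
  algebraMap_mem' c := ⟨0, algebraMap k A c, by simp⟩

theorem map_mem_awaySubalgebra (i : A →ₐ[k] K) (f a : A) : i a ∈ awaySubalgebra i f :=
  ⟨0, a, by simp⟩

theorem inv_mem_awaySubalgebra {i : A →ₐ[k] K} {f : A} (hf : i f ≠ 0) :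
    (i f)⁻¹ ∈ awaySubalgebra i f :=
  ⟨1, 1, by simp [hf]⟩

theorem awaySubalgebra_le {i : A →ₐ[k] K} {f : A} (hf : i f ≠ 0) {T : Subalgebra k K}
    (h : ∀ a, i a ∈ T) (h' : (i f)⁻¹ ∈ T) : awaySubalgebra i f ≤ T := by
  rintro x ⟨n, a, hx⟩
  rw [(eq_mul_inv_iff_mul_eq₀ (pow_ne_zero n hf)).2 hx, ← inv_pow]
  exact mul_mem (h a) (pow_mem h' n)

theorem exists_algEquiv_awaySubalgebra {i : A →ₐ[k] K} (hi : Function.Injective i) {f : A}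
    (hf : f ≠ 0) : ∃ e : Localization.Away f ≃ₐ[k] awaySubalgebra i f,
      ∀ a, (e (algebraMap A _ a) : K) = i a := by
  have hf' : i f ≠ 0 := (map_ne_zero_iff i hi).2 hf
  have hu : ∀ y : Submonoid.powers f, IsUnit (i y) := by
    rintro ⟨_, n, rfl⟩
    simpa using IsUnit.pow n hf'.isUnit
  let j : Localization.Away f →ₐ[k] K := IsLocalization.liftAlgHom (M := Submonoid.powers f) hu
  have hj : ∀ a, j (algebraMap A _ a) = i a := fun a => IsLocalization.lift_eq _ a
  have hjs : ∀ n : ℕ, i f ^ n ≠ 0 := fun n => pow_ne_zero n hf'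
  have hmk : ∀ x : Localization.Away f, ∃ (n : ℕ) (a : A), x * algebraMap A _ f ^ n =
      algebraMap A _ a := fun x => by
    obtain ⟨⟨a, ⟨_, n, rfl⟩⟩, h⟩ := IsLocalization.surj (Submonoid.powers f) x
    exact ⟨n, a, by simpa using h⟩
  have hinj : Function.Injective j := by
    refine (injective_iff_map_eq_zero j).2 fun x hx => ?_
    obtain ⟨n, a, h⟩ := hmk x
    have h1 := congrArg j h
    rw [map_mul, hx, zero_mul, hj, eq_comm, map_eq_zero_iff i hi] at h1
    rw [h1, map_zero] at h
    have hfu : IsUnit (algebraMap A (Localization.Away f) f ^ n) :=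
      (IsLocalization.Away.algebraMap_isUnit f).pow n
    exact (hfu.mul_left_eq_zero).1 h
  have hrange : j.range = awaySubalgebra i f := by
    refine le_antisymm ?_ (awaySubalgebra_le hf' (fun a => ⟨algebraMap A _ a, hj a⟩)
      ⟨IsLocalization.Away.invSelf f, ?_⟩)
    · rintro _ ⟨x, rfl⟩
      obtain ⟨n, a, h⟩ := hmk x
      exact ⟨n, a, by
        have := congrArg j h
        rwa [map_mul, map_pow, hj, hj] at this⟩
    · change j _ = _
      refine eq_inv_of_mul_eq_one_left ?_
      rw [← hj, ← map_mul, mul_comm, IsLocalization.Away.mul_invSelf,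
        map_one]
  exact ⟨(AlgEquiv.ofInjective j hinj).trans (Subalgebra.equivOfEq _ _ hrange), hj⟩

theorem exists_subset_awaySubalgebra [IsDomain A] {i : A →ₐ[k] K}
    (hfrac : ∀ z : K, ∃ a b : A, i b ≠ 0 ∧ z * i b = i a) (S : Finset K) :
    ∃ s : A, i s ≠ 0 ∧ ∀ x ∈ S, x ∈ awaySubalgebra i s := by
  classical
  induction S using Finset.induction with
  | empty => exact ⟨1, by simp, by simp⟩
  | insert x S hx ih =>
    obtain ⟨s, hs, hS⟩ := ih
    obtain ⟨a, b, hb, hab⟩ := hfrac x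
    refine ⟨s * b, by rw [map_mul]; exact mul_ne_zero hs hb, fun y hy => ?_⟩
    rcases Finset.mem_insert.1 hy with rfl | hy
    · exact ⟨1, a * s, by rw [map_mul, map_mul, ← hab]; ring⟩
    · obtain ⟨n, c, h⟩ := hS y hy
      exact ⟨n, c * b ^ n, by rw [map_mul, map_mul, map_pow, ← h]; ring⟩

theorem exists_map_mem_awaySubalgebra [IsDomain A₁] [Algebra.FiniteType k A₂] {i₁ : A₁ →ₐ[k] K}
    (hfrac : ∀ z : K, ∃ a b : A₁, i₁ b ≠ 0 ∧ z * i₁ b = i₁ a) (i₂ : A₂ →ₐ[k] K) :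
    ∃ s : A₁, i₁ s ≠ 0 ∧ ∀ x, i₂ x ∈ awaySubalgebra i₁ s := by
  classical
  obtain ⟨S, hS⟩ := Algebra.FiniteType.out (R := k) (A := A₂)
  obtain ⟨s, hs, h⟩ := exists_subset_awaySubalgebra hfrac (S.image i₂)
  refine ⟨s, hs, fun x => ?_⟩
  have h1 : (Algebra.adjoin k (S : Set A₂)).map i₂ ≤ awaySubalgebra i₁ s := by
    rw [AlgHom.map_adjoin, Algebra.adjoin_le_iff]
    rintro _ ⟨y, hy, rfl⟩
    exact h _ (Finset.mem_image_of_mem _ hy)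
  exact h1 ⟨x, by simp [hS], rfl⟩

/-- In `K`, `t'` is `t * s ^ n` and `s'` is `s * t ^ m`. Inverting `s * t'` therefore inverts both
`s` and `t`; the former already brings in all of `A₂`. Applied in both directions, this gives
equality of the two localizations. -/
theorem awaySubalgebra_mul_le {i₁ : A₁ →ₐ[k] K} {i₂ : A₂ →ₐ[k] K} {s t' : A₁} {s' t : A₂}
    {n m : ℕ} (hs : i₁ s ≠ 0) (ht : i₂ t ≠ 0) (hs' : ∀ x, i₂ x ∈ awaySubalgebra i₁ s)
    (hn : i₂ t * i₁ s ^ n = i₁ t') (hm : i₁ s * i₂ t ^ m = i₂ s') :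
    awaySubalgebra i₂ (t * s') ≤ awaySubalgebra i₁ (s * t') := by
  have hsT : (i₁ s)⁻¹ ∈ awaySubalgebra i₁ (s * t') :=
    ⟨1, t', by rw [map_mul]; field_simp⟩
  have htT : (i₂ t)⁻¹ ∈ awaySubalgebra i₁ (s * t') :=
    ⟨1, s ^ (n + 1), by rw [map_mul, ← hn, map_pow]; field_simp; ring⟩
  have hle : ∀ x, i₂ x ∈ awaySubalgebra i₁ (s * t') := fun x =>
    awaySubalgebra_le hs (map_mem_awaySubalgebra _ _) hsT (hs' x)
  refine awaySubalgebra_le ?_ hle ?_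
  · rw [map_mul, ← hm]; exact mul_ne_zero ht (mul_ne_zero hs (pow_ne_zero _ ht))
  · rw [map_mul, ← hm, mul_inv, mul_inv, ← inv_pow]
    exact mul_mem htT (mul_mem hsT (pow_mem htT m))

/-- Two affine integral `k`-schemes of finite type with the same function field have isomorphic
non-empty principal open subsets. -/
theorem exists_localizationAway_algEquiv [IsDomain A₁] [IsDomain A₂] [Algebra.FiniteType k A₁]
    [Algebra.FiniteType k A₂] {i₁ : A₁ →ₐ[k] K} {i₂ : A₂ →ₐ[k] K}
    (h₁ : Function.Injective i₁) (h₂ : Function.Injective i₂)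
    (hfrac₁ : ∀ z : K, ∃ a b : A₁, i₁ b ≠ 0 ∧ z * i₁ b = i₁ a)
    (hfrac₂ : ∀ z : K, ∃ a b : A₂, i₂ b ≠ 0 ∧ z * i₂ b = i₂ a) :
    ∃ (f : A₁) (g : A₂), f ≠ 0 ∧ g ≠ 0 ∧
      Nonempty (Localization.Away f ≃ₐ[k] Localization.Away g) := by
  obtain ⟨s, hs, hs'⟩ := exists_map_mem_awaySubalgebra hfrac₁ i₂
  obtain ⟨t, ht, ht'⟩ := exists_map_mem_awaySubalgebra hfrac₂ i₁
  obtain ⟨n, t', hn⟩ := hs' t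
  obtain ⟨m, s', hm⟩ := ht' s
  have heq : awaySubalgebra i₁ (s * t') = awaySubalgebra i₂ (t * s') :=
    le_antisymm (awaySubalgebra_mul_le ht hs ht' hm hn)
      (awaySubalgebra_mul_le hs ht hs' hn hm)
  have hf : s * t' ≠ 0 := fun h => by
    have := congrArg i₁ h
    rw [map_mul, ← hn, map_zero] at this
    exact mul_ne_zero hs (mul_ne_zero ht (pow_ne_zero _ hs)) this
  have hg : t * s' ≠ 0 := fun h => by
    have := congrArg i₂ h
    rw [map_mul, ← hm, map_zero] at this
    exact mul_ne_zero ht (mul_ne_zero hs (pow_ne_zero _ ht)) this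
  obtain ⟨e₁, -⟩ := exists_algEquiv_awaySubalgebra h₁ hf
  obtain ⟨e₂, -⟩ := exists_algEquiv_awaySubalgebra h₂ hg
  exact ⟨_, _, hf, hg, ⟨e₁.trans ((Subalgebra.equivOfEq _ _ heq).trans e₂.symm)⟩⟩

/-- Every rational function over the fraction field of `B` is a quotient of polynomials over `B`. -/
theorem exists_mvPolynomial_fraction {σ B : Type*} [CommRing B] [IsDomain B] [Algebra k B] :
    ∃ i : MvPolynomial σ B →ₐ[k] FractionRing (MvPolynomial σ (FractionRing B)),
      Function.Injective i ∧ ∀ z, ∃ a b, i b ≠ 0 ∧ z * i b = i a := by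
  let c : MvPolynomial σ B →ₐ[k] MvPolynomial σ (FractionRing B) :=
    MvPolynomial.mapAlgHom (IsScalarTower.toAlgHom k B (FractionRing B))
  have hc : Function.Injective c :=
    MvPolynomial.map_injective _ (IsFractionRing.injective B (FractionRing B))
  let d : MvPolynomial σ (FractionRing B) →ₐ[k] FractionRing (MvPolynomial σ (FractionRing B)) :=
    IsScalarTower.toAlgHom k _ _
  have hd : Function.Injective d := IsFractionRing.injective _ _
  have hnum : ∀ p : MvPolynomial σ (FractionRing B), ∃ (b : B) (a : MvPolynomial σ B), b ≠ 0 ∧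
      p * c (MvPolynomial.C b) = c a := by
    intro p
    induction p using MvPolynomial.induction_on with
    | C x =>
      obtain ⟨a, b, hb, rfl⟩ := IsFractionRing.div_surjective (A := B) x
      have hb0 := nonZeroDivisors.ne_zero hb
      refine ⟨b, MvPolynomial.C a, hb0, ?_⟩
      have : algebraMap B (FractionRing B) b ≠ 0 :=
        (map_ne_zero_iff _ (IsFractionRing.injective B (FractionRing B))).2 hb0
      have hcC : ∀ x : B, c (MvPolynomial.C x) = MvPolynomial.C (algebraMap B _ x) :=
        fun x => MvPolynomial.map_C _ _
      rw [hcC, hcC, ← MvPolynomial.C_mul]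
      congr 1
      exact div_mul_cancel₀ _ this
    | add p q hp hq =>
      obtain ⟨b, a, hb, h⟩ := hp
      obtain ⟨b', a', hb', h'⟩ := hq
      refine ⟨b * b', a * MvPolynomial.C b' + a' * MvPolynomial.C b, mul_ne_zero hb hb', ?_⟩
      rw [MvPolynomial.C_mul, map_add, map_mul, map_mul, map_mul, ← h, ← h']
      ring
    | mul_X p x hp =>
      obtain ⟨b, a, hb, h⟩ := hp
      refine ⟨b, a * MvPolynomial.X x, hb, ?_⟩
      rw [map_mul, ← h]
      have : c (MvPolynomial.X x) = MvPolynomial.X x := MvPolynomial.map_X _ _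
      rw [this]
      ring
  refine ⟨d.comp c, hd.comp hc, fun z => ?_⟩
  obtain ⟨p, q, hq, rfl⟩ := IsFractionRing.div_surjective (A := MvPolynomial σ (FractionRing B)) z
  obtain ⟨b, a, hb, h⟩ := hnum p
  obtain ⟨b', a', hb', h'⟩ := hnum q
  have hdc : ∀ x, x ≠ 0 → d (c x) ≠ 0 := fun x hx =>
    (map_ne_zero_iff d hd).2 ((map_ne_zero_iff c hc).2 hx)
  have hC : ∀ b : B, b ≠ 0 → d (c (MvPolynomial.C b)) ≠ 0 := fun b hb => hdc _ (by simpa using hb)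
  have hq0 : d q ≠ 0 := (map_ne_zero_iff d hd).2 (nonZeroDivisors.ne_zero hq)
  have ha' : d (c a') ≠ 0 := by
    rw [← h', map_mul]
    exact mul_ne_zero hq0 (hC _ hb')
  refine ⟨a * MvPolynomial.C b', a' * MvPolynomial.C b, ?_, ?_⟩
  · change d (c (a' * MvPolynomial.C b)) ≠ 0
    rw [map_mul, map_mul]
    exact mul_ne_zero ha' (hC _ hb)
  · change d p / d q * d (c (a' * MvPolynomial.C b)) = d (c (a * MvPolynomial.C b'))
    rw [map_mul, map_mul, map_mul, map_mul, ← h, ← h', map_mul, map_mul]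
    field_simp

end Birational

end

noncomputable section

/-! ### Rationality gives resolutions -/

section RationalToResolution

variable {k : Type u} [Field k]

/-- Finite type descends along the faithfully flat extension `k → F`. -/
theorem finiteType_of_splitsOver {F A : Type*} [Field F] [Algebra k F] [CommRing A]
    [HopfAlgebra k A] (h : SplitsOver k F A) : Algebra.FiniteType k A := by
  obtain ⟨n, ⟨e⟩⟩ := h
  have : Algebra.FiniteType F (F ⊗[k] A) := Algebra.FiniteType.equiv inferInstance
    (e.symm : MonoidAlgebra F (Multiplicative (Fin n → ℤ)) ≃ₐ[F] F ⊗[k] A)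
  exact Algebra.FiniteType.of_finiteType_tensorProduct_of_faithfullyFlat F

theorem IsStablyRational.hasPermutationResolution {T : AlgebraicTorus k}
    (h : IsStablyRational k T.functionField) : HasPermutationResolution T.characterLattice := by
  obtain ⟨n, m, r, ⟨E⟩⟩ := h
  have := finiteType_of_splitsOver T.splits
  obtain ⟨i, hi, hfi⟩ := exists_mvPolynomial_fraction (k := k) (σ := Fin m) (B := T.coordRing)
  obtain ⟨j, hj, hfj⟩ := exists_mvPolynomial_fraction (k := k) (σ := Fin r)
    (B := MvPolynomial (Fin n) k)
  let c : MvPolynomial (Fin (r + n)) k ≃ₐ[k] MvPolynomial (Fin r) (MvPolynomial (Fin n) k) :=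
    (MvPolynomial.renameEquiv k finSumFinEquiv.symm).trans (MvPolynomial.sumAlgEquiv k _ _)
  obtain ⟨f, g, hf, hg, ⟨Φ⟩⟩ := exists_localizationAway_algEquiv
    (i₁ := E.toAlgHom.comp i) (i₂ := j.comp c.toAlgHom)
    (E.injective.comp hi) (hj.comp c.injective)
    (fun z => by
      obtain ⟨a, b, hb, hab⟩ := hfi (E.symm z)
      refine ⟨a, b, (map_ne_zero_iff _ E.injective).2 hb, ?_⟩
      have := congrArg E hab
      rwa [map_mul, E.apply_symm_apply] at this)
    (fun z => by
      obtain ⟨a, b, hb, hab⟩ := hfj z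
      refine ⟨c.symm a, c.symm b, ?_, ?_⟩
      · change j (c (c.symm b)) ≠ 0
        rwa [c.apply_symm_apply]
      · change z * j (c (c.symm b)) = j (c (c.symm a))
        rwa [c.apply_symm_apply, c.apply_symm_apply])
  obtain ⟨d, ⟨e⟩⟩ := T.splits
  exact hasPermutationResolution_of_algEquiv e hf hg Φ

/-- `R` and `k[T]` share a principal open subset, given by some `h` in `R`. With `φ h = p / f₀ ^ r`,
inverting `p` makes `φ h` invertible, while `ψ p = h * ψ (f₀ ^ r)` is invertible once `h` is. So the
retraction restricts to `R[1/h]` and `k[x₁,…,xₙ][1/(f₀ p)]`. -/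
theorem IsRetractRational.hasRetractResolution {T : AlgebraicTorus k}
    (h : IsRetractRational k T.functionField) : HasRetractResolution T.characterLattice := by
  obtain ⟨R, hR, n, f₀, φ, ψ, hφψ⟩ := h
  have hφψ' : ∀ x, ψ (φ x) = x := fun x => DFunLike.congr_fun hφψ x
  have := finiteType_of_splitsOver T.splits
  have : Algebra.FiniteType k R :=
    Algebra.FiniteType.of_surjective ψ fun x => ⟨φ x, hφψ' x⟩
  let c : MvPolynomial (Fin 0) T.coordRing ≃ₐ[k] T.coordRing :=
    (MvPolynomial.isEmptyAlgEquiv T.coordRing (Fin 0)).restrictScalars k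
  let i : T.coordRing →ₐ[k] T.functionField := IsScalarTower.toAlgHom k _ _
  have hi : Function.Injective i := IsFractionRing.injective _ _
  obtain ⟨f, h, hf, hh, ⟨Φ⟩⟩ := exists_localizationAway_algEquiv
    (i₁ := i.comp c.toAlgHom) (i₂ := R.val) (hi.comp c.injective)
    Subtype.val_injective
    (fun z => by
      obtain ⟨a, b, hb, rfl⟩ := IsFractionRing.div_surjective (A := T.coordRing) z
      have hb' : i b ≠ 0 := (map_ne_zero_iff _ hi).2 (nonZeroDivisors.ne_zero hb)
      refine ⟨c.symm a, c.symm b, ?_, ?_⟩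
      · change i (c (c.symm b)) ≠ 0
        rwa [c.apply_symm_apply]
      · change _ * i (c (c.symm b)) = i (c (c.symm a))
        rw [c.apply_symm_apply, c.apply_symm_apply]
        exact div_mul_cancel₀ (i a) hb')
    (fun z => by
      obtain ⟨a, b, hb, rfl⟩ := IsFractionRing.div_surjective (A := R) z
      have hb' : R.val b ≠ 0 :=
        (map_ne_zero_iff _ Subtype.val_injective).2 (nonZeroDivisors.ne_zero hb)
      exact ⟨a, b, hb', div_mul_cancel₀ (R.val a) hb'⟩)
  have hf₀ : f₀ ≠ 0 := by
    rintro rfl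
    have h0 : (1 : Localization.Away (0 : MvPolynomial (Fin n) k)) = 0 := by
      have := (IsLocalization.Away.algebraMap_isUnit
        (S := Localization.Away (0 : MvPolynomial (Fin n) k)) (0 : MvPolynomial (Fin n) k))
      rw [map_zero, isUnit_zero_iff] at this
      exact this.symm
    exact one_ne_zero ((map_one ψ).symm.trans ((congrArg ψ h0).trans (map_zero ψ)))
  obtain ⟨⟨p, ⟨_, r, rfl⟩⟩, hp⟩ := IsLocalization.surj (Submonoid.powers f₀) (φ h)
  have hφ : Function.Injective φ := fun x y hxy => by rw [← hφψ' x, hxy, hφψ']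
  have hu : IsUnit (algebraMap (MvPolynomial (Fin n) k) (Localization.Away f₀) (f₀ ^ r)) := by
    rw [map_pow]; exact (IsLocalization.Away.algebraMap_isUnit f₀).pow r
  have hp0 : p ≠ 0 := by
    rintro rfl
    simp only [map_zero] at hp
    exact hh ((map_eq_zero_iff φ hφ).1 (hu.mul_left_eq_zero.1 hp))
  let L := Localization.Away f₀
  let D := Localization.Away (algebraMap (MvPolynomial (Fin n) k) L p)
  have : IsLocalization.Away (f₀ * p) D := IsLocalization.Away.mul' L D f₀ p
  have hφh : IsUnit (algebraMap L D (φ h)) := by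
    have h1 : IsUnit (algebraMap L D (algebraMap _ L p)) :=
      IsLocalization.Away.algebraMap_isUnit _
    have h2 := congrArg (algebraMap L D) hp
    rw [map_mul] at h2
    exact isUnit_of_mul_isUnit_left (h2 ▸ h1)
  let φ' : Localization.Away h →ₐ[k] D := IsLocalization.liftAlgHom (M := Submonoid.powers h)
    (f := (IsScalarTower.toAlgHom k L D).comp φ) (by
      rintro ⟨_, n, rfl⟩
      simpa using hφh.pow n)
  have hψp : IsUnit (algebraMap R (Localization.Away h) (ψ (algebraMap _ L p))) := by
    have h2 := congrArg (fun x => algebraMap R (Localization.Away h) (ψ x)) hp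
    simp only [map_mul ψ, hφψ', map_mul (algebraMap R (Localization.Away h))] at h2
    refine h2 ▸ (IsLocalization.Away.algebraMap_isUnit h).mul ((hu.map ψ).map _)
  let ψ' : D →ₐ[k] Localization.Away h :=
    IsLocalization.liftAlgHom (M := Submonoid.powers (algebraMap (MvPolynomial (Fin n) k) L p))
    (f := (IsScalarTower.toAlgHom k R (Localization.Away h)).comp ψ) (by
      rintro ⟨_, n, rfl⟩
      simpa using hψp.pow n)
  have hcomp : ψ'.comp φ' = AlgHom.id k _ := by
    have h1 : ∀ x, φ' (algebraMap R _ x) = algebraMap L D (φ x) :=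
      fun x => IsLocalization.lift_eq _ x
    have h2 : ∀ x, ψ' (algebraMap L _ x) = algebraMap R _ (ψ x) :=
      fun x => IsLocalization.lift_eq _ x
    refine IsLocalization.algHom_ext (Submonoid.powers h) ?_
    refine AlgHom.ext fun x => ?_
    change ψ' (φ' (algebraMap R _ x)) = algebraMap R _ x
    rw [h1, h2, hφψ']
  obtain ⟨d, ⟨e⟩⟩ := T.splits
  refine hasRetractResolution_of_retract (C := Localization.Away f) (D := D) e hf
    (mul_ne_zero hf₀ hp0) (φ'.comp (Φ : _ →ₐ[k] _)) ((Φ.symm : _ →ₐ[k] _).comp ψ') ?_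
  refine AlgHom.ext fun x => ?_
  change Φ.symm (ψ' (φ' (Φ x))) = x
  exact (congrArg Φ.symm (DFunLike.congr_fun hcomp (Φ x))).trans (Φ.symm_apply_apply x)

end RationalToResolution

end

noncomputable section

/-! ### Constant field extensions and descent of homomorphisms -/

section TensorField

variable {k F K A B C : Type*} [Field k] [Field F] [Algebra k F] [Field K] [Algebra k K]
  [CommRing A] [Algebra k A] [CommRing B] [Algebra k B] [CommRing C] [Algebra k C]

variable (F) in
/-- The `F`-algebra homomorphism `F ⊗ f`. -/
abbrev extendScalars (f : A →ₐ[k] B) : F ⊗[k] A →ₐ[F] F ⊗[k] B :=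
  Algebra.TensorProduct.map (AlgHom.id F F) f

theorem extendScalars_comp_apply (g : B →ₐ[k] C) (f : A →ₐ[k] B) (x : F ⊗[k] A) :
    extendScalars F (g.comp f) x = extendScalars F g (extendScalars F f x) := by
  induction x with
  | zero => simp
  | tmul c x => simp
  | add x y hx hy => simp only [map_add, hx, hy]

variable (F) in
theorem one_tmul_injective : Function.Injective fun c : C => (1 : F) ⊗ₜ[k] c :=
  Algebra.TensorProduct.includeRight_injective (R := k) (A := F) (B := C)
    (FaithfulSMul.algebraMap_injective k F)

theorem exists_mul_tmul_eq_map [IsDomain A] {i : A →ₐ[k] K}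
    (hfrac : ∀ z : K, ∃ a b : A, i b ≠ 0 ∧ z * i b = i a) (x : F ⊗[k] K) :
    ∃ (b : A) (y : F ⊗[k] A), i b ≠ 0 ∧ x * (1 ⊗ₜ i b) = extendScalars F i y := by
  induction x with
  | zero => exact ⟨1, 0, by simp, by simp⟩
  | tmul c z =>
    obtain ⟨a, b, hb, h⟩ := hfrac z
    exact ⟨b, c ⊗ₜ a, hb, by simp [h]⟩
  | add x x' hx hx' =>
    obtain ⟨b, y, hb, h⟩ := hx
    obtain ⟨b', y', hb', h'⟩ := hx'
    refine ⟨b * b', y * (1 ⊗ₜ b') + y' * (1 ⊗ₜ b), by rw [map_mul]; exact mul_ne_zero hb hb', ?_⟩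
    have h1 : (1 : F) ⊗ₜ[k] i (b * b') = (1 ⊗ₜ i b) * (1 ⊗ₜ i b') := by simp
    rw [h1, map_add, map_mul, map_mul, ← h, ← h', Algebra.TensorProduct.map_tmul,
      Algebra.TensorProduct.map_tmul]
    simp only [AlgHom.coe_id, id_eq]
    ring

theorem isDomain_tensor_fraction [IsDomain (F ⊗[k] A)] [IsDomain A] {i : A →ₐ[k] K}
    (hi : Function.Injective i) (hfrac : ∀ z : K, ∃ a b : A, i b ≠ 0 ∧ z * i b = i a) :
    IsDomain (F ⊗[k] K) := by
  have hinj : Function.Injective (extendScalars F i) := map_id_injective_of_injective hi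
  have : Nontrivial (F ⊗[k] K) := hinj.nontrivial
  have hu : ∀ b : A, i b ≠ 0 → IsUnit ((1 : F) ⊗ₜ[k] i b) := fun b hb =>
    hb.isUnit.map (Algebra.TensorProduct.includeRight : K →ₐ[k] F ⊗[k] K)
  have : NoZeroDivisors (F ⊗[k] K) := by
    refine ⟨fun {x x'} hxx => ?_⟩
    obtain ⟨b, y, hb, h⟩ := exists_mul_tmul_eq_map hfrac x
    obtain ⟨b', y', hb', h'⟩ := exists_mul_tmul_eq_map hfrac x'
    have h1 : extendScalars F i (y * y') = 0 := by
      rw [map_mul, ← h, ← h', mul_mul_mul_comm, hxx, zero_mul]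
    rcases mul_eq_zero.1 ((map_eq_zero_iff _ hinj).1 h1) with h2 | h2
    · left
      rw [h2, map_zero] at h
      exact (hu b hb).mul_left_eq_zero.1 h
    · right
      rw [h2, map_zero] at h'
      exact (hu b' hb').mul_left_eq_zero.1 h'
  exact NoZeroDivisors.to_isDomain _

/-- A domain integral over the field `K` is a field. -/
theorem isField_tensor [Algebra.IsAlgebraic k F] [IsDomain (F ⊗[k] K)] : IsField (F ⊗[k] K) := by
  let c : K ⊗[k] F ≃ₐ[k] F ⊗[k] K := Algebra.TensorProduct.comm k K F
  have : IsDomain (K ⊗[k] F) := c.injective.isDomain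
  have : Algebra.IsIntegral k F := Algebra.IsAlgebraic.isIntegral
  exact MulEquiv.isField (isField_of_isIntegral_of_isField' (R := K) (S := K ⊗[k] F)
    (Field.toIsField K)) c.symm.toMulEquiv

/-- Descent of algebra homomorphisms. -/
theorem exists_algHom_of_galTensor_comm [IsGalois k F] (Φ : F ⊗[k] A →ₐ[F] F ⊗[k] B)
    (hΦ : ∀ σ x, Φ (galTensor k F A σ x) = galTensor k F B σ (Φ x)) :
    ∃ φ : A →ₐ[k] B, extendScalars F φ = Φ := by
  choose φ hφ using fun a : A => exists_tmul_of_galTensor_fixed (Φ (1 ⊗ₜ a)) fun σ => by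
    rw [← hΦ, galTensor_tmul, map_one]
  have hinj := one_tmul_injective (k := k) F (C := B)
  let φ' : A →ₐ[k] B :=
    { toFun := φ
      map_one' := hinj ((hφ 1).symm.trans (map_one Φ))
      map_mul' := fun a b => hinj (by
        change _ = (1 : F) ⊗ₜ[k] (φ a * φ b)
        have h : ∀ x y : A, (1 : F) ⊗ₜ[k] (x * y) = (1 ⊗ₜ x) * (1 ⊗ₜ y) := fun x y => by simp
        have h' : ∀ x y : B, (1 : F) ⊗ₜ[k] (x * y) = (1 ⊗ₜ x) * (1 ⊗ₜ y) := fun x y => by simp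
        rw [h', ← hφ, ← hφ, ← map_mul, ← h, hφ])
      map_zero' := hinj (by
        change (1 : F) ⊗ₜ[k] φ 0 = (1 : F) ⊗ₜ[k] (0 : B)
        rw [← hφ, TensorProduct.tmul_zero, TensorProduct.tmul_zero, map_zero])
      map_add' := fun a b => hinj (by
        change _ = (1 : F) ⊗ₜ[k] (φ a + φ b)
        rw [TensorProduct.tmul_add, ← hφ, ← hφ, ← map_add, ← TensorProduct.tmul_add, hφ])
      commutes' := fun c => hinj (by
        change (1 : F) ⊗ₜ[k] φ (algebraMap k A c) = (1 : F) ⊗ₜ[k] algebraMap k B c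
        rw [← hφ, Algebra.algebraMap_eq_smul_one, Algebra.algebraMap_eq_smul_one,
          ← TensorProduct.smul_tmul, ← TensorProduct.smul_tmul]
        change Φ (algebraMap F _ (c • 1)) = algebraMap F _ (c • 1)
        exact Φ.commutes _) }
  refine ⟨φ', AlgHom.ext fun x => ?_⟩
  induction x with
  | zero => simp
  | add x y hx hy => rw [map_add, map_add, hx, hy]
  | tmul c a =>
    have : c ⊗ₜ[k] a = c • ((1 : F) ⊗ₜ[k] a) := by simp [TensorProduct.smul_tmul']
    rw [this, map_smul, map_smul, hφ, Algebra.TensorProduct.map_tmul, map_one]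
    rfl

/-- Linear forms permuted by the Galois group have invariant coordinates. -/
theorem exists_invariant_coordinates [IsGalois k F] {d : ℕ} {a : Gal(F/k) →* Equiv.Perm (Fin d)}
    {D D' : Matrix (Fin d) (Fin d) F} (hDD' : D * D' = 1) (hD'D : D' * D = 1)
    (hD : ∀ (σ : Gal(F/k)) x i, σ (D x i) = D (a σ x) i) (z : Fin d → F ⊗[k] C)
    (hz : ∀ σ j, galTensor k F C σ (z j) = z (a σ j)) :
    ∃ w : Fin d → C, ∀ j, z j = ∑ i, D j i • ((1 : F) ⊗ₜ[k] w i) := by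
  have hinv : ∀ {D D' : Matrix (Fin d) (Fin d) F}, D * D' = 1 → ∀ z : Fin d → F ⊗[k] C,
      ∀ j, ∑ i, D j i • ∑ l, D' i l • z l = z j := by
    intro D D' h z j
    calc ∑ i, D j i • ∑ l, D' i l • z l = ∑ l, (D * D') j l • z l := by
          simp only [Finset.smul_sum, smul_smul, Matrix.mul_apply, Finset.sum_smul]
          exact Finset.sum_comm
      _ = z j := by simp [h, Matrix.one_apply, ite_smul]
  -- `v` is the solution of `D v = z`. Since `σ` permutes `z` and the rows of `D` alike, `σ v`
  -- solves the same system, so `v` is invariant.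
  let v : Fin d → F ⊗[k] C := fun i => ∑ l, D' i l • z l
  have hv : ∀ j, ∑ i, D j i • v i = z j := hinv hDD' z
  have hfix : ∀ σ i, galTensor k F C σ (v i) = v i := fun σ i => by
    have h1 : ∀ j, ∑ i, D j i • galTensor k F C σ (v i) = z j := fun j => by
      have h2 := congrArg (galTensor k F C σ) (hv ((a σ).symm j))
      rw [hz, Equiv.apply_symm_apply, map_sum] at h2
      simpa only [galTensor_smul, hD, Equiv.apply_symm_apply] using h2
    have h3 := hinv hD'D (fun i => galTensor k F C σ (v i)) i
    simp only [h1] at h3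
    exact h3.symm
  choose w hw using fun i => exists_tmul_of_galTensor_fixed (v i) fun σ => hfix σ i
  exact ⟨w, fun j => by simp only [← hw, hv]⟩

end TensorField

/-! ### Points of tori as equivariant maps on characters -/

section CharacterMaps

variable {k F A B C : Type*} [Field k] [Field F] [Algebra k F]
  [CommRing A] [HopfAlgebra k A] [CommRing B] [Algebra k B] [CommRing C] [Algebra k C]

variable (F) in
/-- The map on units induced by an algebra homomorphism. -/
def unitRepMap (f : B →ₐ[k] C) : (unitRep k F B).IntertwiningMap (unitRep k F C) where
  toLinearMap := (MonoidHom.toAdditive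
    (Units.map (extendScalars F f : F ⊗[k] B →* F ⊗[k] C))).toIntLinearMap
  isIntertwining' σ := LinearMap.ext fun _ =>
    congrArg Additive.ofMul (Units.ext (galTensor_map f σ _).symm)

theorem unitRepMap_apply (f : B →ₐ[k] C) (u : Additive (F ⊗[k] B)ˣ) :
    ((unitRepMap F f u).toMul : F ⊗[k] C) = extendScalars F f (u.toMul : F ⊗[k] B) := rfl

variable (k F A) in
/-- Characters as units of `F ⊗ A`. -/
def characterToUnit : (characterRep k F A).IntertwiningMap (unitRep k F A) where
  toLinearMap := (MonoidHom.toAdditive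
    (GroupLike.toUnits F : GroupLike F (F ⊗[k] A) →* (F ⊗[k] A)ˣ)).toIntLinearMap
  isIntertwining' _ := LinearMap.ext fun _ => congrArg Additive.ofMul (Units.ext rfl)

variable {n : ℕ}

theorem exists_algHom_groupLike {H H' : Type*} [CommRing H] [HopfAlgebra F H] [CommRing H']
    [Algebra F H'] (e : H ≃ₐc[F] MonoidAlgebra F (Multiplicative (Fin n → ℤ)))
    (g : GroupLike F H →* H') : ∃ Φ : H →ₐ[F] H', ∀ χ, Φ χ.val = g χ := by
  let f : Multiplicative (Fin n → ℤ) →* GroupLike F H :=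
    { toFun := fun g => ⟨e.symm (MonoidAlgebra.of F _ g),
        (MonoidAlgebra.isGroupLikeElem_of g).map e.symm⟩
      map_one' := GroupLike.val_injective
        ((congrArg e.symm (map_one (MonoidAlgebra.of F _))).trans (map_one e.symm))
      map_mul' := fun g h => GroupLike.val_injective (by simp [← map_mul]) }
  let e' : H →ₐ[F] MonoidAlgebra F (Multiplicative (Fin n → ℤ)) := e
  refine ⟨(MonoidAlgebra.lift F _ _ (g.comp f)).comp e', fun χ => ?_⟩
  obtain ⟨x, hx⟩ := MonoidAlgebra.isGroupLikeElem_iff_mem_range_of.1 (χ.2.map e)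
  have hχ : f x = χ := GroupLike.val_injective (by
    change e.symm (MonoidAlgebra.of F _ x) = χ.val
    rw [hx]; exact e.symm_apply_apply _)
  change MonoidAlgebra.lift F _ _ (g.comp f) (e χ.val) = _
  rw [← hx, MonoidAlgebra.lift_of, MonoidHom.comp_apply, hχ]

variable (e : (F ⊗[k] A) ≃ₐc[F] MonoidAlgebra F (Multiplicative (Fin n → ℤ)))

include e

theorem addHom_ext_groupLike {V : Type*} [AddCommGroup V] {f g : F ⊗[k] A →+ V}
    (h : ∀ (c : F) (χ : GroupLike F (F ⊗[k] A)), f (c • χ.val) = g (c • χ.val)) : f = g := by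
  refine AddMonoidHom.ext fun x => ?_
  have hx : x ∈ Submodule.span F (Set.range (GroupLike.val (R := F) (A := F ⊗[k] A))) := by
    rw [span_groupLike_eq_top e]; trivial
  induction hx using Submodule.closure_induction with
  | zero => rw [map_zero, map_zero]
  | add x y _ _ hx hy => rw [map_add, map_add, hx, hy]
  | smul_mem c x hx =>
    obtain ⟨χ, rfl⟩ := hx
    exact h c χ

/-- A torus represents the functor of equivariant homomorphisms from its character lattice to
units. -/
theorem exists_algHom_of_intertwiningMap [IsGalois k F]
    (g : (characterRep k F A).IntertwiningMap (unitRep k F B)) :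
    ∃ φ : A →ₐ[k] B, ∀ χ, unitRepMap F φ (characterToUnit k F A χ) = g χ := by
  obtain ⟨Φ, hΦ⟩ := exists_algHom_groupLike e ((Units.coeHom (F ⊗[k] B)).comp
    (AddMonoidHom.toMultiplicative (g.toLinearMap.toAddMonoidHom :
      Additive (GroupLike F (F ⊗[k] A)) →+ Additive (F ⊗[k] B)ˣ) :
      GroupLike F (F ⊗[k] A) →* (F ⊗[k] B)ˣ))
  -- Characters span `F ⊗ A`, so equivariance of `g` is enough for `Φ` to commute with the
  -- semilinear actions.
  have hcomm : ∀ σ x, Φ (galTensor k F A σ x) = galTensor k F B σ (Φ x) := fun σ x => by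
    refine DFunLike.congr_fun (addHom_ext_groupLike e (f := (Φ : F ⊗[k] A →+ F ⊗[k] B).comp
      (galTensor k F A σ : F ⊗[k] A →+ F ⊗[k] A)) (g := (galTensor k F B σ : _ →+ _).comp
      (Φ : F ⊗[k] A →+ F ⊗[k] B)) fun c χ => ?_) x
    change Φ (galTensor k F A σ (c • χ.val)) = galTensor k F B σ (Φ (c • χ.val))
    rw [galTensor_smul, map_smul, map_smul, galTensor_smul, hΦ]
    congr 1
    refine (hΦ (galCharacter k A σ χ)).trans ?_
    exact congrArg (fun u : Additive (F ⊗[k] B)ˣ => (u.toMul : F ⊗[k] B))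
      (Representation.IntertwiningMap.isIntertwining _ _ g σ (Additive.ofMul χ))
  obtain ⟨φ, hφ⟩ := exists_algHom_of_galTensor_comm Φ hcomm
  refine ⟨φ, fun χ => Additive.toMul.injective (Units.ext ?_)⟩
  rw [unitRepMap_apply, hφ]
  exact hΦ χ.toMul

theorem algHom_ext_character {φ ψ : A →ₐ[k] B}
    (h : ∀ χ, unitRepMap F φ (characterToUnit k F A χ) =
      unitRepMap F ψ (characterToUnit k F A χ)) : φ = ψ := by
  refine AlgHom.ext fun x => one_tmul_injective (k := k) F ?_
  have := DFunLike.congr_fun (addHom_ext_groupLike e (f := (extendScalars F φ : _ →+ F ⊗[k] B))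
    (g := (extendScalars F ψ : _ →+ F ⊗[k] B)) fun c χ => ?_) ((1 : F) ⊗ₜ x)
  · simpa using this
  · change extendScalars F φ (c • χ.val) = extendScalars F ψ (c • χ.val)
    rw [map_smul, map_smul]
    exact congrArg (fun u : Additive (F ⊗[k] B)ˣ => c • (u.toMul : F ⊗[k] B))
      (h (Additive.ofMul χ))

end CharacterMaps

end

noncomputable section

/-! ### Maps out of permutation lattices -/

section PermutedBasis

variable {G P N X : Type*} [Group G] [AddCommGroup P] [AddCommGroup N]
  {ρP : Representation ℤ G P} {ρN : Representation ℤ G N} {b : Module.Basis X ℤ P}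
  {a : G →* Equiv.Perm X}

theorem IsPermutedBasis.exists_intertwiningMap (hb : IsPermutedBasis ρP b a) (v : X → N)
    (hv : ∀ g x, ρN g (v x) = v (a g x)) :
    ∃ f : ρP.IntertwiningMap ρN, ∀ x, f (b x) = v x :=
  ⟨{ toLinearMap := b.constr ℤ v
     isIntertwining' := fun g => b.ext fun x => by
      simp only [LinearMap.comp_apply, hb g x, Module.Basis.constr_basis, hv] },
    fun x => b.constr_basis ℤ v x⟩

theorem intertwiningMap_ext_basis (b : Module.Basis X ℤ P) {f g : ρP.IntertwiningMap ρN}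
    (h : ∀ x, f (b x) = g (b x)) (m : P) : f m = g m :=
  LinearMap.congr_fun (b.ext h : f.toLinearMap = g.toLinearMap) m

end PermutedBasis

/-! ### Retracts of open subsets of affine space -/

section Retract

/-- It is enough to factor the generic point. By finite generation `ψ` lands in `A[1/s]` for some
`s`; inverting the numerator `p` of `φ s` then extends both maps to a retraction onto `A[1/s]`. -/
theorem isRetractRational_of_factorization {k K A : Type*} [Field k] [Field K] [Algebra k K]
    [CommRing A] [IsDomain A] [Algebra k A] {i : A →ₐ[k] K} (hi : Function.Injective i)
    (hfrac : ∀ z : K, ∃ a b : A, i b ≠ 0 ∧ z * i b = i a) {d : ℕ} {f : MvPolynomial (Fin d) k}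
    (φ : A →ₐ[k] Localization.Away f) (ψ : Localization.Away f →ₐ[k] K) (h : ψ.comp φ = i) :
    IsRetractRational k K := by
  obtain ⟨s, hs, hs'⟩ := exists_map_mem_awaySubalgebra hfrac ψ
  have hs0 : s ≠ 0 := fun h0 => hs (by rw [h0, map_zero])
  obtain ⟨ε, hε⟩ := exists_algEquiv_awaySubalgebra hi hs0
  have hψφ : ∀ x, ψ (φ x) = i x := fun x => DFunLike.congr_fun h x
  obtain ⟨⟨p, ⟨_, r, rfl⟩⟩, hp⟩ := IsLocalization.surj (Submonoid.powers f) (φ s)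
  let L := Localization.Away f
  let D := Localization.Away (algebraMap (MvPolynomial (Fin d) k) L p)
  have hD : IsLocalization.Away (f * p) D := IsLocalization.Away.mul' L D f p
  have hu : IsUnit (algebraMap (MvPolynomial (Fin d) k) (Localization.Away f) (f ^ r)) := by
    rw [map_pow]; exact (IsLocalization.Away.algebraMap_isUnit f).pow r
  have hφs : IsUnit (algebraMap L D (φ s)) := by
    have h1 : IsUnit (algebraMap L D (algebraMap _ L p)) :=
      IsLocalization.Away.algebraMap_isUnit _
    have h2 := congrArg (algebraMap L D) hp
    rw [map_mul] at h2
    exact isUnit_of_mul_isUnit_left (h2 ▸ h1)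
  let φ' : Localization.Away s →ₐ[k] D := IsLocalization.liftAlgHom (M := Submonoid.powers s)
    (f := (IsScalarTower.toAlgHom k L D).comp φ) (by
      rintro ⟨_, n, rfl⟩
      simpa using hφs.pow n)
  let R := awaySubalgebra i s
  let ψ₁ : L →ₐ[k] R := ψ.codRestrict R hs'
  have hψp : IsUnit (ψ₁ (algebraMap _ L p)) := by
    have h2 := congrArg ψ₁ hp
    rw [map_mul] at h2
    refine h2 ▸ IsUnit.mul ?_ (hu.map ψ₁)
    refine IsUnit.of_mul_eq_one ⟨_, inv_mem_awaySubalgebra hs⟩ (Subtype.ext ?_)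
    change ψ (φ s) * (i s)⁻¹ = 1
    rw [hψφ, mul_inv_cancel₀ hs]
  let ψ' : D →ₐ[k] R :=
    IsLocalization.liftAlgHom (M := Submonoid.powers (algebraMap (MvPolynomial (Fin d) k) L p))
    (f := ψ₁) (by
      rintro ⟨_, n, rfl⟩
      simpa using hψp.pow n)
  have hcomp : ψ'.comp φ' = (ε : Localization.Away s →ₐ[k] R) := by
    have h1 : ∀ x, φ' (algebraMap A _ x) = algebraMap L D (φ x) :=
      fun x => IsLocalization.lift_eq _ x
    have h2 : ∀ x, ψ' (algebraMap L _ x) = ψ₁ x :=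
      fun x => IsLocalization.lift_eq _ x
    refine IsLocalization.algHom_ext (Submonoid.powers s) ?_
    refine AlgHom.ext fun x => Subtype.ext ?_
    change (ψ' (φ' (algebraMap A _ x)) : K) = ε (algebraMap A _ x)
    rw [h1, h2, hε]
    exact hψφ x
  have hfr : IsFractionRing R K := IsFractionRing.of_field R K fun z => by
    obtain ⟨a, b, hb, hab⟩ := hfrac z
    exact ⟨⟨i a, map_mem_awaySubalgebra i s a⟩, ⟨i b, map_mem_awaySubalgebra i s b⟩,
      (eq_div_iff hb).2 hab⟩
  let δ : Localization.Away (f * p) ≃ₐ[k] D :=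
    (IsLocalization.algEquiv (Submonoid.powers (f * p)) (Localization.Away (f * p))
      D).restrictScalars k
  refine ⟨R, hfr, d, f * p, δ.symm.toAlgHom.comp (φ'.comp ε.symm.toAlgHom),
    ψ'.comp δ.toAlgHom, ?_⟩
  refine AlgHom.ext fun x => ?_
  change ψ' (δ (δ.symm (φ' (ε.symm x)))) = x
  rw [δ.apply_symm_apply]
  exact (DFunLike.congr_fun hcomp (ε.symm x)).trans (ε.apply_symm_apply x)

variable {k F : Type*} [Field k] [Field F] [Algebra k F]

/-- The value of the `j`th form at the `j`th column of `D'` is the diagonal entry `1` of `D * D'`.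
-/
theorem sum_smul_tmul_X_ne_zero {d : ℕ} {D D' : Matrix (Fin d) (Fin d) F} (hDD' : D * D' = 1)
    (j : Fin d) : ∑ i, D j i • ((1 : F) ⊗ₜ[k] (MvPolynomial.X i : MvPolynomial (Fin d) k)) ≠ 0 := by
  intro h
  let ev : F ⊗[k] MvPolynomial (Fin d) k →ₐ[F] F :=
    Algebra.TensorProduct.lift (AlgHom.id F F) (MvPolynomial.aeval fun i => D' i j)
      fun _ _ => .all _ _
  have h1 := congrArg ev h
  rw [map_sum, map_zero] at h1
  have h2 : ∀ i, ev (D j i • ((1 : F) ⊗ₜ[k] (MvPolynomial.X i : MvPolynomial (Fin d) k))) =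
      D j i * D' i j := fun i => by simp [ev]
  simp only [h2] at h1
  rw [← Matrix.mul_apply, hDD', Matrix.one_apply_eq] at h1
  exact one_ne_zero h1

/-- The dense open subset of affine space on which the linear forms given by the rows of an
equivariant matrix are invertible. -/
theorem exists_mvPolynomial_prod_eq [IsGalois k F] {d : ℕ} {a : Gal(F/k) →* Equiv.Perm (Fin d)}
    {D : Matrix (Fin d) (Fin d) F}
    (hD : ∀ (σ : Gal(F/k)) x i, σ (D x i) = D (a σ x) i) :
    ∃ f : MvPolynomial (Fin d) k,
      ∏ j, ∑ i, D j i • ((1 : F) ⊗ₜ[k] (MvPolynomial.X i : MvPolynomial (Fin d) k)) =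
        1 ⊗ₜ f := by
  refine exists_tmul_of_galTensor_fixed _ fun σ => ?_
  rw [map_prod]
  conv_rhs => rw [← Equiv.prod_comp (a σ)]
  refine Finset.prod_congr rfl fun j _ => ?_
  simp only [map_sum, galTensor_smul, galTensor_tmul, map_one, hD]

end Retract

/-! ### Invertible resolutions give retract rationality -/

section RetractConverse

variable {k F A K : Type u} [Field k] [Field F] [Algebra k F] [IsGalois k F] [CommRing A]
  [HopfAlgebra k A] [Field K] [Algebra k K] {n : ℕ}

/-- Hilbert 90 extends the generic point of `T` to `θ` on `E`, and `θ ∘ π` is a point of the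
permutation lattice `P`, with affine coordinates `w`. The tautological point `g` of the open set
where the linear forms are invertible, restricted to characters, defines `φ`; evaluation at `w` is
`ψ`. They compose to the generic point because `π ∘ ι` is the identity of `E`. -/
theorem isRetractRational_of_hasInvertibleResolution
    (e : (F ⊗[k] A) ≃ₐc[F] MonoidAlgebra F (Multiplicative (Fin n → ℤ))) [IsDomain A]
    {i : A →ₐ[k] K} (hi : Function.Injective i)
    (hfrac : ∀ z : K, ∃ a b : A, i b ≠ 0 ∧ z * i b = i a)
    (h : HasInvertibleResolution (characterRep k F A)) : IsRetractRational k K := by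
  have := isDomain_tensor_of_split e
  have : IsDomain (F ⊗[k] K) := isDomain_tensor_fraction hi hfrac
  obtain ⟨E, Q, _, _, ρE, ρQ, ⟨r⟩, ⟨P, _, ρP, ⟨hPd, d, b, a, hb⟩, ι, π, hπ⟩, hQ⟩ := h
  have hE : IsDiscreteRep ρE := hPd.of_injective ι (Function.LeftInverse.injective hπ)
  obtain ⟨θ, hθ⟩ := r.exists_extension_unitRep isField_tensor hE hQ
    ((unitRepMap F i).comp (characterToUnit k F A))
  obtain ⟨L, _, _, hL⟩ := IsPermutationLattice.exists_normal hPd hb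
  obtain ⟨D, D', hDD', hD'D, hD⟩ := exists_equivariant_matrix a L hL
  let z : Fin d → Additive (F ⊗[k] K)ˣ := fun j => θ (π (b j))
  obtain ⟨w, hw⟩ := exists_invariant_coordinates hDD' hD'D hD
    (fun j => ((z j).toMul : F ⊗[k] K)) fun σ j => by
      rw [← unitRep_apply]
      simp only [z]
      rw [← hb, Representation.IntertwiningMap.isIntertwining,
        Representation.IntertwiningMap.isIntertwining]
  obtain ⟨f, hf⟩ := exists_mvPolynomial_prod_eq (k := k) hD
  let ev : MvPolynomial (Fin d) k →ₐ[k] K := MvPolynomial.aeval w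
  have hev : ∀ j, extendScalars F ev (∑ i, D j i • ((1 : F) ⊗ₜ[k] MvPolynomial.X i)) =
      ((z j).toMul : F ⊗[k] K) := fun j => by
    rw [hw, map_sum]
    refine Finset.sum_congr rfl fun i _ => ?_
    rw [map_smul, Algebra.TensorProduct.map_tmul]
    simp [ev]
  have hfw : ev f ≠ 0 := fun h0 => by
    have h1 := congrArg (extendScalars F ev) hf
    rw [map_prod, Algebra.TensorProduct.map_tmul, h0, TensorProduct.tmul_zero,
      Finset.prod_eq_zero_iff] at h1
    obtain ⟨j, -, hj⟩ := h1
    rw [hev] at hj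
    exact (z j).toMul.ne_zero hj
  let B := Localization.Away f
  let τ : MvPolynomial (Fin d) k →ₐ[k] B := IsScalarTower.toAlgHom k _ _
  let ψ : B →ₐ[k] K := IsLocalization.liftAlgHom (M := Submonoid.powers f) (f := ev) (by
    rintro ⟨_, n, rfl⟩
    simpa using IsUnit.pow n hfw.isUnit)
  have hψ : ψ.comp τ = ev := AlgHom.ext fun x => IsLocalization.lift_eq _ x
  have hunit : ∀ j, IsUnit (extendScalars F τ (∑ i, D j i • ((1 : F) ⊗ₜ[k] MvPolynomial.X i))) := by
    have h1 : IsUnit (extendScalars F τ (1 ⊗ₜ f)) := by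
      rw [Algebra.TensorProduct.map_tmul]
      exact (IsLocalization.Away.algebraMap_isUnit (S := B) f).map
        (Algebra.TensorProduct.includeRight : B →ₐ[k] F ⊗[k] B)
    rw [← hf, map_prod] at h1
    exact fun j => isUnit_of_dvd_unit (Finset.dvd_prod_of_mem
      (fun j => extendScalars F τ (∑ i, D j i • ((1 : F) ⊗ₜ[k] MvPolynomial.X i)))
      (Finset.mem_univ j)) h1
  let l : Fin d → Additive (F ⊗[k] B)ˣ := fun j => Additive.ofMul (hunit j).unit
  obtain ⟨g, hg⟩ := hb.exists_intertwiningMap (ρN := unitRep k F B) l fun σ j =>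
    Additive.toMul.injective (Units.ext (by
      rw [unitRep_apply]
      change galTensor k F B σ (extendScalars F τ _) = extendScalars F τ _
      rw [galTensor_map]
      congr 1
      simp only [map_sum, galTensor_smul, galTensor_tmul, map_one, hD]))
  obtain ⟨φ, hφ⟩ := exists_algHom_of_intertwiningMap e (g.comp (ι.comp r.incl))
  refine isRetractRational_of_factorization hi hfrac φ ψ (algHom_ext_character e fun χ => ?_)
  have hψg : ∀ p, ((unitRepMap F ψ).comp g) p = (θ.comp π) p :=
    intertwiningMap_ext_basis b fun j => by
      change unitRepMap F ψ (g (b j)) = θ (π (b j))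
      rw [hg]
      refine Additive.toMul.injective (Units.ext ?_)
      rw [unitRepMap_apply]
      change extendScalars F ψ (extendScalars F τ _) = _
      rw [← extendScalars_comp_apply, hψ, hev]
  have h1 : unitRepMap F (ψ.comp φ) (characterToUnit k F A χ) =
      unitRepMap F ψ (unitRepMap F φ (characterToUnit k F A χ)) :=
    Additive.toMul.injective (Units.ext (extendScalars_comp_apply _ _ _))
  rw [h1, hφ]
  refine (hψg _).trans ?_
  change θ (π (ι (r.incl χ))) = _
  rw [hπ, hθ]
  rfl

end RetractConverse

end

noncomputable section

/-! ### Units defined over an intermediate field -/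

section RangeExtendScalars

variable {k F N : Type*} [Field k] [Field F] [Algebra k F] [Field N] [Algebra k N]
  (N' : IntermediateField k N)

theorem inv_mem_range_extendScalars [Algebra.IsAlgebraic k F] [IsDomain (F ⊗[k] N)]
    {u : (F ⊗[k] N)ˣ} (hu : (u : F ⊗[k] N) ∈ (extendScalars F N'.val).range) :
    ((u⁻¹ : (F ⊗[k] N)ˣ) : F ⊗[k] N) ∈ (extendScalars F N'.val).range := by
  have hinj : Function.Injective (extendScalars F N'.val) :=
    map_id_injective_of_injective N'.val.injective
  have : IsDomain (F ⊗[k] N') := hinj.isDomain _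
  obtain ⟨v, hv⟩ := hu
  have hv0 : v ≠ 0 := by
    rintro rfl
    exact u.ne_zero (hv.symm.trans (map_zero _))
  obtain ⟨v', hv'⟩ := (isField_tensor (k := k) (F := F) (K := N')).mul_inv_cancel hv0
  refine ⟨v', ?_⟩
  rw [← mul_one (u⁻¹ : (F ⊗[k] N)ˣ).1, Units.eq_inv_mul_iff_mul_eq]
  refine (congrArg (· * _) hv.symm).trans ?_
  exact (map_mul (extendScalars F N'.val) v v').symm.trans (by rw [hv', map_one])

/-- The preimage of `1 ⊗ x` in `F ⊗ N'` is Galois-fixed, so it has the form `1 ⊗ y` with `y` in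
`N'`. -/
theorem mem_of_tmul_mem_range_extendScalars [IsGalois k F] {x : N}
    (hx : (1 : F) ⊗ₜ[k] x ∈ (extendScalars F N'.val).range) : x ∈ N' := by
  have hinj : Function.Injective (extendScalars F N'.val) :=
    map_id_injective_of_injective N'.val.injective
  obtain ⟨u, hu⟩ := hx
  change extendScalars F N'.val u = _ at hu
  obtain ⟨y, rfl⟩ := exists_tmul_of_galTensor_fixed u fun σ => hinj (by
    rw [← galTensor_map, hu, galTensor_tmul, map_one])
  rw [Algebra.TensorProduct.map_tmul, map_one] at hu
  rw [← one_tmul_injective (k := k) F hu]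
  exact y.2

/-- The units of `F ⊗ N` that lie in `F ⊗ N'`. -/
def unitsOfRange [Algebra.IsAlgebraic k F] [IsDomain (F ⊗[k] N)] :
    AddSubgroup (Additive (F ⊗[k] N)ˣ) where
  carrier := {u | (u.toMul : F ⊗[k] N) ∈ (extendScalars F N'.val).range}
  add_mem' := fun {u v} hu hv => by
    change (u.toMul : F ⊗[k] N) * (v.toMul : F ⊗[k] N) ∈ (extendScalars F N'.val).range
    exact mul_mem hu hv
  zero_mem' := one_mem (extendScalars F N'.val).range
  neg_mem' := fun hu => inv_mem_range_extendScalars N' hu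

end RangeExtendScalars

theorem mem_of_basis_mem {X P U : Type*} [AddCommGroup P] [AddCommGroup U] (b : Module.Basis X ℤ P)
    (f : P →ₗ[ℤ] U) (S : AddSubgroup U) (h : ∀ x, f (b x) ∈ S) (m : P) : f m ∈ S := by
  have h1 : Submodule.span ℤ (Set.range b) ≤ (S.toIntSubmodule).comap f := by
    rw [Submodule.span_le]
    rintro _ ⟨x, rfl⟩
    exact h x
  exact h1 (b.mem_span m)

theorem Resolution.finrank_eq {G M E Q : Type*} [Group G] [AddCommGroup M] [AddCommGroup E]
    [AddCommGroup Q] [Module.Finite ℤ E] {ρM : Representation ℤ G M} {ρE : Representation ℤ G E}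
    {ρQ : Representation ℤ G Q} (r : Resolution ρM ρE ρQ) :
    Module.finrank ℤ E = Module.finrank ℤ M + Module.finrank ℤ Q := by
  have h := Submodule.finrank_quotient_add_finrank (LinearMap.ker r.proj.toLinearMap)
  rw [(LinearMap.quotKerEquivOfSurjective r.proj.toLinearMap r.proj_surjective).finrank_eq,
    r.exact.linearMap_ker_eq, LinearMap.finrank_range_of_inj r.incl_injective] at h
  rw [← h, add_comm]

/-! ### Transcendence degree of the function field -/

section TranscendenceDegree

variable {k F A : Type u} [Field k] [Field F] [Algebra k F] [CommRing A]
  [HopfAlgebra k A] {n : ℕ}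

/-- The `n` Laurent coordinates are algebraically independent over `k`, and `F ⊗ A` is algebraic
over `A`. Only this inequality is needed; generation by few elements supplies the other. -/
theorem le_trdeg_of_split [Algebra.IsAlgebraic k F]
    (e : (F ⊗[k] A) ≃ₐc[F] MonoidAlgebra F (Multiplicative (Fin n → ℤ))) :
    n ≤ Algebra.trdeg k A := by
  obtain ⟨t, ht⟩ := exists_algebraicIndependent e
  have := isDomain_tensor_of_split e
  let c : A ⊗[k] F ≃ₐ[k] F ⊗[k] A := Algebra.TensorProduct.comm k A F
  have : IsDomain (A ⊗[k] F) := c.injective.isDomain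
  have h0 : AlgebraicIndependent k t :=
    ht.restrictScalars (FaithfulSMul.algebraMap_injective k F)
  have h1 : AlgebraicIndependent k fun j => c.symm (t j) :=
    h0.map' (f := c.symm.toAlgHom) c.symm.injective
  have : Algebra.IsIntegral k F := Algebra.IsAlgebraic.isIntegral
  have hA : Function.Injective (algebraMap A (A ⊗[k] F)) :=
    Algebra.TensorProduct.includeLeft_injective (R := k) (S := A) (A := A) (B := F) (FaithfulSMul.algebraMap_injective k F)
  have : FaithfulSMul A (A ⊗[k] F) := (faithfulSMul_iff_algebraMap_injective _ _).2 hA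
  have : IsDomain A := hA.isDomain _
  have : Algebra.IsAlgebraic A (A ⊗[k] F) := Algebra.IsIntegral.isAlgebraic
  have h2 := trdeg_add_eq k A (A := A ⊗[k] F)
  rw [trdeg_eq_zero (R := A) (A := A ⊗[k] F), add_zero] at h2
  rw [h2]
  simpa using h1.lift_cardinalMk_le_trdeg

theorem le_trdeg_fractionRing [Algebra.IsAlgebraic k F] [IsDomain A] (q : ℕ)
    (e : (F ⊗[k] A) ≃ₐc[F] MonoidAlgebra F (Multiplicative (Fin n → ℤ))) :
    ((n + q : ℕ) : Cardinal) ≤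
      Algebra.trdeg k (FractionRing (MvPolynomial (Fin q) (FractionRing A))) := by
  obtain ⟨i, hi, -⟩ := exists_mvPolynomial_fraction (k := k) (σ := Fin q) (B := A)
  refine le_trans ?_ (trdeg_le_of_injective i hi)
  have := trdeg_add_eq k A (A := MvPolynomial (Fin q) A)
  rw [← this, MvPolynomial.trdeg_of_isDomain]
  simpa using le_trdeg_of_split e

end TranscendenceDegree

/-! ### Permutation resolutions give stable rationality -/

section StableConverse

/-- Generators no more numerous than the transcendence degree are algebraically independent. -/
theorem isStablyRational_of_adjoin_eq_top {k K : Type u} [Field k] [Field K] [Algebra k K] {q d : ℕ}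
    (w : Fin d → FractionRing (MvPolynomial (Fin q) K))
    (hw : IntermediateField.adjoin k (Set.range w) = ⊤)
    (hd : (d : Cardinal) ≤ Algebra.trdeg k (FractionRing (MvPolynomial (Fin q) K))) :
    IsStablyRational k K := by
  have : Algebra.IsAlgebraic (Algebra.adjoin k (Set.range w))
      (FractionRing (MvPolynomial (Fin q) K)) := ⟨fun x => by
    have hx : x ∈ IntermediateField.adjoin k (Set.range w) := hw ▸ trivial
    obtain ⟨a, ha, b, hb, rfl⟩ := IntermediateField.mem_adjoin_iff_div.1 hx
    exact (isAlgebraic_algebraMap (⟨a, ha⟩ : Algebra.adjoin k (Set.range w))).mul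
      (isAlgebraic_algebraMap (⟨b, hb⟩ : Algebra.adjoin k (Set.range w))).inv⟩
  have hi := (Algebra.IsAlgebraic.isTranscendenceBasis_of_lift_le_trdeg_of_finite k w
    (by simpa using hd)).1
  let K' := FractionRing (MvPolynomial (Fin d) k)
  -- The definition allows further variables on the rational side; none are needed.
  let c : MvPolynomial (Fin 0) K' ≃ₐ[k] K' :=
    (MvPolynomial.isEmptyAlgEquiv K' (Fin 0)).restrictScalars k
  let c' : FractionRing (MvPolynomial (Fin 0) K') ≃ₐ[k] K' :=
    IsFractionRing.algEquivOfAlgEquiv c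
  exact ⟨d, q, 0, ⟨(IntermediateField.topEquiv.symm.trans
    (IntermediateField.equivOfEq hw.symm)).trans (hi.aevalEquivField.symm.trans c'.symm)⟩⟩

variable {k F A : Type u} [Field k] [Field F] [Algebra k F] [IsGalois k F] [CommRing A]
  [HopfAlgebra k A] {n : ℕ}

/-- Dually, the torus of `E` is a torsor over `T` under the torus of `Q`, and Hilbert 90 gives it a
rational section, so it is birational to the product of `T` and the torus of `Q`. Here `θ` is the
section, `η` the generic point of the torus of `Q` in `q` new variables, and `Θ` combines them into
a point whose affine coordinates `w` generate `N`. -/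
theorem isStablyRational_of_hasPermutationResolution
    (e : (F ⊗[k] A) ≃ₐc[F] MonoidAlgebra F (Multiplicative (Fin n → ℤ))) [IsDomain A]
    (h : HasPermutationResolution (characterRep k F A)) :
    IsStablyRational k (FractionRing A) := by
  have := isDomain_tensor_of_split e
  obtain ⟨E, Q, _, _, ρE, ρQ, ⟨r⟩, ⟨hEd, d, b, a, hb⟩, hQ⟩ := h
  obtain ⟨hQd, q, b', a', hb'⟩ := id hQ
  let K := FractionRing A
  let N := FractionRing (MvPolynomial (Fin q) K)
  let i : A →ₐ[k] K := IsScalarTower.toAlgHom k A K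
  let κ : K →ₐ[k] N := (IsScalarTower.toAlgHom k (MvPolynomial (Fin q) K) N).comp
    (IsScalarTower.toAlgHom k K (MvPolynomial (Fin q) K))
  have hi : Function.Injective i := IsFractionRing.injective A K
  have : IsDomain (F ⊗[k] K) := isDomain_tensor_fraction hi fun z => by
    obtain ⟨a, b, hb, rfl⟩ := IsFractionRing.div_surjective (A := A) z
    have hb' : i b ≠ 0 := (map_ne_zero_iff _ hi).2 (nonZeroDivisors.ne_zero hb)
    exact ⟨a, b, hb', div_mul_cancel₀ (i a) hb'⟩
  have : IsDomain (F ⊗[k] N) := by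
    obtain ⟨j, hj, hj'⟩ := exists_mvPolynomial_fraction (k := k) (σ := Fin q) (B := A)
    have := isDomain_tensor_mvPolynomial (m := q) e
    exact isDomain_tensor_fraction hj hj'
  -- the units of `F ⊗ N` given by the permuted variables
  let τ : MvPolynomial (Fin q) k →ₐ[k] N := (IsScalarTower.toAlgHom k (MvPolynomial (Fin q) K)
    N).comp (MvPolynomial.mapAlgHom (Algebra.ofId k K))
  have hτ : Function.Injective τ := (IsFractionRing.injective (MvPolynomial (Fin q) K) N).comp
    (MvPolynomial.map_injective _ (algebraMap k K).injective)
  obtain ⟨L', _, _, hL'⟩ := IsPermutationLattice.exists_normal hQd hb'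
  obtain ⟨S, S', hSS', hS'S, hS⟩ := exists_equivariant_matrix a' L' hL'
  let x : Fin q → F ⊗[k] N := fun j => extendScalars F τ
    (∑ i, S j i • ((1 : F) ⊗ₜ[k] MvPolynomial.X i))
  have hx0 : ∀ j, IsUnit (x j) := fun j => by
    obtain ⟨y, hy⟩ := (isField_tensor (k := k) (F := F) (K := N)).mul_inv_cancel
      ((map_ne_zero_iff _ (map_id_injective_of_injective hτ)).2
        (sum_smul_tmul_X_ne_zero (k := k) hSS' j) : x j ≠ 0)
    exact IsUnit.of_mul_eq_one y hy
  obtain ⟨η, hη⟩ := hb'.exists_intertwiningMap (ρN := unitRep k F N)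
    (fun j => Additive.ofMul (hx0 j).unit) fun σ j =>
    Additive.toMul.injective (Units.ext (by
      rw [unitRep_apply]
      change galTensor k F N σ (extendScalars F τ _) = extendScalars F τ _
      rw [galTensor_map]
      congr 1
      simp only [map_sum, galTensor_smul, galTensor_tmul, map_one, hS]))
  obtain ⟨θ, hθ⟩ := r.exists_extension_unitRep isField_tensor hEd hQ.isInvertibleLattice
    ((unitRepMap F i).comp (characterToUnit k F A))
  let Θ : ρE.IntertwiningMap (unitRep k F N) := (unitRepMap F κ).comp θ + η.comp r.proj
  obtain ⟨L, _, _, hL⟩ := IsPermutationLattice.exists_normal hEd hb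
  obtain ⟨D, D', hDD', hD'D, hD⟩ := exists_equivariant_matrix a L hL
  obtain ⟨w, hw⟩ := exists_invariant_coordinates hDD' hD'D hD
    (fun j => ((Θ (b j)).toMul : F ⊗[k] N)) fun σ j => by
      rw [← unitRep_apply]
      rw [← hb, Representation.IntertwiningMap.isIntertwining]
  refine isStablyRational_of_adjoin_eq_top w ?_ ?_
  · let N' := IntermediateField.adjoin k (Set.range w)
    let U := unitsOfRange (F := F) N'
    have hΘ : ∀ m, Θ m ∈ U := mem_of_basis_mem b Θ.toLinearMap U fun j => by
      change ((Θ (b j)).toMul : F ⊗[k] N) ∈ (extendScalars F N'.val).range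
      rw [hw]
      refine sum_mem fun i _ => Subalgebra.smul_mem _ ?_ _
      exact ⟨1 ⊗ₜ ⟨w i, IntermediateField.subset_adjoin _ _ ⟨i, rfl⟩⟩, by simp⟩
    have hχ : ∀ x : F ⊗[k] A,
        extendScalars F (κ.comp i) x ∈ (extendScalars F N'.val).range := fun x => by
      have h1 : Submodule.span F (Set.range (GroupLike.val (R := F) (A := F ⊗[k] A))) ≤
          (Subalgebra.toSubmodule (extendScalars F N'.val).range).comap
            (extendScalars F (κ.comp i)).toLinearMap := by
        rw [Submodule.span_le]
        rintro _ ⟨χ, rfl⟩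
        have h2 := hΘ (r.incl (Additive.ofMul χ))
        -- On `M` the `η`-part vanishes and `Θ` is the generic point of `T`; so `N'` contains `A`,
        -- and then `K`.
        have h3 : Θ (r.incl (Additive.ofMul χ)) =
            unitRepMap F κ (unitRepMap F i (characterToUnit k F A (Additive.ofMul χ))) := by
          change unitRepMap F κ (θ _) + η (r.proj _) = _
          rw [hθ, (r.proj_eq_zero_iff _).2 ⟨_, rfl⟩, map_zero, add_zero]
          rfl
        rw [h3] at h2
        change extendScalars F (κ.comp i) χ.val ∈ (extendScalars F N'.val).range
        rw [extendScalars_comp_apply]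
        exact h2
      rw [span_groupLike_eq_top e] at h1
      exact h1 (Submodule.mem_top (x := x))
    have hA : ∀ x : A, κ (i x) ∈ N' := fun x =>
      mem_of_tmul_mem_range_extendScalars (F := F) N' (by simpa using hχ (1 ⊗ₜ x))
    have hK : ∀ x : K, κ x ∈ N' := fun x => by
      obtain ⟨a, b, -, rfl⟩ := IsFractionRing.div_surjective (A := A) x
      rw [map_div₀]
      exact div_mem (hA a) (hA b)
    have hFK : ∀ x : F ⊗[k] K, extendScalars F κ x ∈ (extendScalars F N'.val).range := fun x => by
      induction x with
      | zero => rw [map_zero]; exact zero_mem _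
      | tmul c x => exact ⟨c ⊗ₜ ⟨κ x, hK x⟩, by simp⟩
      | add x y hx hy => rw [map_add]; exact add_mem hx hy
    -- With `K` inside `N'`, the `θ`-part can be divided out of `Θ`. This leaves the linear forms in
    -- the new variables, which `S'` solves for the variables.
    have hηU : ∀ m, η m ∈ U := fun m => by
      obtain ⟨m, rfl⟩ := r.proj_surjective m
      have h1 : unitRepMap F κ (θ m) ∈ U := hFK _
      have h2 := sub_mem (hΘ m) h1
      have h3 : Θ m = unitRepMap F κ (θ m) + η (r.proj m) := rfl
      rwa [h3, add_sub_cancel_left] at h2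
    have hxU : ∀ j, x j ∈ (extendScalars F N'.val).range := fun j => by
      have := hηU (b' j)
      rw [hη] at this
      exact this
    have hy : ∀ l, τ (MvPolynomial.X l) ∈ N' := fun l => by
      refine mem_of_tmul_mem_range_extendScalars (F := F) N' ?_
      have h1 : (1 : F) ⊗ₜ[k] τ (MvPolynomial.X l) = ∑ j, S' l j • x j := by
        have h2 : (∑ j, S' l j • ∑ i, S j i • ((1 : F) ⊗ₜ[k] τ (MvPolynomial.X i))) =
            ∑ i, (S' * S) l i • ((1 : F) ⊗ₜ[k] τ (MvPolynomial.X i)) := by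
          simp only [Finset.smul_sum, smul_smul, Matrix.mul_apply, Finset.sum_smul]
          exact Finset.sum_comm
        simp only [x, map_sum, map_smul, Algebra.TensorProduct.map_tmul, map_one]
        rw [h2, hS'S]
        simp [Matrix.one_apply, ite_smul]
      rw [h1]
      exact sum_mem fun j _ => Subalgebra.smul_mem _ (hxU j) _
    have hpoly : ∀ p : MvPolynomial (Fin q) K, algebraMap _ N p ∈ N' := fun p => by
      induction p using MvPolynomial.induction_on with
      | C x => exact hK x
      | add p p' hp hp' => rw [map_add]; exact add_mem hp hp'
      | mul_X p l hp =>
        rw [map_mul]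
        refine mul_mem hp ?_
        have : τ (MvPolynomial.X l) = algebraMap (MvPolynomial (Fin q) K) N (MvPolynomial.X l) :=
          congrArg (algebraMap (MvPolynomial (Fin q) K) N) (MvPolynomial.map_X (algebraMap k K) l)
        rw [← this]
        exact hy l
    rw [eq_top_iff]
    intro x _
    obtain ⟨a, b, -, rfl⟩ := IsFractionRing.div_surjective (A := MvPolynomial (Fin q) K) x
    exact div_mem (hpoly a) (hpoly b)
  -- Rank count in the resolution: `d = n + q`, which the transcendence degree of `N` is at least.
  · have : Module.Finite ℤ E := Module.Finite.of_basis b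
    obtain ⟨g⟩ := nonempty_groupLike_equiv e
    have h1 : Module.finrank ℤ (Additive (Character k F A)) = n := by
      have g' : Additive (Character k F A) ≃+ (Fin n → ℤ) := AddEquiv.toMultiplicativeRight.symm g
      rw [g'.toIntLinearEquiv.finrank_eq]
      simp
    have h2 := r.finrank_eq
    rw [h1, Module.finrank_eq_card_basis b, Module.finrank_eq_card_basis b', Fintype.card_fin,
      Fintype.card_fin] at h2
    rw [h2]
    exact le_trdeg_fractionRing q e

end StableConverse

end

/-! ### The theorem on tensor products -/

theorem theorem6p15 {k : Type u} [Field k] (T₁ T₂ T : AlgebraicTorus k)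
    (hT : AlgebraicTorus.IsTensorProduct T₁ T₂ T)
    (hcop : Nat.Coprime (permutationOrder T₁.characterLattice)
      (permutationOrder T₂.characterLattice)) :
    (IsStablyRational k T₁.functionField → IsStablyRational k T₂.functionField →
        IsStablyRational k T.functionField) ∧
      (IsRetractRational k T₁.functionField → IsRetractRational k T₂.functionField →
        IsRetractRational k T.functionField) := by
  obtain ⟨ε⟩ := hT
  obtain ⟨n, ⟨e⟩⟩ := T.splits
  refine ⟨fun h₁ h₂ => ?_, fun h₁ h₂ => ?_⟩
  · exact isStablyRational_of_hasPermutationResolution e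
      ((h₁.hasPermutationResolution.tprod h₂.hasPermutationResolution hcop).congr ε)
  · have hi : Function.Injective (IsScalarTower.toAlgHom k T.coordRing T.functionField) :=
      IsFractionRing.injective _ _
    refine isRetractRational_of_hasInvertibleResolution e hi (fun z => ?_)
      ((h₁.hasRetractResolution.tprod h₂.hasRetractResolution hcop).congr ε)
    obtain ⟨a, b, hb, rfl⟩ := IsFractionRing.div_surjective (A := T.coordRing) z
    have hb' : IsScalarTower.toAlgHom k T.coordRing T.functionField b ≠ 0 :=
      (map_ne_zero_iff _ hi).2 (nonZeroDivisors.ne_zero hb)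
    exact ⟨a, b, hb', div_mul_cancel₀
      (IsScalarTower.toAlgHom k T.coordRing T.functionField a) hb'⟩
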